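/- Let $n\ge 1$, let $a_1,\dots,a_n\ge 2$ be integers, and let $w$ be an atomic invertible polynomial in $x_1,\dots,x_n$: either a chain $w=\sum_{i=1}^{n-1}x_i^{a_i}x_{i+1}+x_n^{a_n}$ (for $n=1$: the Fermat polynomial $x_1^{a_1}$) or a loop $w=\sum_{i=1}^{n-1}x_i^{a_i}x_{i+1}+x_n^{a_n}x_1$. Let $E$ be its exponent matrix, so that $w=\sum_i\prod_j x_j^{E_{ij}}$, and let $w^T=\sum_i\prod_j x_j^{E_{ji}}$. **B-side.** For a polynomial $v$ with an isolated critical point at $0$ let $\mathscr Q_v=\mathbb C[[x]]/(\partial_1v,\dots,\partial_nv)$ and let $\mathrm{Res}_v(f)$ be the Grothendieck residue of $f\,dx_1\wedge\dots\wedge dx_n$ with respect to $\partial_1v,\dots,\partial_nv$. The set $\mathfrak B$ of standard vectors consists, for a loop, of the $m\in\mathbb N^n$ with $0\le m_i<a_i$ for all $i$. For a chain $\mathfrak B=\bigsqcup_{0\le k\le n/2}\mathfrak B^k$, where $m\in\mathfrak B^k$ iff $m_{n-2i}=a_{n-2i}-1$ and $m_{n-2i-1}=0$ for $0\le i<k$,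 $0\le m_j<a_j$ for $j<n-2k$, and $0\le m_{n-2k}<a_{n-2k}-1$ (if $2k<n$). The socle monomial $\mathrm{soc}$ is $\prod_i x_i^{a_i-1}$ for a loop and $x_n^{a_n-2}\prod_{i<n}x_i^{a_i-1}$ for a chain. The normalized residue pairing on $\mathscr Q_{w^T}$ is $\widetilde{\mathrm{Res}}_{w^T}(f,g)=\mathrm{Res}_{w^T}(fg)/\mathrm{Res}_{w^T}(\mathrm{soc})$. **A-side.** Let $G_w\subset(\mathbb C^*)^n$ be the group of diagonal symmetries of $w$, let $w_\gamma$ be the restriction of $w$ to the fixed subspace $V^\gamma$ of $\gamma\in G_w$, and for a polynomial $v$ in $N$ variables let $H(v)=\Omega^N/(dv\wedge\Omega^{N-1})=\mathscr Q_v\cdot dx_1\wedge\dots\wedge dx_N$. The state space is $\mathscr H(w,G_w)=\bigoplus_{\gamma\in G_w}H(w_\gamma)^{G_w}$. Its pairing $\langle\cdot,\cdot\rangle$ pairs the sector of $\gamma$ only with that of $\gamma^{-1}$, by $$\langle x,y\rangle=\langle\zeta_*x,y\rangle_{w_\gamma},\qquad \langle f\omega,g\omega\rangle_{w_\gamma}=(-1)^{\binom{N}{2}}\mathrm{Res}_{w_\gamma}(fg),\quad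 N=\dim V^\gamma,$$ where $\omega$ is the wedge product, in increasing order, of the $dx_j$ for the coordinates of $V^\gamma$, $\zeta=(e^{\pi iq_1},\dots,e^{\pi iq_n})$ and $q_i=\sum_j(E^{-1})_{ij}$. **Mirror map.** Let $\rho_j=(e^{2\pi i(E^{-1})_{1j}},\dots,e^{2\pi i(E^{-1})_{nj}})\in G_w$ and $\mathfrak I(m)=\prod_j\rho_j^{m_j+1}$. For a Koszul matrix factorization $K=\bigotimes_k\{\alpha_k,\beta_k\}$ with differential $\delta=\sum_k(\alpha_k e_k\wedge+\beta_k\iota(e_k))$ on the exterior algebra generated by the $e_k$, over the ring of polynomials in the coordinates $x_{j_1},\dots,x_{j_N}$ ($j_1<\dots<j_N$) of $V^\gamma$, put $\mathrm{Ch}(K)=\mathrm{str}(\partial_{j_N}\delta\cdots\partial_{j_1}\delta)\,\omega\in H(w_\gamma)$. Let $K_j=\{-(x_j^{a_j}+x_{j+1}^{a_{j+1}-1}x_{j+2}),\,x_{j+1}\}$, where indices are read modulo $n$ for a loop and $x_{n+1}=1$ for a chain. The mirror map $\theta$ is a linear map $\mathscr Q_{w^T}\to\mathscr H(w,G_w)$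 such that * if $m\in\mathfrak B$ and $V^{\mathfrak I(m)}=0$, then $\theta(x^m)$ is the generator $1$ of the sector $H(w_{\mathfrak I(m)})=\mathbb C$ of $\mathfrak I(m)$; * if $w$ is a loop and $n$ is even, then $\theta(x^{m^{\rm odd}})=\mathrm{Ch}(\bigotimes_{j\text{ even}}K_j)$ and $\theta(x^{m^{\rm even}})=\mathrm{Ch}(\bigotimes_{j\text{ odd}}K_j)$ in the sector of $\mathfrak I(m^{\rm odd})=\mathfrak I(m^{\rm even})=1$, with $1\le j\le n$, where $m^{\rm odd}_i=a_i-1$ for $i$ odd and $0$ for $i$ even, and $m^{\rm even}_i=0$ for $i$ odd and $a_i-1$ for $i$ even; * if $w$ is a chain and $m\in\mathfrak B^k$ with $k\ge1$, then $\theta(x^m)=\mathrm{Ch}(K_{n-2k+1}\otimes K_{n-2k+3}\otimes\dots\otimes K_{n-1})$ in the sector of $\mathfrak I(m)$. **Claim.** There is exactly one such linear map $\theta$, and it carries the normalized residue pairing to the pairing of the state space: for all $m,m'\in\mathfrak B$ $$\widetilde{\mathrm{Res}}_{w^T}(x^m,x^{m'})=\langle\theta(x^m),\theta(x^{m'})\rangle,$$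 and hence $\widetilde{\mathrm{Res}}_{w^T}(f,g)=\langle\theta(f),\theta(g)\rangle$ for all $f,g\in\mathscr Q_{w^T}$. -/

import Mathlib

/-! ## Milnor rings and the Grothendieck residue -/

namespace LGMirror

noncomputable section

section Singularity

variable {σ : Type*} [Fintype σ] [DecidableEq σ]

/-- The Jacobian ideal `⟨∂ᵢ w⟩` in `ℂ⟦x⟧`. -/
def jacobianIdeal (w : MvPolynomial σ ℂ) : Ideal (MvPowerSeries σ ℂ) :=
  Ideal.span (Set.range fun i => ((MvPolynomial.pderiv i w : MvPolynomial σ ℂ) :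
    MvPowerSeries σ ℂ))

/-- The Milnor ring `ℂ⟦x⟧ / ⟨∂ᵢ w⟩`. -/
abbrev MilnorRing (w : MvPolynomial σ ℂ) : Type _ :=
  MvPowerSeries σ ℂ ⧸ jacobianIdeal w

/-- A way to write powers `xᵢ ^ (Nᵢ + 1)` as combinations `∑ⱼ Cᵢⱼ fⱼ`. It exists exactly when the
`fⱼ` generate an ideal of finite codimension. -/
structure ResidueData (f : σ → MvPowerSeries σ ℂ) where
  N : σ →₀ ℕ
  C : Matrix σ σ (MvPowerSeries σ ℂ)
  eq : ∀ i, (MvPowerSeries.X i : MvPowerSeries σ ℂ) ^ (N i + 1) = ∑ j, C i j * f j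

/-- `g ↦` the coefficient of `∏ xᵢ ^ Nᵢ` in `det C * g`. -/
def ResidueData.functional {f : σ → MvPowerSeries σ ℂ} (d : ResidueData f) :
    MvPowerSeries σ ℂ →ₗ[ℂ] ℂ :=
  MvPowerSeries.coeff d.N ∘ₗ LinearMap.mulLeft ℂ d.C.det

open Classical in
/-- The Grothendieck residue symbol `Res [g dx₁ ⋯ dxₙ ; f₁, …, fₙ]` as a function of `g`.
It is computed with the transformation law
`Res [g dx ; f₁, …, fₙ] = Res [det C * g dx ; x₁ ^ (N₁ + 1), …, xₙ ^ (Nₙ + 1)]` for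
`xᵢ ^ (Nᵢ + 1) = ∑ⱼ Cᵢⱼ fⱼ` and the fact that the right-hand side is a coefficient; the value does
not depend on `N` and `C`. -/
def grothendieckResidue (f : σ → MvPowerSeries σ ℂ) : MvPowerSeries σ ℂ →ₗ[ℂ] ℂ :=
  if h : Nonempty (ResidueData f) then h.some.functional else 0

theorem ResidueData.functional_mul {f : σ → MvPowerSeries σ ℂ} (d : ResidueData f)
    (g : MvPowerSeries σ ℂ) (j : σ) : d.functional (g * f j) = 0 := by
  have h1 : d.C.mulVec f = fun i => (MvPowerSeries.X i : MvPowerSeries σ ℂ) ^ (d.N i + 1) := by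
    funext i
    rw [d.eq i]
    rfl
  have h2 : d.C.det * f j = ∑ i, d.C.adjugate j i *
      (MvPowerSeries.X i : MvPowerSeries σ ℂ) ^ (d.N i + 1) := by
    have h3 : d.C.adjugate.mulVec (d.C.mulVec f) = d.C.det • f := by
      rw [Matrix.mulVec_mulVec, Matrix.adjugate_mul, Matrix.smul_mulVec, Matrix.one_mulVec]
    have h4 := congrFun h3 j
    rw [h1] at h4
    simpa [Matrix.mulVec, dotProduct] using h4.symm
  have h5 : d.C.det * (g * f j) = ∑ i, (MvPowerSeries.X i : MvPowerSeries σ ℂ) ^ (d.N i + 1) *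
      (g * d.C.adjugate j i) := by
    rw [mul_left_comm, h2, Finset.mul_sum]
    exact Finset.sum_congr rfl fun i _ => by ring
  simp only [ResidueData.functional, LinearMap.comp_apply, LinearMap.mulLeft_apply, h5, map_sum]
  refine Finset.sum_eq_zero fun i _ => ?_
  exact (MvPowerSeries.X_pow_dvd_iff.mp (Dvd.intro _ rfl)) d.N (Nat.lt_succ_self _)

theorem grothendieckResidue_eq_zero (f : σ → MvPowerSeries σ ℂ) (g : MvPowerSeries σ ℂ)
    (hg : g ∈ Ideal.span (Set.range f)) : grothendieckResidue f g = 0 := by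
  unfold grothendieckResidue
  split_ifs with h
  · induction hg using Submodule.span_induction with
    | mem x hx =>
      obtain ⟨j, rfl⟩ := hx
      simpa using h.some.functional_mul 1 j
    | zero => simp
    | add x y _ _ hx hy => rw [map_add, hx, hy, add_zero]
    | smul a x hx _ =>
      obtain ⟨c, rfl⟩ := (Ideal.mem_span_range_iff_exists_fun).mp hx
      rw [smul_eq_mul, Finset.mul_sum, map_sum]
      exact Finset.sum_eq_zero fun j _ => by
        rw [← mul_assoc]
        exact h.some.functional_mul _ j
  · rfl

/-- `Res_w`: the residue `f ↦ Res [f dx₁ ⋯ dxₙ ; ∂₁ w, …, ∂ₙ w]` on the Milnor ring. -/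
def milnorResidue (w : MvPolynomial σ ℂ) : MilnorRing w →ₗ[ℂ] ℂ :=
  (Submodule.liftQ ((jacobianIdeal w).restrictScalars ℂ)
    (grothendieckResidue fun i => ((MvPolynomial.pderiv i w : MvPolynomial σ ℂ) :
      MvPowerSeries σ ℂ))
    (fun g hg => grothendieckResidue_eq_zero _ g hg)) ∘ₗ
  (Submodule.Quotient.restrictScalarsEquiv ℂ (jacobianIdeal w)).symm.toLinearMap

/-! ### Diagonal transformations -/

/-- `w(t x) = c w(x)` for all `x`. -/
def IsSemiInvariant (w : MvPolynomial σ ℂ) (t : σ → ℂˣ) (c : ℂˣ) : Prop :=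
  ∀ x : σ → ℂ, MvPolynomial.eval (fun i => (t i : ℂ) * x i) w = c * MvPolynomial.eval x w

/-- The group `Γ_w` of diagonal transformations preserving `w` up to a scalar. -/
def scalingGroup (w : MvPolynomial σ ℂ) : Subgroup (σ → ℂˣ) where
  carrier := {t | ∃ c, IsSemiInvariant w t c}
  one_mem' := ⟨1, fun x => by simp⟩
  mul_mem' := by
    rintro s t ⟨c, hc⟩ ⟨d, hd⟩
    refine ⟨c * d, fun x => ?_⟩
    have := hc (fun i => (t i : ℂ) * x i)
    simp only [Pi.mul_apply, Units.val_mul, mul_assoc]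
    rw [this, hd x]
  inv_mem' := by
    rintro t ⟨c, hc⟩
    refine ⟨c⁻¹, fun x => ?_⟩
    have := hc (fun i => ((t⁻¹) i : ℂˣ) * x i)
    simp only [Pi.inv_apply, Units.mul_inv_cancel_left] at this
    rw [this, Units.inv_mul_cancel_left]
    rfl

/-- The group `G_w` of diagonal symmetries of `w`. -/
def symmetryGroup (w : MvPolynomial σ ℂ) : Subgroup (σ → ℂˣ) where
  carrier := {t | IsSemiInvariant w t 1}
  one_mem' := fun x => by simp
  mul_mem' := by
    intro s t hs ht x
    have := hs (fun i => (t i : ℂ) * x i)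
    simp only [Pi.mul_apply, Units.val_mul, mul_assoc]
    rw [this, ht x]
    simp
  inv_mem' := by
    intro t ht x
    have := ht (fun i => ((t⁻¹) i : ℂˣ) * x i)
    simp only [Pi.inv_apply, Units.mul_inv_cancel_left] at this
    rw [this]
    simp

theorem symmetryGroup_le {σ : Type*} (w : MvPolynomial σ ℂ) : symmetryGroup w ≤ scalingGroup w :=
  fun _ ht => ⟨1, ht⟩

theorem coe_scale (t : σ → ℂˣ) (p : MvPolynomial σ ℂ) :
    ((MvPolynomial.aeval (fun i => MvPolynomial.C (t i : ℂ) * MvPolynomial.X i) p :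
      MvPolynomial σ ℂ) : MvPowerSeries σ ℂ) =
    MvPowerSeries.rescaleAlgHom (fun i => (t i : ℂ)) (p : MvPowerSeries σ ℂ) := by
  induction p using MvPolynomial.induction_on with
  | C a =>
    simp only [MvPolynomial.aeval_C, MvPolynomial.algebraMap_eq, MvPolynomial.coe_C]
    exact ((MvPowerSeries.rescaleAlgHom (fun i => (t i : ℂ))).commutes a).symm
  | add p q hp hq => rw [map_add, MvPolynomial.coe_add, MvPolynomial.coe_add, map_add, hp, hq]
  | mul_X p i hp =>
    simp only [map_mul, MvPolynomial.aeval_X, MvPolynomial.coe_mul, hp, MvPolynomial.coe_X,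
      MvPolynomial.coe_C]
    congr 1
    rw [MvPowerSeries.rescaleAlgHom_apply]
    ext m
    rw [MvPowerSeries.coeff_rescale, MvPowerSeries.coeff_C_mul, MvPowerSeries.coeff_X]
    split_ifs with h
    · subst h
      simp
    · simp

theorem pderiv_scale (t : σ → ℂˣ) (p : MvPolynomial σ ℂ) (j : σ) :
    MvPolynomial.pderiv j (MvPolynomial.aeval
      (fun i => MvPolynomial.C (t i : ℂ) * MvPolynomial.X i) p) =
    MvPolynomial.C (t j : ℂ) * MvPolynomial.aeval
      (fun i => MvPolynomial.C (t i : ℂ) * MvPolynomial.X i) (MvPolynomial.pderiv j p) := by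
  induction p using MvPolynomial.induction_on with
  | C a => simp [MvPolynomial.algebraMap_eq]
  | add p q hp hq => rw [map_add, map_add, map_add, map_add, hp, hq, mul_add]
  | mul_X p i hp =>
    simp only [map_mul, MvPolynomial.aeval_X, Derivation.leibniz, hp, MvPolynomial.pderiv_X,
      MvPolynomial.pderiv_C, smul_eq_mul, mul_zero, add_zero, map_add]
    by_cases hij : i = j
    · subst hij
      simp
      ring
    · simp [hij]
      ring

theorem jacobianIdeal_le_comap (w : MvPolynomial σ ℂ) {t : σ → ℂˣ} (ht : t ∈ scalingGroup w) :
    jacobianIdeal w ≤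
      (jacobianIdeal w).comap (MvPowerSeries.rescaleAlgHom fun i => (t i : ℂ)) := by
  obtain ⟨c, hc⟩ := ht
  have h1 : MvPolynomial.aeval (fun i => MvPolynomial.C (t i : ℂ) * MvPolynomial.X i) w =
      MvPolynomial.C (c : ℂ) * w := by
    refine MvPolynomial.funext fun x => ?_
    have h2 := hc x
    rw [map_mul, MvPolynomial.eval_C, ← h2]
    change (MvPolynomial.eval x) (MvPolynomial.bind₁ _ w) = _
    rw [← MvPolynomial.coe_aeval_eq_eval, RingHom.coe_coe, MvPolynomial.aeval_bind₁]
    simp [MvPolynomial.aeval_eq_eval]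
  refine Ideal.span_le.mpr ?_
  rintro _ ⟨j, rfl⟩
  simp only [SetLike.mem_coe, Ideal.mem_comap]
  have h3 := pderiv_scale t w j
  rw [h1, MvPolynomial.pderiv_C_mul] at h3
  have h4 : MvPolynomial.aeval (fun i => MvPolynomial.C (t i : ℂ) * MvPolynomial.X i)
      (MvPolynomial.pderiv j w) =
      MvPolynomial.C (((t j)⁻¹ : ℂˣ) * (c : ℂ)) * MvPolynomial.pderiv j w := by
    rw [MvPolynomial.C_mul, mul_assoc, h3]
    rw [← mul_assoc, ← MvPolynomial.C_mul, Units.inv_mul, MvPolynomial.C_1, one_mul]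
  rw [← coe_scale, h4, MvPolynomial.coe_mul]
  exact Ideal.mul_mem_left _ _ (Ideal.subset_span ⟨j, rfl⟩)

/-- The space `H(w) = Ωⁿ / (dw ∧ Ωⁿ⁻¹)` of top-degree forms. The class of the form
`f dx₁ ∧ ⋯ ∧ dxₙ` is represented by the class of `f` in the Milnor ring. -/
abbrev FormSpace (w : MvPolynomial σ ℂ) : Type _ := MilnorRing w

/-- The push-forward `t_* = (t⁻¹)^*` of forms along a diagonal transformation:
`t_* (f dx₁ ∧ ⋯ ∧ dxₙ) = (∏ tᵢ⁻¹) f(t⁻¹ x) dx₁ ∧ ⋯ ∧ dxₙ`. -/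
def pushForward (w : MvPolynomial σ ℂ) (t : σ → ℂˣ) (ht : t ∈ scalingGroup w) :
    FormSpace w →ₗ[ℂ] FormSpace w :=
  ((∏ i, (t i)⁻¹ : ℂˣ) : ℂ) • (Ideal.quotientMapₐ (jacobianIdeal w)
    (MvPowerSeries.rescaleAlgHom fun i => ((t⁻¹) i : ℂ))
    (jacobianIdeal_le_comap w (inv_mem ht))).toLinearMap

/-- The canonical form `⟨f ω, g ω⟩_w = (-1) ^ (n choose 2) Res_w (f g ω)` on `H(w)`. -/
def canonicalPairing (w : MvPolynomial σ ℂ) : FormSpace w →ₗ[ℂ] FormSpace w →ₗ[ℂ] ℂ :=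
  ((-1 : ℂ) ^ (Fintype.card σ).choose 2) •
    (LinearMap.mul ℂ (MilnorRing w)).compr₂ (milnorResidue w)

end Singularity

/-! ### Koszul matrix factorizations and their Chern characters -/

section Koszul

/-- The differential `δ = ∑ₖ (αₖ eₖ ∧ · + βₖ ι(eₖ))` of the Koszul matrix factorization
`{α₁, β₁} ⊗ ⋯ ⊗ {αᵣ, βᵣ}` on the exterior algebra of a free module of rank `r`, in the basis
`e_S = e_{s₁} ∧ e_{s₂} ∧ ⋯` (`s₁ < s₂ < ⋯`) indexed by the subsets `S`. It squares to `∑ αₖ βₖ`.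
The entry `(T, S)` is the coefficient of `e_T` in `δ e_S`. -/
def koszulDifferential {R : Type*} [CommRing R] {r : ℕ} (α β : Fin r → R) :
    Matrix (Finset (Fin r)) (Finset (Fin r)) R :=
  fun T S => ∑ k, (-1 : R) ^ (S.filter (· < k)).card *
    ((if k ∉ S ∧ T = insert k S then α k else 0) + (if k ∈ S ∧ T = S.erase k then β k else 0))

/-- The supertrace for the grading of the exterior algebra by the parity of `S`. -/
def superTrace {R : Type*} [CommRing R] {r : ℕ}
    (M : Matrix (Finset (Fin r)) (Finset (Fin r)) R) : R :=
  ∑ S, (-1 : R) ^ S.card * M S S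

/-- The coefficient `str (∂ₙ δ ⋯ ∂₁ δ)` of `dx₁ ∧ ⋯ ∧ dxₙ` in the Chern character of the Koszul
matrix factorization `{α₁, β₁} ⊗ ⋯ ⊗ {αᵣ, βᵣ}`. -/
def koszulChern {σ : Type*} [Fintype σ] [LinearOrder σ] {r : ℕ}
    (α β : Fin r → MvPolynomial σ ℂ) : MvPolynomial σ ℂ :=
  superTrace ((((Finset.univ : Finset σ).sort (· ≤ ·)).reverse.map fun j =>
    (koszulDifferential α β).map (MvPolynomial.pderiv j)).prod)

end Koszul

/-! ## The state space of an exponent matrix -/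

section StateSpace

variable {n : ℕ} (E : Matrix (Fin n) (Fin n) ℕ)

/-- The polynomial `∑ᵢ ∏ⱼ xⱼ ^ Eᵢⱼ` with exponent matrix `E`. -/
def polyOf : MvPolynomial (Fin n) ℂ := ∑ i, ∏ j, MvPolynomial.X j ^ E i j

/-- The entry `ρⱼ^(i)` in row `i` and column `j` of the inverse exponent matrix. -/
def rho (j i : Fin n) : ℚ := (E.map (Nat.cast : ℕ → ℚ))⁻¹ i j

/-- The weight `qᵢ = ∑ⱼ ρⱼ^(i)` of the variable `xᵢ`. -/
def weight (i : Fin n) : ℚ := ∑ j, rho E j i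

/-- `e ^ z` as a nonzero complex number. -/
def expUnit (z : ℂ) : ℂˣ := Units.mk0 (Complex.exp z) (Complex.exp_ne_zero z)

/-- The element `ρⱼ = (e ^ (2πi ρⱼ^(1)), …, e ^ (2πi ρⱼ^(n)))`. -/
def rhoElt (j : Fin n) : Fin n → ℂˣ := fun i =>
  expUnit (2 * Real.pi * Complex.I * (rho E j i : ℂ))

/-- The element `ζ = (e ^ (πi q₁), …, e ^ (πi qₙ))`. -/
def zetaElt : Fin n → ℂˣ := fun i => expUnit (Real.pi * Complex.I * (weight E i : ℂ))

theorem polyOf_semiInvariant (t : Fin n → ℂˣ) (c : ℂˣ) (h : ∀ i, ∏ j, t j ^ E i j = c) :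
    IsSemiInvariant (polyOf E) t c := by
  intro x
  simp only [polyOf, map_sum, map_prod, map_pow, MvPolynomial.eval_X, Finset.mul_sum]
  refine Finset.sum_congr rfl fun i _ => ?_
  simp only [mul_pow, Finset.prod_mul_distrib]
  rw [← h i]
  push_cast
  rfl

theorem prod_expUnit_pow (u : Fin n → ℂ) (e : Fin n → ℕ) :
    ∏ j, expUnit (u j) ^ e j = expUnit (∑ j, (e j : ℂ) * u j) := by
  ext
  push_cast
  simp only [expUnit, Units.val_mk0, Complex.exp_sum, Complex.exp_nat_mul]

theorem expUnit_one_of_int (k : ℤ) : expUnit (2 * Real.pi * Complex.I * (k : ℂ)) = 1 := by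
  ext
  simp only [expUnit, Units.val_mk0, Units.val_one]
  rw [mul_comm]
  exact Complex.exp_int_mul_two_pi_mul_I k

theorem sum_mul_rho (i j : Fin n) :
    (∑ k, (E i k : ℚ) * rho E j k = if i = j then 1 else 0) ∨ ∀ j k, rho E j k = 0 := by
  by_cases h : IsUnit (E.map (Nat.cast : ℕ → ℚ)).det
  · left
    have := congrFun (congrFun (Matrix.mul_nonsing_inv _ h) i) j
    simpa [Matrix.mul_apply, Matrix.one_apply, rho] using this
  · right
    intro j k
    rw [rho, Matrix.nonsing_inv_apply_not_isUnit _ h]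
    rfl

theorem rhoElt_mem (j : Fin n) : rhoElt E j ∈ symmetryGroup (polyOf E) := by
  refine polyOf_semiInvariant E _ 1 fun i => ?_
  unfold rhoElt
  rw [prod_expUnit_pow]
  rcases sum_mul_rho E i j with h | h
  · rw [← expUnit_one_of_int (if i = j then 1 else 0)]
    congr 1
    have h' : (∑ k, (E i k : ℂ) * (rho E j k : ℂ)) = ((if i = j then 1 else 0 : ℤ) : ℂ) := by
      have := congrArg (fun q : ℚ => (q : ℂ)) h
      push_cast at this
      rw [this]
      split_ifs <;> simp
    rw [← h', Finset.mul_sum]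
    exact Finset.sum_congr rfl fun k _ => by ring
  · rw [← expUnit_one_of_int 0]
    simp [h]

theorem zetaElt_mem : zetaElt E ∈ scalingGroup (polyOf E) := by
  by_cases h0 : ∀ j k, rho E j k = 0
  · refine ⟨1, polyOf_semiInvariant E _ 1 fun i => ?_⟩
    ext
    simp [zetaElt, expUnit, weight, h0]
  · refine ⟨expUnit (Real.pi * Complex.I), polyOf_semiInvariant E _ _ fun i => ?_⟩
    unfold zetaElt
    rw [prod_expUnit_pow]
    congr 1
    have h' : (∑ k, (E i k : ℚ) * weight E k) = 1 := by
      simp only [weight, Finset.mul_sum]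
      rw [Finset.sum_comm]
      rw [Finset.sum_congr rfl fun j _ => (sum_mul_rho E i j).resolve_right h0]
      simp
    have h'' : (∑ k, (E i k : ℂ) * (weight E k : ℂ)) = 1 := by
      have := congrArg (fun q : ℚ => (q : ℂ)) h'
      push_cast at this
      exact this
    calc _ = Real.pi * Complex.I * ∑ k, (E i k : ℂ) * (weight E k : ℂ) := by
          rw [Finset.mul_sum]
          exact Finset.sum_congr rfl fun k _ => by ring
      _ = _ := by rw [h'', mul_one]

/-- The group `G_w` of the polynomial `w` with exponent matrix `E`. -/
abbrev symGroup : Subgroup (Fin n → ℂˣ) := symmetryGroup (polyOf E)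

/-- The map `m ↦ ∏ⱼ ρⱼ ^ (mⱼ + 1)` from exponent vectors to `G_w`. -/
def groupElt (m : Fin n → ℕ) : symGroup E :=
  ∏ j, (⟨rhoElt E j, rhoElt_mem E j⟩ : symGroup E) ^ (m j + 1)

open Classical in
/-- The indices of the coordinates fixed by `γ`; they are coordinates on the fixed subspace
`V^γ`. -/
def fixedVars (γ : Fin n → ℂˣ) : Finset (Fin n) := Finset.univ.filter fun i => γ i = 1

theorem fixedVars_inv (γ : Fin n → ℂˣ) : fixedVars γ⁻¹ = fixedVars γ := by
  simp [fixedVars]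

/-- Restriction of polynomials to the coordinate subspace with coordinates in `S`. -/
def restrictTo (S : Finset (Fin n)) : MvPolynomial (Fin n) ℂ →ₐ[ℂ] MvPolynomial S ℂ :=
  MvPolynomial.aeval fun i => if h : i ∈ S then MvPolynomial.X ⟨i, h⟩ else 0

/-- The restriction of `w` to the coordinate subspace with coordinates in `S`. -/
def restrictedPoly (S : Finset (Fin n)) : MvPolynomial S ℂ := restrictTo S (polyOf E)

theorem eval_restrictTo (S : Finset (Fin n)) (p : MvPolynomial (Fin n) ℂ) (y : S → ℂ) :
    MvPolynomial.eval y (restrictTo S p) =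
      MvPolynomial.eval (fun i => if h : i ∈ S then y ⟨i, h⟩ else 0) p := by
  induction p using MvPolynomial.induction_on with
  | C a => simp [restrictTo, MvPolynomial.algebraMap_eq]
  | add p q hp hq => simp [hp, hq]
  | mul_X p i hp =>
    rw [map_mul, map_mul, hp, map_mul, MvPolynomial.eval_X]
    congr 1
    by_cases h : i ∈ S <;> simp [restrictTo, h]

theorem restrict_mem {t : Fin n → ℂˣ} (ht : t ∈ scalingGroup (polyOf E)) (S : Finset (Fin n)) :
    (fun i : S => t i) ∈ scalingGroup (restrictedPoly E S) := by
  obtain ⟨c, hc⟩ := ht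
  refine ⟨c, fun y => ?_⟩
  rw [restrictedPoly, eval_restrictTo, eval_restrictTo, ← hc]
  congr 2
  funext i
  by_cases h : i ∈ S <;> simp [h]

/-- The action by push-forward of `t ∈ Γ_w` on the forms of the coordinate subspace `S`. -/
def restrictedPush (S : Finset (Fin n)) (t : Fin n → ℂˣ) (ht : t ∈ scalingGroup (polyOf E)) :
    FormSpace (restrictedPoly E S) →ₗ[ℂ] FormSpace (restrictedPoly E S) :=
  pushForward (restrictedPoly E S) (fun i => t i) (restrict_mem E ht S)

/-- The sector `H(w_γ)^{G_w}`. -/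
def sector (γ : symGroup E) :
    Submodule ℂ (FormSpace (restrictedPoly E (fixedVars (γ : Fin n → ℂˣ)))) where
  carrier := {h | ∀ g (hg : g ∈ symGroup E), restrictedPush E _ g (symmetryGroup_le _ hg) h = h}
  zero_mem' := fun _ _ => map_zero _
  add_mem' := fun hx hy g hg => by rw [map_add, hx g hg, hy g hg]
  smul_mem' := fun c x hx g hg => by rw [map_smul, hx g hg]

/-- The state space `⨁_γ H(w_γ)^{G_w}`, where `γ` runs over `G_w`. -/
abbrev StateSpace : Type _ := DirectSum (symGroup E) fun γ => sector E γ

/-- The identification of the spaces of forms attached to two equal coordinate subspaces. -/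
def formCast {S T : Finset (Fin n)} (h : S = T) :
    FormSpace (restrictedPoly E S) →ₗ[ℂ] FormSpace (restrictedPoly E T) :=
  h ▸ LinearMap.id

/-- The pairing `⟨x, y⟩ = ⟨ζ_* x, y⟩_{w_γ}` of the sectors of `γ` and `γ⁻¹`. -/
def sectorPairing (γ : symGroup E) : sector E γ →ₗ[ℂ] sector E γ⁻¹ →ₗ[ℂ] ℂ :=
  (canonicalPairing (restrictedPoly E (fixedVars (γ : Fin n → ℂˣ)))).compl₁₂
    (restrictedPush E _ (zetaElt E) (zetaElt_mem E) ∘ₗ (sector E γ).subtype)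
    (formCast E (fixedVars_inv (γ : Fin n → ℂˣ)) ∘ₗ (sector E γ⁻¹).subtype)

open Classical in
/-- The pairing of the state space; the sector of `γ` is orthogonal to all sectors except that of
`γ⁻¹`. -/
def statePairing : StateSpace E →ₗ[ℂ] StateSpace E →ₗ[ℂ] ℂ :=
  DirectSum.toModule ℂ (symGroup E) (StateSpace E →ₗ[ℂ] ℂ) fun γ =>
    LinearMap.lcomp ℂ ℂ (DirectSum.component ℂ (symGroup E) (fun γ => sector E γ) γ⁻¹) ∘ₗ
      sectorPairing E γ

open Classical in
/-- `v` is the class `h ∈ H(w_γ)`, which is then `G_w`-invariant, placed in the sector of `γ`. -/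
def IsSectorElt (v : StateSpace E) (γ : symGroup E)
    (h : FormSpace (restrictedPoly E (fixedVars (γ : Fin n → ℂˣ)))) : Prop :=
  ∃ s : sector E γ, (s : FormSpace _) = h ∧
    v = DirectSum.lof ℂ (symGroup E) (fun γ => sector E γ) γ s

/-- The Chern character in `H(w_γ)` of the Koszul matrix factorization `⊗ₖ {αₖ, βₖ}` restricted
to `V^γ`. -/
def sectorChern (γ : symGroup E) {r : ℕ} (αβ : Fin r → MvPolynomial (Fin n) ℂ ×
    MvPolynomial (Fin n) ℂ) : FormSpace (restrictedPoly E (fixedVars (γ : Fin n → ℂˣ))) :=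
  Ideal.Quotient.mk _ ((koszulChern (fun k => restrictTo (fixedVars (γ : Fin n → ℂˣ)) (αβ k).1)
    (fun k => restrictTo (fixedVars (γ : Fin n → ℂˣ)) (αβ k).2) :
      MvPolynomial (fixedVars (γ : Fin n → ℂˣ)) ℂ) :
      MvPowerSeries (fixedVars (γ : Fin n → ℂˣ)) ℂ)

end StateSpace

/-! ## Atomic polynomials, standard vectors and the mirror map -/

section Atomic

/-- The types of atomic polynomials. The Fermat polynomial `x ^ a` is the chain with `n = 1`. -/
inductive AtomicType
  | chain
  | loop

variable (τ : AtomicType) {n : ℕ} (a : Fin n → ℕ)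

/-- The exponent matrix of `x₁^a₁ x₂ + ⋯ + xₙ₋₁^aₙ₋₁ xₙ + xₙ^aₙ` (chain) or of
`x₁^a₁ x₂ + ⋯ + xₙ₋₁^aₙ₋₁ xₙ + xₙ^aₙ x₁` (loop). -/
def exponentMatrix : Matrix (Fin n) (Fin n) ℕ := fun i j =>
  (if i = j then a i else 0) +
    match τ with
    | .chain => if (j : ℕ) = i + 1 then 1 else 0
    | .loop => if (j : ℕ) = (i + 1) % n then 1 else 0

/-- The polynomial with the transposed exponent matrix. -/
def dualPoly : MvPolynomial (Fin n) ℂ := polyOf (exponentMatrix τ a).transpose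

/-- The monomial `∏ xⱼ ^ mⱼ` in the Milnor ring of the dual polynomial. -/
def mono (m : Fin n → ℕ) : MilnorRing (dualPoly τ a) :=
  Ideal.Quotient.mk _ (∏ j, MvPowerSeries.X j ^ m j)

/-- The standard vectors of chain type with parameter `k`: those `m` for which
`x^m = ∏_{i < k} xₙ₋₂ᵢ ^ (aₙ₋₂ᵢ - 1) * ∏_{j ≤ n - 2k} xⱼ ^ mⱼ` with `mⱼ < aⱼ` for `j < n - 2k` and
`mⱼ < aⱼ - 1` for `j = n - 2k`. The variable `xⱼ` has the index `j - 1` in `Fin n`. -/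
def IsChainStandard (k : ℕ) (m : Fin n → ℕ) : Prop :=
  2 * k ≤ n ∧ ∀ i : Fin n,
    ((i : ℕ) + 1 + 2 * k < n → m i < a i) ∧
    ((i : ℕ) + 1 + 2 * k = n → m i + 1 < a i) ∧
    (n < (i : ℕ) + 1 + 2 * k → m i = if Even (n - (i + 1)) then a i - 1 else 0)

/-- The standard vectors. -/
def IsStandard (m : Fin n → ℕ) : Prop :=
  match τ with
  | .chain => ∃ k, IsChainStandard a k m
  | .loop => ∀ i, m i < a i

/-- The exponent vector of the socle monomial of the dual polynomial. -/
def socleVec : Fin n → ℕ := fun i =>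
  match τ with
  | .chain => if (i : ℕ) + 1 = n then a i - 2 else a i - 1
  | .loop => a i - 1

/-- The normalized residue pairing: the multiple of `(f, g) ↦ Res (f g)` for which the residue of
the socle monomial is `1`. -/
def normalizedResidue (f g : MilnorRing (dualPoly τ a)) : ℂ :=
  milnorResidue (dualPoly τ a) (f * g) /
    milnorResidue (dualPoly τ a) (mono τ a (socleVec τ a))

/-- The variable with (zero-based) index `j`: for a loop the indices are read modulo `n`, for a
chain the variables beyond the last one are replaced by `1`. -/
def extVar (j : ℕ) : MvPolynomial (Fin n) ℂ :=
  match τ with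
  | .chain => if h : j < n then MvPolynomial.X ⟨j, h⟩ else 1
  | .loop => if h : 0 < n then MvPolynomial.X ⟨j % n, Nat.mod_lt j h⟩ else 1

/-- The exponent with (zero-based) index `j`, read modulo `n`. -/
def extExp (j : ℕ) : ℕ := if h : 0 < n then a ⟨j % n, Nat.mod_lt j h⟩ else 0

/-- The pair `{-(xⱼ^aⱼ + xⱼ₊₁^(aⱼ₊₁ - 1) xⱼ₊₂), xⱼ₊₁}`. Its product is the sum of the two terms of
`-w` that contain `xⱼ₊₁`. -/
def koszulPair (j : ℕ) : MvPolynomial (Fin n) ℂ × MvPolynomial (Fin n) ℂ :=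
  (-(extVar τ j ^ extExp a j + extVar τ (j + 1) ^ (extExp a (j + 1) - 1) * extVar τ (j + 2)),
    extVar τ (j + 1))

/-- `m^odd`, with entries `aᵢ - 1` at the odd and `0` at the even positions `1, …, n`. -/
def oddVec : Fin n → ℕ := fun i => if Odd ((i : ℕ) + 1) then a i - 1 else 0

/-- `m^even`, with entries `0` at the odd and `aᵢ - 1` at the even positions `1, …, n`. -/
def evenVec : Fin n → ℕ := fun i => if Even ((i : ℕ) + 1) then a i - 1 else 0

/-- The defining properties of the mirror map. -/
structure IsMirrorMap
    (θ : MilnorRing (dualPoly τ a) →ₗ[ℂ] StateSpace (exponentMatrix τ a)) : Prop where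
  /-- On a standard vector whose group element fixes only the origin, the value is the generator
  `1` of the sector `H(0) = ℂ`. -/
  narrow : ∀ m, IsStandard τ a m →
    fixedVars (groupElt (exponentMatrix τ a) m : Fin n → ℂˣ) = ∅ →
    IsSectorElt _ (θ (mono τ a m)) (groupElt _ m) 1
  /-- For a loop with an even number of variables, `m^odd` goes to the Chern character of the
  Koszul matrix factorization formed by the pairs with `j = 2, 4, …, n` (zero-based
  `1, 3, …, n - 1`). -/
  loop_odd : τ = .loop → Even n →
    IsSectorElt _ (θ (mono τ a (oddVec a))) (groupElt _ (oddVec a))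
      (sectorChern _ _ fun s : Fin (n / 2) => koszulPair τ a (2 * s + 1))
  /-- For a loop with an even number of variables, `m^even` goes to the Chern character of the
  Koszul matrix factorization formed by the pairs with `j = 1, 3, …, n - 1` (zero-based
  `0, 2, …, n - 2`). -/
  loop_even : τ = .loop → Even n →
    IsSectorElt _ (θ (mono τ a (evenVec a))) (groupElt _ (evenVec a))
      (sectorChern _ _ fun s : Fin (n / 2) => koszulPair τ a (2 * s))
  /-- For a chain and a standard vector with parameter `k ≥ 1`, the value is the Chern character of
  the Koszul matrix factorization formed by the pairs with `j = n - 2k + 1, n - 2k + 3, …, n - 1`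
  (zero-based `n - 2k, n - 2k + 2, …, n - 2`). -/
  chain_broad : τ = .chain → ∀ k m, 1 ≤ k → IsChainStandard a k m →
    IsSectorElt _ (θ (mono τ a m)) (groupElt _ m)
      (sectorChern _ _ fun s : Fin k => koszulPair τ a (n - 2 * k + 2 * s))

end Atomic

end

end LGMirror

open LGMirror

/-! Write E for the exponent matrix of w. Both pairings are supported on the same pairs of standard
vectors, and on each such pair both equal the same signed product of exponents aᵢ.

Support. By homogeneity under the diagonal symmetries of w^T, the residue of x^(m+m') can be nonzero
only if m + m' + 2 lies in E ℤⁿ (`inLattice_of_residue_ne_zero`). The same lattice condition says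
that ℑ(m') is the inverse of ℑ(m) (`groupElt_eq_inv_iff`), which is necessary for the sectors to
pair. Size estimates for the solutions of E c = m + m' + 2 leave few cases. For a loop, either m +
m' is the socle exponent, or n is even and m = m' is m^odd or m^even (`loop_pair_cases`). For a
chain, m and m' have the same k and are complementary away from the last 2k positions
(`chain_pair_cases`). Similar estimates for E⁻¹(m + 1) determine the fixed variables: none, or all
for m^odd and m^even; for a chain exactly the last 2k.

B-side. The relations ∂ₖ w^T = 0 read xᵢ^aᵢ = -aₖ xₖ^(aₖ-1) x_{s(k)} when s(i) = k. Applied at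
alternate positions they turn x^(m+m') into an explicit multiple of the socle monomial
(`monoRes_chain`, `monoRes_oddVec`, `monoRes_evenVec`). The normalization makes only the
nonvanishing of Res(soc) relevant there.

A-side. Here actual residues of the restrictions w_γ are needed: 1/∏ aᵢ for a chain and 1/(∏ aᵢ -
(-1)ⁿ) for a loop (`residue_socle_chain`, `residue_socle_loop`). They come from an explicit
presentation of powers of the variables by the derivatives. The supertrace of a product of 2r
Clifford multiplications is alternating, hence a determinant (`superTrace_prod_cliff`). So each
Chern character is a Jacobian determinant, and it reduces to an r × r bidiagonal one. This gives a
monomial for a chain and a combination of two monomials for a loop. The sign (-1)^binom(2r,2) of the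
canonical form cancels the factor (-1)^r produced by ζ.

Existence and uniqueness. Monomials with mᵢ < aᵢ span the Milnor ring (`span_box`), where cyclic
rewriting is stopped by the fact that every step multiplies by a factor of absolute value at least
2. The nonstandard ones among them vanish for a chain. Standard monomials are separated by residue
functionals (`standard_separating`), so they form a basis. The prescribed values therefore define
exactly one θ, and bilinearity extends the equality of the pairings from the basis to all elements.
-/

namespace LGMirror

/-! ## Independence of the Grothendieck residue of its presentation -/

section Residue

open MvPowerSeries

variable {σ : Type*} [Fintype σ]

/-- The monomial `∏ xⱼ ^ mⱼ` as a power series. -/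
noncomputable def xpow (m : σ → ℕ) : MvPowerSeries σ ℂ := ∏ j, X j ^ m j

theorem xpow_eq_monomial (m : σ → ℕ) :
    xpow m = monomial (Finsupp.equivFunOnFinite.symm m) (1 : ℂ) := by
  rw [MvPowerSeries.monomial_one_eq, Finsupp.prod_fintype _ _ (fun _ => pow_zero _)]
  rfl

theorem xpow_add (m m' : σ → ℕ) : xpow (m + m') = xpow m * xpow m' := by
  simp [xpow, pow_add, Finset.prod_mul_distrib]

theorem xpow_zero : xpow (0 : σ → ℕ) = 1 := by simp [xpow]

theorem rescale_xpow (t : σ → ℂ) (m : σ → ℕ) :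
    rescaleAlgHom t (xpow m) = C (∏ i, t i ^ m i) * xpow m := by
  rw [rescaleAlgHom_apply, xpow_eq_monomial]
  ext n
  rw [coeff_rescale, coeff_C_mul]
  classical
  rw [coeff_monomial]
  split_ifs with h
  · subst h
    rw [Finsupp.prod_fintype _ _ (fun _ => pow_zero _)]
    simp
  · simp

variable [DecidableEq σ]

theorem xpow_single (i : σ) (k : ℕ) : xpow (Pi.single i k) = X i ^ k := by
  rw [xpow, Finset.prod_eq_single i]
  · simp
  · intro j _ hj
    simp [hj]
  · simp

/-- The rows of C' are exchanged for those of C one at a time. An exchange changes the determinant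
by det D, where row i of D is the difference of the two rows and annihilates f. By Cramer's rule
every det D · fⱼ then lies in the ideal of the powers X_k^(N_k+1) with k ≠ i, and hence so does
X_i^(N_i+1) · det D. -/
theorem coeff_det_mul_congr (N : σ →₀ ℕ) (f : σ → MvPowerSeries σ ℂ)
    (C C' : Matrix σ σ (MvPowerSeries σ ℂ))
    (h : ∀ i, (X i : MvPowerSeries σ ℂ) ^ (N i + 1) = ∑ j, C i j * f j)
    (h' : ∀ i, (X i : MvPowerSeries σ ℂ) ^ (N i + 1) = ∑ j, C' i j * f j)
    (g : MvPowerSeries σ ℂ) : coeff N (C.det * g) = coeff N (C'.det * g) := by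
  let mix : Finset σ → Matrix σ σ (MvPowerSeries σ ℂ) := fun S i => if i ∈ S then C i else C' i
  have hmix : ∀ S i, ∑ j, mix S i j * f j = X i ^ (N i + 1) := by
    intro S i
    by_cases hi : i ∈ S
    · simp [mix, hi, h i]
    · simp [mix, hi, h' i]
  have key : ∀ S : Finset σ, coeff N ((mix S).det * g) = coeff N (C'.det * g) := by
    intro S
    induction S using Finset.induction_on with
    | empty => simp [mix]
    | insert i S hi ih =>
      rw [← ih]
      have e1 : mix (insert i S) = (mix S).updateRow i ((C i - C' i) + C' i) := by
        refine funext fun k => ?_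
        by_cases hk : k = i
        · subst hk
          rw [Matrix.updateRow_self]
          simp [mix]
        · rw [Matrix.updateRow_ne hk]
          simp [mix, hk]
      have e2 : (mix S).updateRow i (C' i) = mix S := by
        refine funext fun k => ?_
        by_cases hk : k = i
        · subst hk
          rw [Matrix.updateRow_self]
          simp [mix, hi]
        · rw [Matrix.updateRow_ne hk]
      rw [e1, Matrix.det_updateRow_add, e2, add_mul, map_add, add_eq_right]
      set D := (mix S).updateRow i (C i - C' i) with hD
      have hDf : D.mulVec f = fun k => if k = i then 0 else X k ^ (N k + 1) := by
        funext k
        by_cases hk : k = i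
        · subst hk
          simp only [Matrix.mulVec, dotProduct, hD, Matrix.updateRow_self, if_true,
            Pi.sub_apply, sub_mul, Finset.sum_sub_distrib]
          rw [← h k, ← h' k, sub_self]
        · simp only [Matrix.mulVec, dotProduct, hD, Matrix.updateRow_ne hk, if_neg hk]
          exact hmix S k
      have hadj : ∀ j, D.det * f j =
          ∑ k, D.adjugate j k * (if k = i then 0 else X k ^ (N k + 1)) := by
        intro j
        have h3 : D.adjugate.mulVec (D.mulVec f) = D.det • f := by
          rw [Matrix.mulVec_mulVec, Matrix.adjugate_mul, Matrix.smul_mulVec, Matrix.one_mulVec]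
        have h4 := congrFun h3 j
        rw [hDf] at h4
        simpa [Matrix.mulVec, dotProduct] using h4.symm
      have h5 : X i ^ (N i + 1) * (D.det * g) = ∑ j, ∑ k, C i j * g * D.adjugate j k *
          (if k = i then 0 else X k ^ (N k + 1)) := by
        rw [h i, Finset.sum_mul]
        refine Finset.sum_congr rfl fun j _ => ?_
        rw [show C i j * f j * (D.det * g) = C i j * g * (D.det * f j) by ring, hadj,
          Finset.mul_sum]
        exact Finset.sum_congr rfl fun k _ => by ring
      -- Multiplication by X_i^(N_i+1) moves the coefficient at N to this exponent. Its entries at k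
      -- ≠ i are still N_k, so multiples of X_k^(N_k+1) contribute nothing.
      have h6 := congrArg (coeff (Finsupp.single i (N i + 1) + N)) h5
      rw [X_pow_eq, coeff_add_monomial_mul, one_mul] at h6
      rw [h6, map_sum]
      refine Finset.sum_eq_zero fun j _ => ?_
      rw [map_sum]
      refine Finset.sum_eq_zero fun k _ => ?_
      by_cases hk : k = i
      · simp [hk]
      · rw [if_neg hk, mul_comm]
        refine (X_pow_dvd_iff.mp (Dvd.intro _ rfl)) _ ?_
        simp [Ne.symm hk]
  have := key Finset.univ
  simpa [mix] using this

/-- Raising the exponents of a residue datum. -/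
noncomputable def ResidueData.raise {f : σ → MvPowerSeries σ ℂ} (d : ResidueData f)
    (K : σ →₀ ℕ) : ResidueData f where
  N := K + d.N
  C := Matrix.of fun i j => X i ^ K i * d.C i j
  eq i := by
    rw [Finsupp.add_apply, add_assoc, pow_add, d.eq i, Finset.mul_sum]
    exact Finset.sum_congr rfl fun j _ => by simp [mul_assoc]

/-- Row i is multiplied by X_i^(K_i), so the determinant gains the monomial X^K, which is exactly
the shift of the exponent at which the coefficient is taken. -/
theorem ResidueData.functional_raise {f : σ → MvPowerSeries σ ℂ} (d : ResidueData f)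
    (K : σ →₀ ℕ) (g : MvPowerSeries σ ℂ) : (d.raise K).functional g = d.functional g := by
  simp only [ResidueData.functional, LinearMap.comp_apply, LinearMap.mulLeft_apply, raise]
  rw [Matrix.det_mul_column]
  have : (∏ i, (X i : MvPowerSeries σ ℂ) ^ K i) = monomial K 1 := by
    rw [MvPowerSeries.monomial_one_eq, Finsupp.prod_fintype _ _ (fun _ => pow_zero _)]
  rw [this, mul_assoc, coeff_add_monomial_mul, one_mul]

/-- Each presentation is raised by the exponents of the other. They then present the same powers and
`coeff_det_mul_congr` applies. -/
theorem ResidueData.functional_eq {f : σ → MvPowerSeries σ ℂ} (d d' : ResidueData f)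
    (g : MvPowerSeries σ ℂ) : d.functional g = d'.functional g := by
  rw [← d.functional_raise d'.N, ← d'.functional_raise d.N]
  have hN : (d.raise d'.N).N = (d'.raise d.N).N := add_comm _ _
  have h2 := (d'.raise d.N).eq
  rw [← hN] at h2
  have := coeff_det_mul_congr _ f _ _ (d.raise d'.N).eq h2 g
  simp only [ResidueData.functional, LinearMap.comp_apply, LinearMap.mulLeft_apply]
  rw [this, hN]

/-- The residue may be computed from any presentation. -/
theorem grothendieckResidue_eq {f : σ → MvPowerSeries σ ℂ} (d : ResidueData f)
    (g : MvPowerSeries σ ℂ) : grothendieckResidue f g = coeff d.N (d.C.det * g) := by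
  have h : Nonempty (ResidueData f) := ⟨d⟩
  rw [grothendieckResidue, dif_pos h]
  exact h.some.functional_eq d g

theorem milnorResidue_mk (w : MvPolynomial σ ℂ) (g : MvPowerSeries σ ℂ) :
    milnorResidue w (Ideal.Quotient.mk _ g) =
      grothendieckResidue (fun i => ((MvPolynomial.pderiv i w : MvPolynomial σ ℂ) :
        MvPowerSeries σ ℂ)) g := rfl

/-- Since w is invariant, ∂ⱼw has the weight inverse to that of xⱼ. -/
theorem rescale_pderiv_of_mem (w : MvPolynomial σ ℂ) {t : σ → ℂˣ} (ht : t ∈ symmetryGroup w)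
    (j : σ) : rescaleAlgHom (fun i => (t i : ℂ)) ((MvPolynomial.pderiv j w :
      MvPolynomial σ ℂ) : MvPowerSeries σ ℂ) =
      C (((t j)⁻¹ : ℂˣ) : ℂ) * ((MvPolynomial.pderiv j w : MvPolynomial σ ℂ) :
        MvPowerSeries σ ℂ) := by
  have h1 : MvPolynomial.aeval (fun i => MvPolynomial.C (t i : ℂ) * MvPolynomial.X i) w = w := by
    refine MvPolynomial.funext fun x => ?_
    have h2 := ht x
    rw [Units.val_one, one_mul] at h2
    rw [← h2]
    change (MvPolynomial.eval x) (MvPolynomial.bind₁ _ w) = _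
    rw [← MvPolynomial.coe_aeval_eq_eval, RingHom.coe_coe, MvPolynomial.aeval_bind₁]
    simp [MvPolynomial.aeval_eq_eval]
  have h3 := pderiv_scale t w j
  rw [h1] at h3
  rw [← coe_scale, ← MvPolynomial.coe_C, ← MvPolynomial.coe_mul]
  congr 1
  conv_rhs => rw [h3]
  rw [← mul_assoc, ← MvPolynomial.C_mul, Units.inv_mul, MvPolynomial.C_1, one_mul]

/-- A monomial with non-vanishing residue has the same weight as the Hessian. -/
theorem prod_pow_eq_one_of_residue_ne_zero (w : MvPolynomial σ ℂ) {t : σ → ℂˣ}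
    (ht : t ∈ symmetryGroup w) (m : σ → ℕ)
    (hm : milnorResidue w (Ideal.Quotient.mk _ (xpow m)) ≠ 0) :
    ∏ i, (t i : ℂ) ^ (m i + 2) = 1 := by
  rw [milnorResidue_mk] at hm
  set f := fun i => ((MvPolynomial.pderiv i w : MvPolynomial σ ℂ) : MvPowerSeries σ ℂ) with hf
  have hne : Nonempty (ResidueData f) := by
    by_contra h
    exact hm (by rw [grothendieckResidue, dif_neg h]; rfl)
  obtain ⟨d⟩ := hne
  let R := rescaleAlgHom (fun i => (t i : ℂ))
  have hR : ∀ j, R (f j) = C (((t j)⁻¹ : ℂˣ) : ℂ) * f j := rescale_pderiv_of_mem w ht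
  have hX : ∀ i k, R (X i ^ k) = C ((t i : ℂ) ^ k) * X i ^ k := by
    intro i k
    have := rescale_xpow (fun i => (t i : ℂ)) (Pi.single i k)
    rw [xpow_single] at this
    rw [this, Finset.prod_eq_single i]
    · simp
    · intro j _ hj
      simp [hj]
    · simp
  -- The rescaled presentation, with rows and columns corrected by the weights of the powers and of
  -- the derivatives, presents the same powers again.
  let d' : ResidueData f :=
    { N := d.N
      C := Matrix.of fun i j => C ((((t i)⁻¹ : ℂˣ) : ℂ) ^ (d.N i + 1)) *
        (Matrix.of fun i j => C (((t j)⁻¹ : ℂˣ) : ℂ) * R (d.C i j)) i j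
      eq := by
        intro i
        have h1 := congrArg R (d.eq i)
        rw [hX, map_sum] at h1
        have h2 : (C ((((t i)⁻¹ : ℂˣ) : ℂ) ^ (d.N i + 1)) : MvPowerSeries σ ℂ) *
            (C ((t i : ℂ) ^ (d.N i + 1)) * X i ^ (d.N i + 1)) = X i ^ (d.N i + 1) := by
          rw [← mul_assoc, ← map_mul, ← mul_pow]
          simp
        rw [← h2, h1, Finset.mul_sum]
        refine Finset.sum_congr rfl fun j _ => ?_
        simp only [map_mul, hR, Matrix.of_apply]
        ring }
  have hdet : d'.C.det = C ((∏ i, (((t i)⁻¹ : ℂˣ) : ℂ) ^ (d.N i + 1)) *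
      ∏ i, (((t i)⁻¹ : ℂˣ) : ℂ)) * R d.C.det := by
    change (Matrix.of fun i j => C ((((t i)⁻¹ : ℂˣ) : ℂ) ^ (d.N i + 1)) *
        (Matrix.of fun i j => C (((t j)⁻¹ : ℂˣ) : ℂ) * R (d.C i j)) i j).det = _
    rw [Matrix.det_mul_column]
    have : (Matrix.of fun i j => C (((t j)⁻¹ : ℂˣ) : ℂ) * R (d.C i j)) =
      Matrix.of fun i j => C (((t j)⁻¹ : ℂˣ) : ℂ) * (R.mapMatrix d.C) i j := rfl
    rw [this, Matrix.det_mul_row, ← AlgHom.map_det, map_mul, map_prod, map_prod, mul_assoc]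
  have e1 := grothendieckResidue_eq d (xpow m)
  have e2 := grothendieckResidue_eq d' (xpow m)
  have e3 : d'.C.det * xpow m = C ((∏ i, (((t i)⁻¹ : ℂˣ) : ℂ) ^ (d.N i + 1)) *
      (∏ i, (((t i)⁻¹ : ℂˣ) : ℂ)) * ∏ i, (((t i)⁻¹ : ℂˣ) : ℂ) ^ m i) *
        R (d.C.det * xpow m) := by
    have h1 : R (xpow m) = C (∏ i, (t i : ℂ) ^ m i) * xpow m := rescale_xpow _ _
    have h2 : (C (∏ i, (((t i)⁻¹ : ℂˣ) : ℂ) ^ m i) : MvPowerSeries σ ℂ) *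
        C (∏ i, (t i : ℂ) ^ m i) = 1 := by
      rw [← map_mul, ← Finset.prod_mul_distrib]
      simp
    rw [hdet, map_mul R, h1, map_mul C _ (∏ i, (((t i)⁻¹ : ℂˣ) : ℂ) ^ m i)]
    linear_combination (- C ((∏ i, (((t i)⁻¹ : ℂˣ) : ℂ) ^ (d.N i + 1)) *
      ∏ i, (((t i)⁻¹ : ℂˣ) : ℂ)) * R d.C.det * xpow m) * h2
  have e4 : coeff d.N (R (d.C.det * xpow m)) =
      (∏ i, (t i : ℂ) ^ d.N i) * coeff d.N (d.C.det * xpow m) := by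
    simp only [R]
    rw [rescaleAlgHom_apply, coeff_rescale, Finsupp.prod_fintype _ _ (fun _ => pow_zero _)]
  change _ = coeff d.N (d'.C.det * xpow m) at e2
  rw [e3, coeff_C_mul, e4, ← e1] at e2
  set r := grothendieckResidue f (xpow m)
  -- The two presentations give residues that differ by a factor. The exponent of tᵢ⁻¹ in it is (Nᵢ
  -- + 1) + 1 + mᵢ - Nᵢ = mᵢ + 2.
  have e5 : (∏ i, (((t i)⁻¹ : ℂˣ) : ℂ) ^ (m i + 2)) * r = r := by
    conv_rhs => rw [e2]
    rw [← mul_assoc]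
    congr 1
    simp only [← Finset.prod_mul_distrib]
    refine Finset.prod_congr rfl fun i _ => ?_
    have h : (((t i)⁻¹ : ℂˣ) : ℂ) * (t i : ℂ) = 1 := by simp
    calc _ = (((t i)⁻¹ : ℂˣ) : ℂ) ^ (m i + 2) *
          ((((t i)⁻¹ : ℂˣ) : ℂ) * (t i : ℂ)) ^ d.N i := by rw [h]; simp
      _ = _ := by ring
  have e6 : (∏ i, (((t i)⁻¹ : ℂˣ) : ℂ) ^ (m i + 2)) = 1 :=
    mul_right_cancel₀ hm (e5.trans (one_mul r).symm)
  have e7 : (∏ i, (((t i)⁻¹ : ℂˣ) : ℂ) ^ (m i + 2)) * ∏ i, (t i : ℂ) ^ (m i + 2) = 1 := by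
    rw [← Finset.prod_mul_distrib]
    simp
  rwa [e6, one_mul] at e7

end Residue

/-! ## Determinants of sparse matrices -/

section Determinants

variable {σ R : Type*} [Fintype σ] [DecidableEq σ] [CommRing R]

/-- The matrix is triangular for the order by rank: a nontrivial permutation with nonvanishing
product would strictly lower the sum of the ranks, which permutations preserve. -/
theorem det_eq_prod_diag_of_rank (M : Matrix σ σ R) (rank : σ → ℕ)
    (h : ∀ i j, i ≠ j → M i j ≠ 0 → rank i < rank j) : M.det = ∏ i, M i i := by
  rw [Matrix.det_apply, Finset.sum_eq_single 1]
  · simp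
  · intro π _ hπ
    have : ∃ i, M (π i) i = 0 := by
      by_contra! hne
      have hle : ∀ i, rank (π i) ≤ rank i := by
        intro i
        by_cases hi : π i = i
        · rw [hi]
        · exact (h _ _ hi (hne i)).le
      obtain ⟨i, hi⟩ : ∃ i, π i ≠ i := by
        by_contra! hid
        exact hπ (Equiv.ext hid)
      have hlt : ∑ i, rank (π i) < ∑ i, rank i :=
        Finset.sum_lt_sum (fun i _ => hle i) ⟨i, Finset.mem_univ _, h _ _ hi (hne i)⟩
      rw [Equiv.sum_comp π rank] at hlt
      exact lt_irrefl _ hlt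
    obtain ⟨i, hi⟩ := this
    rw [Finset.prod_eq_zero (f := fun i => M (π i) i) (Finset.mem_univ i) hi, smul_zero]
  · simp

/-- The permutation `s` has only one orbit. -/
def HasOneOrbit (s : Equiv.Perm σ) : Prop :=
  ∀ T : Finset σ, T.Nonempty → (∀ i ∈ T, s i ∈ T) → T = Finset.univ

/-- The complement of a set closed under preimages is closed under `s`. -/
theorem HasOneOrbit.eq_empty_or_univ {s : Equiv.Perm σ} (hs : HasOneOrbit s) (T : Finset σ)
    (hT : ∀ i, s i ∈ T → i ∈ T) : T = ∅ ∨ T = Finset.univ := by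
  rcases Tᶜ.eq_empty_or_nonempty with h | h
  · right
    rwa [Finset.compl_eq_empty_iff] at h
  · left
    have := hs Tᶜ h fun i hi => by
      rw [Finset.mem_compl] at hi ⊢
      exact fun h => hi (hT i h)
    rwa [Finset.compl_eq_univ_iff] at this

theorem HasOneOrbit.symm {s : Equiv.Perm σ} (hs : HasOneOrbit s) : HasOneOrbit s.symm := by
  intro T hne hT
  rcases hs.eq_empty_or_univ T (fun i hi => by simpa using hT _ hi) with h | h
  · exact absurd h hne.ne_empty
  · exact h

/-- The product is expanded over the set T of indices that use the diagonal entry. If T is neither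
empty nor everything, some i ∉ T has s i ∈ T, and a contributing permutation would send both i and s
i to s i. Only the identity and s remain. With one index the two coincide as permutations and the
formula still holds; with no index it fails. -/
theorem det_cyclic [Nonempty σ] {s : Equiv.Perm σ} (hs : HasOneOrbit s) (d o : σ → R) :
    (Matrix.of fun i j => (if i = j then d i else 0) + (if s i = j then o i else 0)).det =
      ∏ i, d i + (Equiv.Perm.sign s : ℤ) * ∏ i, o i := by
  rw [← Matrix.det_transpose, Matrix.det_apply']
  simp only [Matrix.transpose_apply, Matrix.of_apply]
  have h1 : ∀ π : Equiv.Perm σ, ∏ i, ((if i = π i then d i else 0) +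
      (if s i = π i then o i else 0)) = ∑ T : Finset σ,
        (∏ i ∈ T, if i = π i then d i else 0) *
          ∏ i ∈ Tᶜ, if s i = π i then o i else 0 := by
    intro π
    rw [Finset.prod_add, Finset.powerset_univ]
    exact Finset.sum_congr rfl fun T _ => by rw [Finset.compl_eq_univ_sdiff]
  simp only [h1, Finset.mul_sum]
  rw [Finset.sum_comm, Finset.sum_eq_add (Finset.univ : Finset σ) ∅]
  · congr 1
    · rw [Finset.sum_eq_single 1]
      · simp
      · intro π _ hπ
        obtain ⟨i, hi⟩ : ∃ i, ¬ i = π i := by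
          by_contra! hid
          exact hπ (Equiv.ext fun i => (hid i).symm)
        rw [Finset.prod_eq_zero (Finset.mem_univ i) (if_neg hi)]
        simp
      · simp
    · rw [Finset.sum_eq_single s]
      · simp
      · intro π _ hπ
        obtain ⟨i, hi⟩ : ∃ i, ¬ s i = π i := by
          by_contra! hid
          exact hπ (Equiv.ext fun i => (hid i).symm)
        rw [Finset.compl_empty, Finset.prod_eq_zero (Finset.mem_univ i) (if_neg hi)]
        simp
      · simp
  · exact Finset.univ_nonempty.ne_empty
  · intro T _ hT
    refine Finset.sum_eq_zero fun π _ => ?_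
    have hex : ∃ i, s i ∈ T ∧ i ∉ T := by
      by_contra! hcl
      rcases hs.eq_empty_or_univ T hcl with h | h
      · exact hT.2 h
      · exact hT.1 h
    obtain ⟨i, hi, hi'⟩ := hex
    by_cases hp : s i = π i
    · have : ¬ s i = π (s i) := fun h => hi' (by
        have := π.injective (hp.symm.trans h)
        rw [this]; exact hi)
      rw [Finset.prod_eq_zero hi (if_neg this)]
      simp
    · rw [Finset.prod_eq_zero (Finset.mem_compl.mpr hi') (if_neg hp)]
      simp
  · simp
  · simp

end Determinants

/-! ## Polynomials `∑ᵢ xᵢ ^ aᵢ x_{s(i)}` for a partial injection `s` -/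

section AtomPoly

variable {σ : Type*} [Fintype σ] [DecidableEq σ] (s : σ → Option σ) (a : σ → ℕ)

/-- The polynomial `∑ᵢ xᵢ ^ aᵢ x_{s(i)}`, where `x_{s(i)} = 1` if `s` is not defined at `i`. -/
noncomputable def atomPoly : MvPolynomial σ ℂ :=
  ∑ i, MvPolynomial.X i ^ a i * (s i).elim 1 MvPolynomial.X

/-- The exponent matrix of `atomPoly`. -/
def atomMat : Matrix σ σ ℕ := fun i j =>
  (if i = j then a i else 0) + if s i = some j then 1 else 0

/-- Every element has at most one preimage under `s`. -/
def PartialInj {σ : Type*} (s : σ → Option σ) : Prop :=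
  ∀ i j k, s i = some k → s j = some k → i = j

/-- The partial derivative of `atomPoly` as a power series. -/
noncomputable def atomDeriv (j : σ) : MvPowerSeries σ ℂ :=
  ((MvPolynomial.pderiv j (atomPoly s a) : MvPolynomial σ ℂ) : MvPowerSeries σ ℂ)

/-- The variable `x_o`, which is `1` for `o = none`. -/
noncomputable def optX (o : Option σ) : MvPowerSeries σ ℂ := o.elim 1 MvPowerSeries.X

theorem optX_some {σ : Type*} (k : σ) : optX (some k) = MvPowerSeries.X k := rfl

theorem optX_none {σ : Type*} : optX (none : Option σ) = 1 := rfl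

theorem atomDeriv_eq (j : σ) : atomDeriv s a j =
    (a j : MvPowerSeries σ ℂ) * MvPowerSeries.X j ^ (a j - 1) * optX (s j) +
      ∑ i, if s i = some j then MvPowerSeries.X i ^ a i else 0 := by
  have h1 : ∀ i, MvPolynomial.pderiv j (MvPolynomial.X i ^ a i *
      (s i).elim 1 MvPolynomial.X : MvPolynomial σ ℂ) =
      (if i = j then (a j : MvPolynomial σ ℂ) * MvPolynomial.X j ^ (a j - 1) *
        (s j).elim 1 MvPolynomial.X else 0) +
      if s i = some j then MvPolynomial.X i ^ a i else 0 := by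
    intro i
    rw [MvPolynomial.pderiv_mul, MvPolynomial.pderiv_pow]
    congr 1
    · by_cases h : i = j
      · subst h; simp
      · simp [h]
    · rcases hs : s i with _ | k
      · simp
      · by_cases hk : k = j
        · subst hk; simp
        · simp [hk]
  rw [atomDeriv, atomPoly, map_sum, Finset.sum_congr rfl fun i _ => h1 i,
    Finset.sum_add_distrib, Finset.sum_ite_eq' Finset.univ j, if_pos (Finset.mem_univ j),
    MvPolynomial.coe_add, MvPolynomial.coe_mul, MvPolynomial.coe_mul, MvPolynomial.coe_pow,
    MvPolynomial.coe_X]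
  congr 1
  · congr 1
    · congr 1
      exact map_natCast (MvPolynomial.coeToMvPowerSeries.ringHom (R := ℂ) (σ := σ)) (a j)
    · rcases s j with _ | k <;> simp [optX]
  · rw [← MvPolynomial.coeToMvPowerSeries.ringHom_apply, map_sum]
    refine Finset.sum_congr rfl fun i _ => ?_
    rw [MvPolynomial.coeToMvPowerSeries.ringHom_apply]
    split_ifs <;> simp

variable {s} in
theorem atomDeriv_of_some (hs : PartialInj s) {i k : σ} (h : s i = some k) :
    atomDeriv s a k = (a k : MvPowerSeries σ ℂ) * MvPowerSeries.X k ^ (a k - 1) * optX (s k) +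
      MvPowerSeries.X i ^ a i := by
  rw [atomDeriv_eq, Finset.sum_eq_single i, if_pos h]
  · intro j _ hj
    exact if_neg fun h' => hj (hs _ _ _ h' h)
  · simp

/-- The operator xⱼ∂ⱼ multiplies a monomial by its exponent in xⱼ. Thus the exponent matrix is the
transition matrix from the terms to the xⱼ∂ⱼ, and inverting it writes the terms through the
derivatives. -/
theorem atomDeriv_euler (ha : ∀ i, 2 ≤ a i) (j : σ) :
    MvPowerSeries.X j * atomDeriv s a j = ∑ i, (atomMat s a i j : MvPowerSeries σ ℂ) *
      (MvPowerSeries.X i ^ a i * optX (s i)) := by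
  have h1 : ∀ i, (atomMat s a i j : MvPowerSeries σ ℂ) *
      (MvPowerSeries.X i ^ a i * optX (s i)) =
      (if i = j then (a j : MvPowerSeries σ ℂ) * (MvPowerSeries.X j ^ a j * optX (s j)) else 0) +
      if s i = some j then MvPowerSeries.X i ^ a i * MvPowerSeries.X j else 0 := by
    intro i
    rw [atomMat, Nat.cast_add, add_mul]
    congr 1
    · by_cases h : i = j
      · subst h; simp
      · simp [h]
    · by_cases h : s i = some j
      · simp [h, optX]
      · simp [h]
  rw [Finset.sum_congr rfl fun i _ => h1 i, Finset.sum_add_distrib,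
    Finset.sum_ite_eq' Finset.univ j, if_pos (Finset.mem_univ j), atomDeriv_eq, mul_add]
  congr 1
  · obtain ⟨b, hb⟩ : ∃ b, a j = b + 1 := ⟨a j - 1, by have := ha j; omega⟩
    rw [hb, Nat.add_sub_cancel, pow_succ]
    ring
  · rw [Finset.mul_sum]
    refine Finset.sum_congr rfl fun i _ => ?_
    split_ifs <;> ring

/-- The exponent matrix with complex entries. -/
noncomputable def atomMatC : Matrix σ σ ℂ := (atomMat s a).map (Nat.cast : ℕ → ℂ)

/-- Strict diagonal dominance: the diagonal entry is at least 2, and the row has at most one other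
nonzero entry, equal to 1. -/
theorem det_atomMatC_ne_zero (ha : ∀ i, 2 ≤ a i) : (atomMatC s a).det ≠ 0 := by
  refine det_ne_zero_of_sum_row_lt_diag fun i => ?_
  have h1 : ∀ j ∈ Finset.univ.erase i, ‖atomMatC s a i j‖ = if s i = some j then 1 else 0 := by
    intro j hj
    have : i ≠ j := (Finset.ne_of_mem_erase hj).symm
    simp only [atomMatC, Matrix.map_apply, atomMat, this, if_false, zero_add]
    split_ifs <;> simp
  rw [Finset.sum_congr rfl h1]
  have h2 : (2 : ℝ) ≤ ‖atomMatC s a i i‖ := by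
    rw [atomMatC, Matrix.map_apply, Complex.norm_natCast]
    have : 2 ≤ atomMat s a i i := by
      simp only [atomMat, if_true]
      exact le_add_right (ha i)
    exact_mod_cast this
  refine lt_of_le_of_lt ?_ (lt_of_lt_of_le one_lt_two h2)
  rcases hs : s i with _ | k
  · simp
  · simp only [Option.some.injEq]
    rw [Finset.sum_ite_eq]
    split_ifs <;> simp

/-- The terms of `atomPoly` are combinations of the `xⱼ ∂ⱼ`. -/
theorem term_eq_sum (ha : ∀ i, 2 ≤ a i) (i : σ) :
    MvPowerSeries.X i ^ a i * optX (s i) =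
      ∑ j, MvPowerSeries.C ((atomMatC s a)⁻¹ j i) * MvPowerSeries.X j * atomDeriv s a j := by
  have hE : atomMatC s a * (atomMatC s a)⁻¹ = 1 :=
    Matrix.mul_nonsing_inv _ (isUnit_iff_ne_zero.mpr (det_atomMatC_ne_zero s a ha))
  have h1 : ∀ j, MvPowerSeries.C ((atomMatC s a)⁻¹ j i) * MvPowerSeries.X j * atomDeriv s a j =
      ∑ k, MvPowerSeries.C (atomMatC s a k j * (atomMatC s a)⁻¹ j i) *
        (MvPowerSeries.X k ^ a k * optX (s k)) := by
    intro j
    rw [mul_assoc, atomDeriv_euler s a ha, Finset.mul_sum]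
    refine Finset.sum_congr rfl fun k _ => ?_
    rw [map_mul, atomMatC, Matrix.map_apply, map_natCast]
    ring
  rw [Finset.sum_congr rfl fun j _ => h1 j, Finset.sum_comm]
  simp only [← Finset.sum_mul, ← map_sum]
  have h2 : ∀ k, ∑ j, atomMatC s a k j * (atomMatC s a)⁻¹ j i = if k = i then 1 else 0 := by
    intro k
    rw [← Matrix.mul_apply, hE, Matrix.one_apply]
  simp [h2]

/-- The coefficients of a presentation of powers of the variables by the derivatives. -/
noncomputable def atomC : Matrix σ σ (MvPowerSeries σ ℂ) := fun i j =>
  match s i with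
  | none => MvPowerSeries.C ((atomMatC s a)⁻¹ j i) * MvPowerSeries.X j
  | some k => (if j = k then MvPowerSeries.X i ^ a i else 0) -
      (a k : MvPowerSeries σ ℂ) * MvPowerSeries.X k ^ (a k - 2) * optX (s k) *
        (MvPowerSeries.C ((atomMatC s a)⁻¹ j i) * MvPowerSeries.X j)

/-- The exponents in the presentation. -/
noncomputable def atomN : σ →₀ ℕ := Finsupp.equivFunOnFinite.symm fun i =>
  (if s i = none then 0 else a i) + (a i - 1)

variable {s a}

/-- If s i is undefined, xᵢ^aᵢ is itself a term. If s i = k, multiplying ∂ₖ = aₖ xₖ^(aₖ-1) x_{s(k)}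
+ xᵢ^aᵢ by xᵢ^aᵢ gives xᵢ^(2aᵢ) modulo a multiple of the term xᵢ^aᵢ xₖ, and terms are combinations
of derivatives. -/
theorem X_pow_eq_sum (hs : PartialInj s) (ha : ∀ i, 2 ≤ a i) (i : σ) :
    (MvPowerSeries.X i : MvPowerSeries σ ℂ) ^ (atomN s a i + 1) =
      ∑ j, atomC s a i j * atomDeriv s a j := by
  have hu := term_eq_sum s a ha i
  have hai := ha i
  rcases h : s i with _ | k
  · simp only [atomC, atomN, h, Finsupp.coe_equivFunOnFinite_symm, if_true, zero_add]
    rw [← hu, h, optX_none, mul_one, Nat.sub_add_cancel (by omega)]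
  · simp only [atomC, atomN, h, Finsupp.coe_equivFunOnFinite_symm, reduceCtorEq, if_false,
      sub_mul, Finset.sum_sub_distrib, ite_mul, zero_mul]
    rw [Finset.sum_ite_eq' Finset.univ k, if_pos (Finset.mem_univ k)]
    have h2 : ∀ j, (a k : MvPowerSeries σ ℂ) * MvPowerSeries.X k ^ (a k - 2) * optX (s k) *
        (MvPowerSeries.C ((atomMatC s a)⁻¹ j i) * MvPowerSeries.X j) * atomDeriv s a j =
        (a k : MvPowerSeries σ ℂ) * MvPowerSeries.X k ^ (a k - 2) * optX (s k) *
        (MvPowerSeries.C ((atomMatC s a)⁻¹ j i) * MvPowerSeries.X j * atomDeriv s a j) :=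
      fun j => by ring
    rw [Finset.sum_congr rfl fun j _ => h2 j, ← Finset.mul_sum, ← hu, h, optX_some,
      atomDeriv_of_some a hs h]
    obtain ⟨b, hb⟩ : ∃ b, a k = b + 2 := ⟨a k - 2, by have := ha k; omega⟩
    rw [show a i + (a i - 1) + 1 = a i + a i by omega, hb, Nat.add_sub_cancel,
      show b + 2 - 1 = b + 1 by omega, pow_add, pow_succ]
    ring

/-- The presentation of powers of the variables by the derivatives of `atomPoly`. -/
noncomputable def atomData (hs : PartialInj s) (ha : ∀ i, 2 ≤ a i) :
    ResidueData (atomDeriv s a) where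
  N := atomN s a
  C := atomC s a
  eq := X_pow_eq_sum hs ha

variable (s a) in
/-- A matrix with the same determinant as `atomC`, up to monomial factors and a constant. -/
noncomputable def atomM : Matrix σ σ (MvPowerSeries σ ℂ) := fun i j =>
  match s i with
  | none => if i = j then 1 else 0
  | some k => (if i = j then MvPowerSeries.X i ^ a i -
      (a k : MvPowerSeries σ ℂ) * MvPowerSeries.X k ^ (a k - 1) * optX (s k) else 0) +
        if k = j then (a k : MvPowerSeries σ ℂ) * MvPowerSeries.X i ^ a i else 0

/-- Multiplying row i by x_{s(i)} makes xⱼ a common factor of column j. What remains is `atomM`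
times the transposed inverse of the exponent matrix, whose determinants are both accessible. -/
theorem atomM_mul (hs : PartialInj s) (ha : ∀ i, 2 ≤ a i) (i j : σ) :
    (∑ l, atomM s a i l * MvPowerSeries.C ((atomMatC s a)⁻¹ j l)) * MvPowerSeries.X j =
      optX (s i) * atomC s a i j := by
  have hE : (atomMatC s a)⁻¹ * atomMatC s a = 1 :=
    Matrix.nonsing_inv_mul _ (isUnit_iff_ne_zero.mpr (det_atomMatC_ne_zero s a ha))
  rcases h : s i with _ | k
  · simp only [atomM, atomC, h, optX, Option.elim, ite_mul, one_mul, zero_mul]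
    rw [Finset.sum_ite_eq Finset.univ i, if_pos (Finset.mem_univ i)]
  · simp only [atomM, atomC, h, optX, Option.elim, add_mul, ite_mul, zero_mul,
      Finset.sum_add_distrib]
    rw [Finset.sum_ite_eq Finset.univ i, if_pos (Finset.mem_univ i),
      Finset.sum_ite_eq Finset.univ k, if_pos (Finset.mem_univ k)]
    -- By injectivity, column k of the exponent matrix is aₖ eₖ + eᵢ; this is the entry (j, k) of
    -- E⁻¹E = 1.
    have h1 : (atomMatC s a)⁻¹ j k * a k + (atomMatC s a)⁻¹ j i = if j = k then 1 else 0 := by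
      have := congrFun (congrFun hE j) k
      rw [Matrix.mul_apply, Matrix.one_apply] at this
      rw [← this]
      have h2 : ∀ l, (atomMatC s a)⁻¹ j l * atomMatC s a l k =
          (if l = k then (atomMatC s a)⁻¹ j k * a k else 0) +
            if l = i then (atomMatC s a)⁻¹ j i else 0 := by
        intro l
        have h3 : s l = some k ↔ l = i := ⟨fun h' => hs _ _ _ h' h, fun h' => h' ▸ h⟩
        rw [atomMatC, Matrix.map_apply, atomMat, Nat.cast_add, mul_add]
        congr 1
        · split_ifs with h4
          · rw [h4]
          · simp
        · simp only [h3]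
          split_ifs with h4
          · rw [h4]; simp
          · simp
      rw [Finset.sum_congr rfl fun l _ => h2 l, Finset.sum_add_distrib]
      simp
    have h4 := congrArg (MvPowerSeries.C (σ := σ) (R := ℂ)) h1
    rw [map_add, map_mul, map_natCast] at h4
    obtain ⟨b, hb⟩ : ∃ b, a k = b + 2 := ⟨a k - 2, by have := ha k; omega⟩
    rw [show a k - 1 = (a k - 2) + 1 by omega, pow_succ]
    by_cases hjk : j = k
    · subst hjk
      rw [if_pos rfl, map_one] at h4
      rw [if_pos rfl]
      linear_combination MvPowerSeries.X i ^ a i * MvPowerSeries.X j * h4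
    · rw [if_neg hjk, map_zero] at h4
      rw [if_neg hjk]
      linear_combination MvPowerSeries.X i ^ a i * MvPowerSeries.X j * h4

theorem det_atomC_mul (hs : PartialInj s) (ha : ∀ i, 2 ≤ a i) :
    (∏ i, optX (s i)) * (atomC s a).det =
      (atomM s a).det * MvPowerSeries.C ((atomMatC s a).det⁻¹) * ∏ j, MvPowerSeries.X j := by
  rw [← Matrix.det_mul_column]
  have h1 : (Matrix.of fun i j => optX (s i) * atomC s a i j) =
      Matrix.of fun i j => MvPowerSeries.X j *
        (atomM s a * (((atomMatC s a)⁻¹).transpose.map (MvPowerSeries.C (σ := σ)))) i j := by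
    ext1 i j
    rw [Matrix.of_apply, Matrix.of_apply, ← atomM_mul hs ha i j, mul_comm]
    rfl
  rw [h1, Matrix.det_mul_row, Matrix.det_mul, mul_comm]
  congr 2
  have : ((atomMatC s a)⁻¹).transpose.map (MvPowerSeries.C (σ := σ)) =
    (MvPowerSeries.C (σ := σ)).mapMatrix ((atomMatC s a)⁻¹).transpose := rfl
  rw [this, ← RingHom.map_det, Matrix.det_transpose, Matrix.det_nonsing_inv, Ring.inverse_eq_inv]

/-- The exponents of the socle monomial. -/
def IsSocle (s : σ → Option σ) (a soc : σ → ℕ) : Prop :=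
  ∀ j, soc j + 1 = (a j - 1) + if ∃ i, s i = some j then 1 else 0

theorem prod_optX (hs : PartialInj s) :
    ∏ i, optX (s i) = xpow fun j => if ∃ i, s i = some j then 1 else 0 := by
  have h1 : ∀ i, optX (s i) =
      ∏ j, (MvPowerSeries.X j : MvPowerSeries σ ℂ) ^ (if s i = some j then 1 else 0) := by
    intro i
    rcases h : s i with _ | k
    · simp [optX]
    · simp only [optX, Option.elim, Option.some.injEq]
      rw [Finset.prod_eq_single k]
      · simp
      · intro j _ hj
        simp [Ne.symm hj]
      · simp
  rw [Finset.prod_congr rfl fun i _ => h1 i, Finset.prod_comm, xpow]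
  refine Finset.prod_congr rfl fun j _ => ?_
  rw [Finset.prod_pow_eq_pow_sum]
  congr 1
  split_ifs with h
  · obtain ⟨i, hi⟩ := h
    rw [Finset.sum_eq_single i, if_pos hi]
    · intro l _ hl
      exact if_neg fun h' => hl (hs _ _ _ h' hi)
    · simp
  · exact Finset.sum_eq_zero fun i _ => if_neg fun h' => h ⟨i, h'⟩

/-- The socle exponent is chosen so that x^soc ∏ xⱼ = ∏ xⱼ^(aⱼ-1) ∏ x_{s(i)}. The last product turns
det C into det M by `det_atomC_mul`, ∏ xⱼ cancels, and ∏ xⱼ^(aⱼ-1) takes away the part aⱼ - 1 of Nⱼ.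
-/
theorem residue_socle_eq_coeff (hs : PartialInj s) (ha : ∀ i, 2 ≤ a i) {soc : σ → ℕ}
    (hsoc : IsSocle s a soc) :
    milnorResidue (atomPoly s a) (Ideal.Quotient.mk _ (xpow soc)) =
      (atomMatC s a).det⁻¹ * MvPowerSeries.coeff (Finsupp.equivFunOnFinite.symm fun i =>
        if s i = none then 0 else a i) (atomM s a).det := by
  rw [milnorResidue_mk]
  change grothendieckResidue (atomDeriv s a) (xpow soc) = _
  rw [grothendieckResidue_eq (atomData hs ha)]
  change MvPowerSeries.coeff (atomN s a) ((atomC s a).det * xpow soc) = _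
  have hX : (∏ j, MvPowerSeries.X j : MvPowerSeries σ ℂ) = xpow 1 := by simp [xpow]
  have h1 : (atomC s a).det * xpow soc * xpow 1 =
      (xpow fun j => a j - 1) * (MvPowerSeries.C ((atomMatC s a).det⁻¹) * (atomM s a).det) *
        xpow 1 := by
    have h2 : xpow (soc + 1) = xpow ((fun j => a j - 1) +
        fun j => if ∃ i, s i = some j then 1 else 0) :=
      congrArg xpow (funext hsoc)
    have h3 := det_atomC_mul hs ha
    rw [xpow_add, xpow_add, ← prod_optX hs] at h2
    rw [hX] at h3
    linear_combination (atomC s a).det * h2 + (xpow fun j => a j - 1) * h3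
  have hne : xpow (1 : σ → ℕ) ≠ 0 := by
    rw [xpow_eq_monomial]
    intro h
    have := congrArg (MvPowerSeries.coeff (Finsupp.equivFunOnFinite.symm (1 : σ → ℕ))) h
    simp at this
  rw [mul_right_cancel₀ hne h1]
  have hN : atomN s a = (Finsupp.equivFunOnFinite.symm fun i => a i - 1) +
      Finsupp.equivFunOnFinite.symm (fun i => if s i = none then 0 else a i) := by
    ext i
    simp [atomN, add_comm]
  rw [xpow_eq_monomial, hN, MvPowerSeries.coeff_add_monomial_mul, one_mul,
    MvPowerSeries.coeff_C_mul]

end AtomPoly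

/-! ## The residue of the socle monomial -/

section Socle

variable {σ : Type*} [Fintype σ] [DecidableEq σ] {s : σ → Option σ} {a : σ → ℕ}

variable (s a) in
/-- The exponents of the first term of a diagonal entry of `atomM`. -/
noncomputable def headExp (i : σ) : σ →₀ ℕ := if s i = none then 0 else Finsupp.single i (a i)

variable (s a) in
/-- The exponents of the second term of a diagonal entry of `atomM`. -/
noncomputable def tailExp (i : σ) : σ →₀ ℕ := (s i).elim 0 fun k =>
  Finsupp.single k (a k - 1) + (s k).elim 0 fun l => Finsupp.single l 1

variable (s a) in
/-- The coefficient of the second term of a diagonal entry of `atomM`. -/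
noncomputable def tailCoeff (i : σ) : ℂ := (s i).elim 0 fun k => -(a k : ℂ)

variable (s a) in
/-- The part of a diagonal entry of `atomM` that is not caused by a fixed point of `s`. -/
noncomputable def atomDiag (i : σ) : MvPowerSeries σ ℂ :=
  MvPowerSeries.monomial (headExp s a i) 1 + MvPowerSeries.monomial (tailExp s a i) (tailCoeff s a i)

theorem optX_eq_monomial {σ : Type*} (o : Option σ) :
    optX o = MvPowerSeries.monomial (o.elim 0 fun l => Finsupp.single l 1) (1 : ℂ) := by
  rcases o with _ | k
  · rfl
  · rfl

theorem atomDiag_of_some {σ : Type*} {s : σ → Option σ} {a : σ → ℕ} {i k : σ} (h : s i = some k) : atomDiag s a i =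
    MvPowerSeries.X i ^ a i -
      (a k : MvPowerSeries σ ℂ) * MvPowerSeries.X k ^ (a k - 1) * optX (s k) := by
  simp only [atomDiag, headExp, tailExp, tailCoeff, h, Option.elim_some, reduceCtorEq, if_false]
  rw [MvPowerSeries.X_pow_eq, MvPowerSeries.X_pow_eq, optX_eq_monomial, mul_assoc,
    MvPowerSeries.monomial_mul_monomial, mul_one, sub_eq_add_neg]
  congr 1
  rw [← map_natCast (MvPowerSeries.C (σ := σ) (R := ℂ)), ← MvPowerSeries.smul_eq_C_mul,
    ← map_smul, ← map_neg]
  simp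

theorem atomDiag_of_none {σ : Type*} {s : σ → Option σ} {a : σ → ℕ} {i : σ} (h : s i = none) : atomDiag s a i = 1 := by
  simp only [atomDiag, headExp, tailExp, tailCoeff, h, Option.elim_none, if_true, map_zero,
    add_zero]
  rfl

theorem sum_headExp {σ : Type*} [Fintype σ] {s : σ → Option σ} {a : σ → ℕ} : ∑ i, headExp s a i =
    Finsupp.equivFunOnFinite.symm fun i => if s i = none then 0 else a i := by
  ext j
  rw [Finsupp.finsetSum_apply, Finset.sum_eq_single j]
  · simp only [headExp, Finsupp.coe_equivFunOnFinite_symm]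
    split_ifs <;> simp
  · intro i _ hi
    simp only [headExp]
    split_ifs <;> simp [hi]
  · simp

/-- The heads contain xⱼ at least aⱼ ≥ 2 times. Without a predecessor of j in S, the tails contain
it at most once, namely through a second predecessor of j. -/
theorem exists_pred_of_sum_eq {σ : Type*} [DecidableEq σ] {s : σ → Option σ} {a : σ → ℕ}
    (hs : PartialInj s) (ha : ∀ i, 2 ≤ a i) (S : Finset σ)
    (hsum : ∑ i ∈ S, tailExp s a i = ∑ i ∈ S, headExp s a i)
    (hS : ∀ i ∈ S, s i ≠ none) {j : σ} (hj : j ∈ S) : ∃ i ∈ S, s i = some j := by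
  by_contra! hno
  have h1 : a j ≤ (∑ i ∈ S, headExp s a i) j := by
    rw [Finsupp.finsetSum_apply]
    refine le_trans ?_ (Finset.single_le_sum (fun i _ => Nat.zero_le _) hj)
    simp [headExp, hS j hj]
  rw [← hsum, Finsupp.finsetSum_apply] at h1
  have h2 : ∀ i ∈ S, tailExp s a i j = if (s i).bind s = some j then 1 else 0 := by
    intro i hi
    rcases hk : s i with _ | k
    · simp [tailExp, hk]
    · have hkj : k ≠ j := fun h => hno i hi (by rw [hk, h])
      rcases hl : s k with _ | l
      · simp [tailExp, hk, hl, hkj]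
      · simp only [tailExp, hk, hl, Option.elim_some, Finsupp.add_apply, Option.bind_some]
        rw [Finsupp.single_eq_of_ne hkj.symm, zero_add, Finsupp.single_apply]
        simp
  rw [Finset.sum_congr rfl h2, Finset.sum_boole, Nat.cast_id] at h1
  have h3 : (S.filter fun i => (s i).bind s = some j).card ≤ 1 := by
    rw [Finset.card_le_one]
    intro x hx y hy
    rw [Finset.mem_filter, Option.bind_eq_some_iff] at hx hy
    obtain ⟨-, k, hk, hk'⟩ := hx
    obtain ⟨-, l, hl, hl'⟩ := hy
    have := hs _ _ _ hk' hl'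
    subst this
    exact hs _ _ _ hk hl
  have := ha j
  omega

/-- S is the set of factors from which the tail is taken. The head monomials of the complement
cancel from the condition on exponents. -/
theorem coeff_prod_atomDiag : MvPowerSeries.coeff (∑ i, headExp s a i) (∏ i, atomDiag s a i) =
    ∑ S : Finset σ, if ∑ i ∈ S, tailExp s a i = ∑ i ∈ S, headExp s a i then
      ∏ i ∈ S, tailCoeff s a i else 0 := by
  have h : ∀ i, atomDiag s a i = MvPowerSeries.monomial (tailExp s a i) (tailCoeff s a i) +
      MvPowerSeries.monomial (headExp s a i) 1 := fun i => add_comm _ _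
  rw [Finset.prod_congr rfl fun i _ => h i, Finset.prod_add, Finset.powerset_univ, map_sum]
  refine Finset.sum_congr rfl fun T _ => ?_
  rw [← Finset.compl_eq_univ_sdiff, MvPowerSeries.prod_monomial, MvPowerSeries.prod_monomial,
    MvPowerSeries.monomial_mul_monomial, Finset.prod_const_one, mul_one,
    MvPowerSeries.coeff_monomial, ← Finset.sum_add_sum_compl T (fun i => headExp s a i)]
  congr 1
  rw [add_left_inj]
  exact propext eq_comm

/-- The residue of the socle monomial of a polynomial of chain type. -/
theorem residue_socle_chain (hs : PartialInj s) (ha : ∀ i, 2 ≤ a i) (rank : σ → ℕ)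
    (hrank : ∀ i k, s i = some k → rank i < rank k) {soc : σ → ℕ} (hsoc : IsSocle s a soc) :
    milnorResidue (atomPoly s a) (Ideal.Quotient.mk _ (xpow soc)) = (∏ i, (a i : ℂ))⁻¹ := by
  have hirr : ∀ i, s i ≠ some i := fun i h => lt_irrefl _ (hrank _ _ h)
  have hE : (atomMatC s a).det = ∏ i, (a i : ℂ) := by
    rw [det_eq_prod_diag_of_rank _ rank]
    · exact Finset.prod_congr rfl fun i _ => by simp [atomMatC, atomMat, hirr i]
    · intro i j hij h
      refine hrank i j ?_
      by_contra h'
      exact h (by simp [atomMatC, atomMat, hij, h'])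
  have hM : (atomM s a).det = ∏ i, atomDiag s a i := by
    rw [det_eq_prod_diag_of_rank _ rank]
    · refine Finset.prod_congr rfl fun i _ => ?_
      rcases h : s i with _ | k
      · simp [atomM, h, atomDiag_of_none h]
      · have : k ≠ i := fun h' => hirr i (h' ▸ h)
        simp [atomM, h, atomDiag_of_some h, this]
    · intro i j hij h
      refine hrank i j ?_
      by_contra h'
      refine h ?_
      rcases hk : s i with _ | k
      · simp [atomM, hk, hij]
      · have : k ≠ j := fun h'' => h' (h'' ▸ hk)
        simp [atomM, hk, hij, this]
  rw [residue_socle_eq_coeff hs ha hsoc, hE, hM, ← sum_headExp, coeff_prod_atomDiag,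
    Finset.sum_eq_single ∅]
  · simp
  · intro S _ hS
    split_ifs with h
    · by_contra hne
      have hS' : ∀ i ∈ S, s i ≠ none := by
        intro i hi h0
        exact hne (Finset.prod_eq_zero hi (by simp [tailCoeff, h0]))
      -- An element of least rank in S has no predecessor in S, so only S = ∅ contributes and the
      -- coefficient is 1.
      obtain ⟨j, hj, hmin⟩ := S.exists_min_image rank (Finset.nonempty_iff_ne_empty.mpr hS)
      obtain ⟨i, hi, hij⟩ := exists_pred_of_sum_eq hs ha S h hS' hj
      exact absurd (hmin i hi) (not_le.mpr (hrank i j hij))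
    · rfl
  · simp

/-- The determinant of the exponent matrix of a polynomial of loop type. -/
theorem det_atomMatC_loop [Nonempty σ] {p : Equiv.Perm σ} (hp : HasOneOrbit p) :
    (atomMatC (fun i => some (p i)) a).det =
      ∏ i, (a i : ℂ) + (Equiv.Perm.sign p : ℤ) := by
  have := det_cyclic hp (fun i => (a i : ℂ)) (fun _ => 1)
  rw [Finset.prod_const_one, mul_one] at this
  rw [← this]
  congr 1
  ext i j
  simp only [atomMatC, atomMat, Matrix.map_apply, Matrix.of_apply, Option.some.injEq,
    Nat.cast_add, Nat.cast_ite, Nat.cast_zero, Nat.cast_one]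

theorem partialInj_some {σ : Type*} (p : Equiv.Perm σ) : PartialInj fun i => some (p i) := by
  intro i j k hi hj
  simp only [Option.some.injEq] at hi hj
  exact p.injective (hi.trans hj.symm)

/-- The residue of the socle monomial of a polynomial of loop type. -/
theorem residue_socle_loop [Nonempty σ] {p : Equiv.Perm σ} (hp : HasOneOrbit p)
    (hsign : ((Equiv.Perm.sign p : ℤ) : ℂ) = -(-1) ^ Fintype.card σ) (ha : ∀ i, 2 ≤ a i) :
    milnorResidue (atomPoly (fun i => some (p i)) a)
      (Ideal.Quotient.mk _ (xpow fun i => a i - 1)) =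
      (∏ i, (a i : ℂ) - (-1) ^ Fintype.card σ)⁻¹ := by
  set s : σ → Option σ := fun i => some (p i) with hs'
  have hs : PartialInj s := partialInj_some p
  have hsoc : IsSocle s a fun i => a i - 1 := by
    intro j
    rw [if_pos ⟨p.symm j, by simp [hs']⟩]
  have hM : (atomM s a).det = ∏ i, atomDiag s a i + ((Equiv.Perm.sign p : ℤ) : MvPowerSeries σ ℂ) *
      ∏ i, ((a (p i) : MvPowerSeries σ ℂ) * MvPowerSeries.X i ^ a i) := by
    rw [← det_cyclic hp]
    congr 1
    ext1 i j
    simp only [atomM, hs', Matrix.of_apply]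
    congr 1
    split_ifs with h
    · exact (atomDiag_of_some (s := s) (i := i) (k := p i) rfl).symm
    · rfl
  have hprod : ∏ i, ((a (p i) : MvPowerSeries σ ℂ) * MvPowerSeries.X i ^ a i) =
      MvPowerSeries.C (∏ i, (a i : ℂ)) * xpow a := by
    rw [Finset.prod_mul_distrib, Equiv.prod_comp p (fun i => (a i : MvPowerSeries σ ℂ)), map_prod]
    simp only [map_natCast]
    rfl
  have htail : ∑ i, tailExp s a i = ∑ i, headExp s a i := by
    simp only [tailExp, headExp, hs', Option.elim_some, reduceCtorEq, if_false,
      Finset.sum_add_distrib]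
    rw [Equiv.sum_comp p (fun i => Finsupp.single i (a i - 1)),
      Equiv.sum_comp p (fun i => Finsupp.single (p i) 1),
      Equiv.sum_comp p (fun i => Finsupp.single i 1), ← Finset.sum_add_distrib]
    refine Finset.sum_congr rfl fun i _ => ?_
    rw [← Finsupp.single_add]
    congr 1
    have := ha i
    omega
  -- A contributing S is closed under predecessors, hence empty or everything.
  have hcoeff : MvPowerSeries.coeff (∑ i, headExp s a i) (∏ i, atomDiag s a i) =
      1 + (-1) ^ Fintype.card σ * ∏ i, (a i : ℂ) := by
    rw [coeff_prod_atomDiag, Finset.sum_eq_add ∅ Finset.univ]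
    · rw [if_pos (by simp), if_pos htail, Finset.prod_empty]
      congr 1
      simp only [tailCoeff, hs', Option.elim_some, Finset.prod_neg]
      rw [Equiv.prod_comp p (fun i => (a i : ℂ)), Finset.card_univ]
    · exact Finset.univ_nonempty.ne_empty.symm
    · intro S _ hS
      refine if_neg fun h => ?_
      have hcl : ∀ i, p i ∈ S → i ∈ S := by
        intro i hi
        obtain ⟨j, hj, hji⟩ := exists_pred_of_sum_eq hs ha S h (by simp [hs']) hi
        have : j = i := p.injective (Option.some.inj hji)
        rwa [← this]
      rcases hp.eq_empty_or_univ S hcl with h | h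
      · exact hS.1 h
      · exact hS.2 h
    · simp
    · simp
  have hsgn : MvPowerSeries.coeff (∑ i, headExp s a i)
      (((Equiv.Perm.sign p : ℤ) : MvPowerSeries σ ℂ) *
        (MvPowerSeries.C (∏ i, (a i : ℂ)) * xpow a)) =
      (Equiv.Perm.sign p : ℤ) * ∏ i, (a i : ℂ) := by
    rw [← map_intCast (MvPowerSeries.C (σ := σ) (R := ℂ)), MvPowerSeries.coeff_C_mul,
      MvPowerSeries.coeff_C_mul, sum_headExp, xpow_eq_monomial]
    simp [hs', MvPowerSeries.coeff_monomial_same]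
  -- The full set S and the cyclic permutation contribute (-1)ⁿ ∏ aᵢ and sign(p) ∏ aᵢ, which cancel.
  -- The coefficient is again 1, and the residue is the inverse of the determinant of the exponent
  -- matrix.
  rw [residue_socle_eq_coeff hs ha hsoc, det_atomMatC_loop hp, hM, ← sum_headExp, map_add,
    hcoeff, hprod, hsgn, hsign]
  ring

end Socle

/-! ## Monomials in the Milnor ring -/

section Milnor

variable {σ : Type*} [Fintype σ]

/-- The class of the monomial `∏ xⱼ ^ mⱼ` in the Milnor ring of `w`. -/
noncomputable def cls (w : MvPolynomial σ ℂ) (m : σ → ℕ) : MilnorRing w :=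
  Ideal.Quotient.mk _ (xpow m)

theorem cls_add (w : MvPolynomial σ ℂ) (m m' : σ → ℕ) : cls w (m + m') = cls w m * cls w m' := by
  rw [cls, xpow_add, map_mul]
  rfl

theorem cls_zero (w : MvPolynomial σ ℂ) : cls w 0 = 1 := by
  rw [cls, xpow_zero, map_one]

theorem cls_sum {ι : Type*} (w : MvPolynomial σ ℂ) (T : Finset ι) (m : ι → σ → ℕ) :
    cls w (∑ i ∈ T, m i) = ∏ i ∈ T, cls w (m i) := by
  classical
  induction T using Finset.induction_on with
  | empty => simp [cls_zero]
  | insert i T hi ih => rw [Finset.sum_insert hi, Finset.prod_insert hi, cls_add, ih]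

variable [DecidableEq σ]

/-- If powers of all variables lie in the Jacobian ideal, the monomials span the Milnor ring. -/
theorem span_range_cls (w : MvPolynomial σ ℂ) (N : σ → ℕ)
    (hN : ∀ i, (MvPowerSeries.X i : MvPowerSeries σ ℂ) ^ (N i + 1) ∈ jacobianIdeal w) :
    Submodule.span ℂ (Set.range (cls w)) = ⊤ := by
  rw [eq_top_iff]
  intro q _
  obtain ⟨f, rfl⟩ := Ideal.Quotient.mk_surjective q
  have key : ∀ S : Finset σ, ∃ g : MvPowerSeries σ ℂ, f - g ∈ jacobianIdeal w ∧
      ∀ m : σ →₀ ℕ, MvPowerSeries.coeff m g ≠ 0 → ∀ i ∈ S, m i ≤ N i := by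
    intro S
    induction S using Finset.induction_on with
    | empty => exact ⟨f, by simp, by simp⟩
    | insert i S hi ih =>
      obtain ⟨g, hg, hg'⟩ := ih
      -- The omitted terms are together divisible by X_i^(N_i+1), hence lie in the Jacobian ideal.
      -- After all variables are treated a polynomial remains.
      let g₁ : MvPowerSeries σ ℂ := fun m => if m i ≤ N i then MvPowerSeries.coeff m g else 0
      have hg₁ : ∀ m, MvPowerSeries.coeff m g₁ =
          if m i ≤ N i then MvPowerSeries.coeff m g else 0 := fun m => rfl
      refine ⟨g₁, ?_, ?_⟩
      · have hd : (MvPowerSeries.X i : MvPowerSeries σ ℂ) ^ (N i + 1) ∣ g - g₁ := by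
          rw [MvPowerSeries.X_pow_dvd_iff]
          intro m hm
          rw [map_sub, hg₁, if_pos (by omega), sub_self]
        have := Ideal.add_mem _ hg (Ideal.mem_of_dvd _ hd (hN i))
        rwa [sub_add_sub_cancel] at this
      · intro m hm j hj
        rw [hg₁] at hm
        rcases Finset.mem_insert.mp hj with rfl | hj
        · by_contra h
          exact hm (if_neg h)
        · refine hg' m ?_ j hj
          intro h
          rw [h] at hm
          simp at hm
  obtain ⟨g, hg, hg'⟩ := key Finset.univ
  have hfg : (Ideal.Quotient.mk (jacobianIdeal w) f) = Ideal.Quotient.mk _ g :=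
    Ideal.Quotient.eq.mpr hg
  rw [hfg]
  let B : Finset (σ →₀ ℕ) := Finset.Iic (Finsupp.equivFunOnFinite.symm N)
  have hB : g = ∑ m ∈ B, MvPowerSeries.coeff m g • xpow (fun i => m i) := by
    ext m
    rw [map_sum]
    have h1 : ∀ m' ∈ B, MvPowerSeries.coeff m (MvPowerSeries.coeff m' g • xpow (fun i => m' i)) =
        if m = m' then MvPowerSeries.coeff m g else 0 := by
      intro m' _
      rw [map_smul, xpow_eq_monomial, MvPowerSeries.coeff_monomial]
      have h2 : Finsupp.equivFunOnFinite.symm (fun i => m' i) = m' := by ext; rfl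
      rw [h2]
      split_ifs with h <;> simp [h]
    rw [Finset.sum_congr rfl h1, Finset.sum_ite_eq]
    split_ifs with h
    · rfl
    · by_contra hne
      refine h (Finset.mem_Iic.mpr fun i => ?_)
      exact hg' m hne i (Finset.mem_univ i)
  rw [hB, map_sum]
  refine Submodule.sum_mem _ fun m _ => ?_
  have : Ideal.Quotient.mk (jacobianIdeal w) (MvPowerSeries.coeff m g • xpow (fun i => m i)) =
      MvPowerSeries.coeff m g • cls w (fun i => m i) := rfl
  rw [this]
  exact Submodule.smul_mem _ _ (Submodule.subset_span ⟨_, rfl⟩)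

/-- A finite family of vectors, each of which lies in a subspace or is a multiple by a factor of
absolute value greater than one of another member, lies in the subspace. -/
theorem mem_of_expanding {ι V : Type*} [Finite ι] [AddCommGroup V] [Module ℂ V]
    (v : ι → V) (U : Submodule ℂ V)
    (h : ∀ x, v x ∈ U ∨ ∃ y, ∃ c : ℂ, 1 < ‖c‖ ∧ v x = c • v y) (x : ι) : v x ∈ U := by
  by_contra hx
  -- For a functional φ that vanishes on U but not on v x, take a member y with |φ(v y)| nonzero and
  -- minimal. Its relation would lead to a member with a smaller nonzero value.
  obtain ⟨φ, hφ, hU⟩ := Submodule.exists_le_ker_of_notMem hx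
  have hfin : {y | φ (v y) ≠ 0}.Finite := Set.toFinite _
  obtain ⟨y, hy, hmin⟩ := hfin.exists_minimalFor (fun y => ‖φ (v y)‖) _ ⟨x, hφ⟩
  rcases h y with hy' | ⟨z, c, hc, hz⟩
  · exact hy (hU hy')
  · have h1 : φ (v y) = c * φ (v z) := by rw [hz, map_smul, smul_eq_mul]
    have hz0 : φ (v z) ≠ 0 := fun h0 => hy (by rw [h1, h0, mul_zero])
    have h2 : ‖φ (v y)‖ = ‖c‖ * ‖φ (v z)‖ := by rw [h1, norm_mul]
    have hpos : 0 < ‖φ (v z)‖ := norm_pos_iff.mpr hz0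
    have h3 : ‖φ (v z)‖ < ‖φ (v y)‖ := by rw [h2]; nlinarith
    exact absurd (hmin hz0 h3.le) (not_le.mpr h3)

variable {s : σ → Option σ} {a : σ → ℕ} {w : MvPolynomial σ ℂ}

theorem mk_atomDeriv {σ : Type*} [Fintype σ] {s : σ → Option σ} {a : σ → ℕ}
    {w : MvPolynomial σ ℂ} (hw : w = atomPoly s a) (j : σ) :
    Ideal.Quotient.mk (jacobianIdeal w) (atomDeriv s a j) = 0 := by
  subst hw
  exact Ideal.Quotient.eq_zero_iff_mem.mpr (Ideal.subset_span ⟨j, rfl⟩)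

/-- The exponent vector of `x_o`. -/
def optExp (o : Option σ) : σ → ℕ := o.elim 0 fun l => Pi.single l 1

theorem xpow_optExp (o : Option σ) : xpow (optExp o) = optX o := by
  rcases o with _ | k
  · exact xpow_zero
  · simp [optExp, optX_some, xpow_single]

theorem cls_single_add_optExp (hw : w = atomPoly s a) (ha : ∀ i, 2 ≤ a i) (i : σ) :
    cls w (Pi.single i (a i) + optExp (s i)) = 0 := by
  rw [cls, xpow_add, xpow_single, xpow_optExp, term_eq_sum s a ha i, map_sum]
  exact Finset.sum_eq_zero fun j _ => by rw [map_mul, mk_atomDeriv hw, mul_zero]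

/-- This is the relation ∂ₖ = 0; by injectivity i is the only index that contributes a term xᵢ^aᵢ to
it. -/
theorem cls_single (hw : w = atomPoly s a) (hs : PartialInj s) {i k : σ} (h : s i = some k) :
    cls w (Pi.single i (a i)) =
      (-(a k : ℂ)) • cls w (Pi.single k (a k - 1) + optExp (s k)) := by
  have h1 := mk_atomDeriv hw k
  rw [atomDeriv_of_some a hs h, map_add] at h1
  have h2 := eq_neg_of_add_eq_zero_right h1
  rw [cls, xpow_single, h2, cls, xpow_add, xpow_single, xpow_optExp, neg_smul, mul_assoc]
  congr 1
  rw [map_mul, map_natCast, Nat.cast_smul_eq_nsmul ℂ, nsmul_eq_mul]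

/-- The simultaneous application of the relations at the elements of `T`. -/
theorem cls_add_sum_single (hw : w = atomPoly s a) (hs : PartialInj s) (T : Finset σ)
    (k : σ → σ) (hk : ∀ i ∈ T, s i = some (k i)) (h : σ → ℕ) :
    cls w (h + ∑ i ∈ T, Pi.single i (a i)) = (∏ i ∈ T, -(a (k i) : ℂ)) •
      cls w (h + ∑ i ∈ T, (Pi.single (k i) (a (k i) - 1) + optExp (s (k i)))) := by
  rw [cls_add, cls_sum, Finset.prod_congr rfl fun i hi => cls_single hw hs (hk i hi),
    Finset.prod_smul, cls_add, cls_sum, mul_smul_comm]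

/-- Overflow at i is rewritten with xᵢ^aᵢ = -aₖ xₖ^(aₖ-1) x_{s(k)}. The result is zero, lies in the
box, or is -aₖ times a box monomial times one more variable. Along a loop the last case may recur
forever, but there are finitely many such products and |aₖ| ≥ 2, so `mem_of_expanding` applies. -/
theorem cls_mul_single_mem (hw : w = atomPoly s a) (hs : PartialInj s) (ha : ∀ i, 2 ≤ a i)
    (m : σ → ℕ) (hm : ∀ i, m i < a i) (i : σ) :
    cls w (m + Pi.single i 1) ∈ Submodule.span ℂ (cls w '' {m | ∀ i, m i < a i}) := by
  set U := Submodule.span ℂ (cls w '' {m | ∀ i, m i < a i})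
  have hbox : ∀ m : σ → ℕ, (∀ i, m i < a i) → cls w m ∈ U := fun m hm =>
    Submodule.subset_span ⟨m, hm, rfl⟩
  let v : ((∀ i, Fin (a i)) × σ) → MilnorRing w := fun x =>
    cls w ((fun j => (x.1 j : ℕ)) + Pi.single x.2 1)
  refine mem_of_expanding v U ?_ (fun j => ⟨m j, hm j⟩, i)
  rintro ⟨f, i⟩
  set m : σ → ℕ := fun j => (f j : ℕ) with hmf
  have hm : ∀ j, m j < a j := fun j => (f j).2
  change cls w (m + Pi.single i 1) ∈ U ∨ ∃ y : (∀ i, Fin (a i)) × σ, ∃ c : ℂ,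
    1 < ‖c‖ ∧ cls w (m + Pi.single i 1) = c • v y
  by_cases hi : m i + 1 < a i
  · left
    refine hbox _ fun j => ?_
    by_cases hj : j = i
    · subst hj; simpa using hi
    · simpa [hj] using hm j
  have hi' : m i + 1 = a i := by have := hm i; omega
  set h : σ → ℕ := Function.update m i 0 with hh
  have hdec : m + Pi.single i 1 = h + Pi.single i (a i) := by
    funext j
    by_cases hj : j = i
    · subst hj; simp [hh, hi']
    · simp [hh, hj]
  rcases hsi : s i with _ | k
  · left
    have h0 := cls_single_add_optExp hw ha i
    rw [hsi, show optExp (none : Option σ) = 0 from rfl, add_zero] at h0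
    rw [hdec, cls_add, h0, mul_zero]
    exact zero_mem _
  -- A fixed point occurs for the loop in one variable; the relation then reads (1 + aₖ) xₖ^aₖ = 0.
  by_cases hki : k = i
  · left
    subst hki
    have h0 := cls_single hw hs hsi
    have h1 : (Pi.single k (a k - 1) : σ → ℕ) + optExp (s k) = Pi.single k (a k) := by
      rw [hsi]
      change (Pi.single k (a k - 1) : σ → ℕ) + Pi.single k 1 = _
      rw [← Pi.single_add, Nat.sub_add_cancel (by have := ha k; omega)]
    rw [h1, neg_smul, eq_neg_iff_add_eq_zero] at h0
    have h2 : ((1 : ℂ) + a k) • cls w (Pi.single k (a k)) = 0 := by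
      rw [add_smul, one_smul, h0]
    have h3 : (1 : ℂ) + a k ≠ 0 := by exact_mod_cast (by omega : 1 + a k ≠ 0)
    rw [hdec, cls_add, (smul_eq_zero.mp h2).resolve_left h3, mul_zero]
    exact zero_mem _
  by_cases hmk : m k = 0
  · have hstep : cls w (m + Pi.single i 1) =
        (-(a k : ℂ)) • cls w (h + Pi.single k (a k - 1) + optExp (s k)) := by
      rw [hdec, cls_add, cls_single hw hs hsi, mul_smul_comm, ← cls_add, add_assoc]
    have hb : ∀ j, (h + (Pi.single k (a k - 1) : σ → ℕ)) j < a j := by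
      intro j
      by_cases hj : j = k
      · subst hj
        have := ha j
        simp [hh, hki, hmk]
        omega
      · by_cases hj' : j = i
        · subst hj'
          have := ha j
          simp [hh, hj]
          omega
        · simpa [hh, hj, hj'] using hm j
    rcases hsk : s k with _ | l
    · left
      rw [hstep, hsk]
      exact U.smul_mem _ (hbox _ hb)
    · right
      refine ⟨(fun j => ⟨_, hb j⟩, l), -(a k : ℂ), ?_, ?_⟩
      · rw [norm_neg, Complex.norm_natCast]
        exact_mod_cast ha k
      · rw [hstep, hsk]
        rfl
  -- Now xₖ divides the monomial, and xᵢ^aᵢ xₖ is a term of the polynomial, which vanishes in the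
  -- Milnor ring.
  · left
    have : m + Pi.single i 1 = (h - Pi.single k 1) + (Pi.single i (a i) + optExp (s i)) := by
      rw [hdec, hsi]
      funext j
      by_cases hj : j = k
      · subst hj
        simp [hh, optExp, hki]
        omega
      · simp [optExp, hj]
    rw [this, cls_add, cls_single_add_optExp hw ha, mul_zero]
    exact zero_mem _

/-- The monomials with exponents `mᵢ < aᵢ` span the Milnor ring. -/
theorem span_box (hw : w = atomPoly s a) (hs : PartialInj s) (ha : ∀ i, 2 ≤ a i) :
    Submodule.span ℂ (cls w '' {m | ∀ i, m i < a i}) = ⊤ := by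
  set U := Submodule.span ℂ (cls w '' {m | ∀ i, m i < a i}) with hU
  have hmul : ∀ i, ∀ q ∈ U, q * cls w (Pi.single i 1) ∈ U := by
    intro i q hq
    induction hq using Submodule.span_induction with
    | mem x hx =>
      obtain ⟨m, hm, rfl⟩ := hx
      rw [← cls_add]
      exact cls_mul_single_mem hw hs ha m hm i
    | zero => rw [zero_mul]; exact zero_mem _
    | add x y _ _ hx hy => rw [add_mul]; exact add_mem hx hy
    | smul c x _ hx => rw [smul_mul_assoc]; exact U.smul_mem _ hx
  have hall : ∀ n : ℕ, ∀ m : σ → ℕ, ∑ i, m i = n → cls w m ∈ U := by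
    intro n
    induction n with
    | zero =>
      intro m hm
      have : m = 0 := funext fun i => by simpa using (Finset.sum_eq_zero_iff.mp hm) i
      subst this
      exact Submodule.subset_span ⟨0, fun i => by have := ha i; simp; omega, rfl⟩
    | succ n ih =>
      intro m hm
      obtain ⟨i, hi⟩ : ∃ i, m i ≠ 0 := by
        by_contra! h
        simp [h] at hm
      have h1 : m = (m - Pi.single i 1) + Pi.single i 1 := by
        funext j
        by_cases hj : j = i
        · subst hj; simp; omega
        · simp [hj]
      rw [h1, cls_add]
      refine hmul i _ (ih _ ?_)
      have h2 := congrArg (fun f : σ → ℕ => ∑ j, f j) h1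
      simp only [Pi.add_apply, Finset.sum_add_distrib, Finset.sum_pi_single',
        Finset.mem_univ, if_true] at h2
      have h3 : ∑ j, (Pi.single i 1 : σ → ℕ) j = 1 := by simp
      omega
  rw [eq_top_iff, ← span_range_cls w (atomN s a) ?_, Submodule.span_le]
  · rintro _ ⟨m, rfl⟩
    exact hall _ m rfl
  · intro i
    rw [X_pow_eq_sum hs ha, hw]
    exact Ideal.sum_mem _ fun j _ => Ideal.mul_mem_left _ _ (Ideal.subset_span ⟨j, rfl⟩)

end Milnor

/-! ## The Chern character of a Koszul matrix factorization as a determinant -/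

section Clifford

variable {R : Type*} [CommRing R] {r : ℕ}

/-- The sign `(-1) ^ #{x ∈ S | x < k}`. -/
def extSign (R : Type*) [CommRing R] (k : Fin r) (S : Finset (Fin r)) : R :=
  (-1) ^ (S.filter (· < k)).card

/-- The creation operator `eₖ ∧ ·` (second component `0`) and the annihilation operator `ι(eₖ)`
(second component `1`). -/
def cliffGen (R : Type*) [CommRing R] (p : Fin r × Fin 2) :
    Matrix (Finset (Fin r)) (Finset (Fin r)) R := fun T S =>
  if T = symmDiff S {p.1} then (if (p.1 ∈ S ↔ p.2 = 1) then extSign R p.1 S else 0) else 0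

/-- The index of the operator dual to the one with index `p`. -/
def cliffDual (p : Fin r × Fin 2) : Fin r × Fin 2 := (p.1, 1 - p.2)

theorem extSign_mul_self (k : Fin r) (S : Finset (Fin r)) :
    extSign R k S * extSign R k S = 1 := by
  rw [extSign, ← pow_add, ← two_mul, pow_mul]
  simp

theorem extSign_symmDiff_self (k : Fin r) (S : Finset (Fin r)) :
    extSign R k (symmDiff S {k}) = extSign R k S := by
  unfold extSign
  congr 2
  ext x
  simp only [Finset.mem_filter, Finset.mem_symmDiff, Finset.mem_singleton]
  constructor
  · rintro ⟨h, hx⟩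
    have : x ≠ k := hx.ne
    tauto
  · rintro ⟨h, hx⟩
    have : x ≠ k := hx.ne
    tauto

theorem extSign_symmDiff_of_lt {k l : Fin r} (h : k < l) (S : Finset (Fin r)) :
    extSign R l (symmDiff S {k}) = -extSign R l S := by
  unfold extSign
  by_cases hk : k ∈ S
  · have h1 : S.filter (· < l) = insert k ((symmDiff S {k}).filter (· < l)) := by
      ext x
      simp only [Finset.mem_filter, Finset.mem_insert, Finset.mem_symmDiff, Finset.mem_singleton]
      by_cases hx : x = k
      · subst hx; tauto
      · tauto
    rw [h1, Finset.card_insert_of_notMem, pow_succ]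
    · ring
    · simp [Finset.mem_symmDiff, hk]
  · have h1 : (symmDiff S {k}).filter (· < l) = insert k (S.filter (· < l)) := by
      ext x
      simp only [Finset.mem_filter, Finset.mem_insert, Finset.mem_symmDiff, Finset.mem_singleton]
      by_cases hx : x = k
      · subst hx; tauto
      · tauto
    rw [h1, Finset.card_insert_of_notMem, pow_succ]
    · ring
    · simp [hk]

theorem extSign_symmDiff_of_gt {k l : Fin r} (h : l < k) (S : Finset (Fin r)) :
    extSign R l (symmDiff S {k}) = extSign R l S := by
  unfold extSign
  congr 2
  ext x
  simp only [Finset.mem_filter, Finset.mem_symmDiff, Finset.mem_singleton]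
  constructor
  · rintro ⟨h', hx⟩
    have : x ≠ k := (hx.trans h).ne
    tauto
  · rintro ⟨h', hx⟩
    have : x ≠ k := (hx.trans h).ne
    tauto

theorem mul_cliffGen_apply (M : Matrix (Finset (Fin r)) (Finset (Fin r)) R) (p : Fin r × Fin 2)
    (T S : Finset (Fin r)) : (M * cliffGen R p) T S =
      M T (symmDiff S {p.1}) * if (p.1 ∈ S ↔ p.2 = 1) then extSign R p.1 S else 0 := by
  rw [Matrix.mul_apply, Finset.sum_eq_single (symmDiff S {p.1})]
  · simp [cliffGen]
  · intro U _ hU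
    simp [cliffGen, hU]
  · simp

/-- Adding or removing the smaller index flips the sign attached to the larger one, but not
conversely. -/
theorem cliffGen_anticomm_of_lt {p q : Fin r × Fin 2} (h : p.1 < q.1) :
    cliffGen R p * cliffGen R q + cliffGen R q * cliffGen R p = 0 := by
  ext T S
  rw [Matrix.add_apply, mul_cliffGen_apply, mul_cliffGen_apply, Matrix.zero_apply]
  have h1 : symmDiff (symmDiff S {q.1}) {p.1} = symmDiff (symmDiff S {p.1}) {q.1} := by
    rw [symmDiff_assoc, symmDiff_comm {q.1} {p.1}, ← symmDiff_assoc]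
  have h2 : p.1 ∈ symmDiff S {q.1} ↔ p.1 ∈ S := by
    simp [Finset.mem_symmDiff, h.ne]
  have h3 : q.1 ∈ symmDiff S {p.1} ↔ q.1 ∈ S := by
    simp [Finset.mem_symmDiff, h.ne']
  simp only [cliffGen, h1, h2, h3, extSign_symmDiff_of_lt h, extSign_symmDiff_of_gt h]
  split_ifs <;> ring

theorem cliffGen_mul_of_fst_eq {p q : Fin r × Fin 2} (h : p.1 = q.1) :
    cliffGen R p * cliffGen R q =
      Matrix.diagonal fun S => if (q.1 ∈ S ↔ q.2 = 1) ∧ p.2 = 1 - q.2 then 1 else 0 := by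
  ext T S
  rw [mul_cliffGen_apply, Matrix.diagonal_apply]
  have h1 : symmDiff (symmDiff S {q.1}) {q.1} = S := by
    rw [symmDiff_assoc, symmDiff_self]
    exact symmDiff_bot _
  have h2 : q.1 ∈ symmDiff S {q.1} ↔ q.1 ∉ S := by
    simp [Finset.mem_symmDiff]
  simp only [cliffGen, h, h1, h2, extSign_symmDiff_self]
  obtain ⟨p1, p2⟩ := p
  obtain ⟨q1, q2⟩ := q
  simp only at h ⊢
  subst h
  by_cases hT : T = S
  · subst hT
    by_cases hp : p1 ∈ T
    · fin_cases p2 <;> fin_cases q2 <;> simp [hp, extSign_mul_self]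
    · fin_cases p2 <;> fin_cases q2 <;> simp [hp, extSign_mul_self]
  · simp [hT]

theorem cliffGen_anticomm (p q : Fin r × Fin 2) :
    cliffGen R p * cliffGen R q + cliffGen R q * cliffGen R p =
      if q = cliffDual p then 1 else 0 := by
  rcases lt_trichotomy p.1 q.1 with h | h | h
  · rw [cliffGen_anticomm_of_lt h, if_neg]
    rintro rfl
    exact lt_irrefl _ h
  · rw [cliffGen_mul_of_fst_eq h, cliffGen_mul_of_fst_eq h.symm, Matrix.diagonal_add]
    obtain ⟨p1, p2⟩ := p
    obtain ⟨q1, q2⟩ := q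
    simp only at h
    subst h
    have : ((p1, q2) = cliffDual (p1, p2)) ↔ q2 = 1 - p2 := by simp [cliffDual]
    simp only [this]
    rw [show (if q2 = 1 - p2 then (1 : Matrix (Finset (Fin r)) (Finset (Fin r)) R) else 0) =
      Matrix.diagonal fun _ => if q2 = 1 - p2 then 1 else 0 by split_ifs <;> simp]
    congr 1
    funext S
    by_cases hp : p1 ∈ S
    · fin_cases p2 <;> fin_cases q2 <;> simp [hp]
    · fin_cases p2 <;> fin_cases q2 <;> simp [hp]
  · rw [add_comm, cliffGen_anticomm_of_lt h, if_neg]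
    rintro rfl
    exact lt_irrefl _ h

/-- The operator of Clifford multiplication by a vector. -/
def cliff (R : Type*) [CommRing R] {r : ℕ} : (Fin r × Fin 2 → R) →ₗ[R]
    Matrix (Finset (Fin r)) (Finset (Fin r)) R :=
  Fintype.linearCombination R (cliffGen R)

theorem cliff_anticomm (v w : Fin r × Fin 2 → R) :
    cliff R v * cliff R w + cliff R w * cliff R v =
      (∑ p, v p * w (cliffDual p)) • (1 : Matrix (Finset (Fin r)) (Finset (Fin r)) R) := by
  simp only [cliff, Fintype.linearCombination_apply, Finset.sum_mul, Finset.mul_sum]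
  rw [Finset.sum_comm, ← Finset.sum_add_distrib, Finset.sum_smul]
  refine Finset.sum_congr rfl fun p _ => ?_
  rw [← Finset.sum_add_distrib, ← Finset.sum_subset (Finset.subset_univ {cliffDual p})]
  · rw [Finset.sum_singleton, smul_mul_smul_comm, smul_mul_smul_comm, mul_comm (w _), ← smul_add,
      cliffGen_anticomm, if_pos rfl]
  · intro q _ hq
    rw [smul_mul_smul_comm, smul_mul_smul_comm, mul_comm (w _), ← smul_add, cliffGen_anticomm,
      if_neg (by simpa using hq), smul_zero]

/-- The supertrace as a linear map. -/
def superTraceₗ (R : Type*) [CommRing R] (r : ℕ) :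
    Matrix (Finset (Fin r)) (Finset (Fin r)) R →ₗ[R] R where
  toFun := superTrace
  map_add' M N := by simp [superTrace, mul_add, Finset.sum_add_distrib]
  map_smul' c M := by
    simp only [superTrace, Matrix.smul_apply, smul_eq_mul, RingHom.id_apply, Finset.mul_sum]
    exact Finset.sum_congr rfl fun S _ => by ring

theorem superTraceₗ_apply (M : Matrix (Finset (Fin r)) (Finset (Fin r)) R) :
    superTraceₗ R r M = superTrace M := rfl

/-- A generator changes the parity of the subset, so the cyclicity of the trace acquires a sign. -/
theorem superTrace_cliffGen_mul (p : Fin r × Fin 2)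
    (M : Matrix (Finset (Fin r)) (Finset (Fin r)) R) :
    superTrace (cliffGen R p * M) = -superTrace (M * cliffGen R p) := by
  simp only [superTrace, Matrix.mul_apply, Finset.mul_sum]
  rw [Finset.sum_comm, ← Finset.sum_neg_distrib]
  refine Finset.sum_congr rfl fun S _ => ?_
  rw [← Finset.sum_neg_distrib]
  refine Finset.sum_congr rfl fun T _ => ?_
  simp only [cliffGen]
  by_cases hT : T = symmDiff S {p.1}
  · have hc : (-1 : R) ^ T.card = -(-1) ^ S.card := by
      subst hT
      by_cases hp : p.1 ∈ S
      · have : S = insert p.1 (symmDiff S {p.1}) := by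
          ext x
          simp only [Finset.mem_insert, Finset.mem_symmDiff, Finset.mem_singleton]
          by_cases hx : x = p.1
          · subst hx; tauto
          · tauto
        conv_rhs => rw [this]
        rw [Finset.card_insert_of_notMem (by simp [Finset.mem_symmDiff, hp]), pow_succ]
        ring
      · have : symmDiff S {p.1} = insert p.1 S := by
          ext x
          simp only [Finset.mem_insert, Finset.mem_symmDiff, Finset.mem_singleton]
          by_cases hx : x = p.1
          · subst hx; tauto
          · tauto
        rw [this, Finset.card_insert_of_notMem hp, pow_succ]
        ring
    rw [hc]
    ring
  · simp [hT]

/-- The supertrace of a product of an even number of generators vanishes if one is missing. -/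
theorem superTrace_gen_eq_zero (l : List (Fin r × Fin 2)) (hl : Even l.length)
    (hlt : l.length < 2 * r) : superTrace ((l.map (cliffGen R)).prod) = 0 := by
  obtain ⟨p, hp⟩ : ∃ p, p ∉ l := by
    by_contra! h
    have h1 : Fintype.card (Fin r × Fin 2) ≤ l.toFinset.card := by
      rw [← Finset.card_univ]
      exact Finset.card_le_card fun p _ => List.mem_toFinset.mpr (h p)
    have h2 := l.toFinset_card_le
    simp only [Fintype.card_prod, Fintype.card_fin] at h1
    omega
  set q := cliffDual p with hq
  have hqp : cliffDual q = p := by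
    simp [hq, cliffDual]
  have hcomm : ∀ l : List (Fin r × Fin 2), p ∉ l → cliffGen R q * (l.map (cliffGen R)).prod =
      (-1) ^ l.length * ((l.map (cliffGen R)).prod * cliffGen R q) := by
    intro l
    induction l with
    | nil => simp
    | cons t l ih =>
      intro hl
      rw [List.mem_cons, not_or] at hl
      have h1 := cliffGen_anticomm (R := R) q t
      rw [hqp, if_neg (Ne.symm hl.1)] at h1
      have h2 := eq_neg_of_add_eq_zero_left h1
      rw [List.map_cons, List.prod_cons, ← mul_assoc, h2, neg_mul, mul_assoc, ih hl.2,
        List.length_cons, pow_succ, mul_neg_one, neg_mul, neg_inj]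
      simp only [← mul_assoc]
      congr 2
      exact (((Commute.neg_one_left (cliffGen R t)).pow_left l.length).eq).symm
  set X := (l.map (cliffGen R)).prod
  have hX : cliffGen R q * X = X * cliffGen R q := by
    rw [hcomm l hp, hl.neg_one_pow, one_mul]
  -- The identity is inserted as pq + qp. Since p does not occur in the even product X, its dual q
  -- commutes with X, and the two supertraces cancel by graded cyclicity.
  have h1 : X = cliffGen R p * cliffGen R q * X + cliffGen R q * (cliffGen R p * X) := by
    rw [← mul_assoc, ← add_mul, cliffGen_anticomm, if_pos rfl, one_mul]
  have h2 := congrArg (superTraceₗ R r) h1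
  rw [map_add, superTraceₗ_apply, superTraceₗ_apply, superTraceₗ_apply] at h2
  rw [h2, superTrace_cliffGen_mul, mul_assoc, mul_assoc, hX, add_neg_cancel]

/-- By multilinearity the factors are expanded into generators one after another; in the induction,
l' is the part already expanded. -/
theorem superTrace_cliff_eq_zero (l : List (Fin r × Fin 2 → R)) (hl : Even l.length)
    (hlt : l.length < 2 * r) : superTrace ((l.map (cliff R)).prod) = 0 := by
  have key : ∀ (l : List (Fin r × Fin 2 → R)) (l' : List (Fin r × Fin 2)),
      Even (l'.length + l.length) → l'.length + l.length < 2 * r →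
      superTraceₗ R r ((l'.map (cliffGen R)).prod * (l.map (cliff R)).prod) = 0 := by
    intro l
    induction l with
    | nil =>
      intro l' h h'
      rw [List.map_nil, List.prod_nil, mul_one]
      exact superTrace_gen_eq_zero l' (by simpa using h) (by simpa using h')
    | cons v l ih =>
      intro l' h h'
      rw [List.map_cons, List.prod_cons, cliff, Fintype.linearCombination_apply,
        Finset.sum_mul, Finset.mul_sum, map_sum]
      refine Finset.sum_eq_zero fun p _ => ?_
      rw [smul_mul_assoc, mul_smul_comm, map_smul, ← mul_assoc]
      have := ih (l' ++ [p]) (by simpa [add_assoc, add_comm 1] using h)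
        (by simpa [add_assoc, add_comm 1] using h')
      rw [List.map_append, List.prod_append] at this
      simp only [List.map_cons, List.map_nil, List.prod_cons, List.prod_nil, mul_one] at this
      rw [cliff] at this
      rw [this, smul_zero]
  simpa [superTraceₗ_apply] using key l [] (by simpa using hl) (by simpa using hlt)

end Clifford

/-! ### Supertraces of products of 2r Clifford multiplications as determinants -/

section KoszulDet

variable {R : Type*} [CommRing R] {r : ℕ}

/-- This exhibits an adjacent transposition as the exchange of two neighbouring entries of a list,
so that the anticommutator can be applied there. -/
theorem ofFn_comp_swap {α : Type*} : ∀ {n : ℕ} (u : Fin (n + 1) → α) (i : Fin n),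
    ∃ l₁ l₂ : List α, l₁.length + l₂.length + 2 = n + 1 ∧
      List.ofFn u = l₁ ++ u i.castSucc :: u i.succ :: l₂ ∧
      List.ofFn (u ∘ Equiv.swap i.castSucc i.succ) = l₁ ++ u i.succ :: u i.castSucc :: l₂
  | 0, _, i => i.elim0
  | n + 1, u, i => by
    induction i using Fin.cases with
    | zero =>
      refine ⟨[], List.ofFn fun j : Fin n => u j.succ.succ, by simp, ?_, ?_⟩
      · rw [List.ofFn_succ, List.ofFn_succ]
        rfl
      · rw [List.ofFn_succ, List.ofFn_succ]
        simp only [Function.comp_apply, List.nil_append, Fin.castSucc_zero, Equiv.swap_apply_left,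
          Equiv.swap_apply_right, List.cons.injEq, true_and]
        congr 1
    | succ i =>
      obtain ⟨l₁, l₂, hl, h1, h2⟩ := ofFn_comp_swap (fun j => u j.succ) i
      refine ⟨u 0 :: l₁, l₂, by simp; omega, ?_, ?_⟩
      · rw [List.ofFn_succ, h1]
        rfl
      · have h3 : (fun j : Fin (n + 1) => (u ∘ Equiv.swap i.succ.castSucc i.succ.succ) j.succ) =
            (fun j => u j.succ) ∘ Equiv.swap i.castSucc i.succ := by
          funext j
          simp only [Function.comp_apply]
          congr 1
          rw [← Fin.succ_castSucc]
          exact (Fin.succ_injective _).swap_apply _ _ _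
        rw [List.ofFn_succ, h3, h2]
        simp only [Function.comp_apply, List.cons_append, List.cons.injEq]
        refine ⟨?_, rfl⟩
        rw [← Fin.succ_castSucc, Equiv.swap_apply_of_ne_of_ne]
        · exact (Fin.succ_ne_zero _).symm
        · exact (Fin.succ_ne_zero _).symm

/-- For an adjacent transposition, the sum of the two products contains a scalar anticommutator and
only 2r - 2 further factors, so its supertrace vanishes. Adjacent transpositions generate the
symmetric group. -/
theorem superTrace_ofFn_perm {m : ℕ} (hm : m = 2 * r) (u : Fin m → Fin r × Fin 2 → R)
    (π : Equiv.Perm (Fin m)) :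
    superTrace ((List.ofFn (u ∘ π)).map (cliff R)).prod =
      ((Equiv.Perm.sign π : ℤ) : R) * superTrace ((List.ofFn u).map (cliff R)).prod := by
  rcases m with _ | n
  · have : π = 1 := Subsingleton.elim _ _
    subst this
    simp
  have hswap : ∀ (u : Fin (n + 1) → Fin r × Fin 2 → R) (i : Fin n),
      superTrace ((List.ofFn (u ∘ Equiv.swap i.castSucc i.succ)).map (cliff R)).prod =
        - superTrace ((List.ofFn u).map (cliff R)).prod := by
    intro u i
    obtain ⟨l₁, l₂, hl, h1, h2⟩ := ofFn_comp_swap u i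
    rw [h1, h2, eq_neg_iff_add_eq_zero]
    simp only [List.map_append, List.map_cons, List.prod_append, List.prod_cons]
    rw [← superTraceₗ_apply, ← superTraceₗ_apply, ← map_add, ← mul_add, ← mul_assoc, ← mul_assoc,
      ← add_mul, cliff_anticomm, smul_mul_assoc, one_mul, mul_smul_comm, map_smul,
      superTraceₗ_apply, ← List.prod_append, ← List.map_append, superTrace_cliff_eq_zero, smul_zero]
    · rw [List.length_append]
      exact ⟨r - 1, by omega⟩
    · rw [List.length_append]
      omega
  have hπ : π ∈ Submonoid.closure
      (Set.range fun i : Fin n => Equiv.swap i.castSucc i.succ) := by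
    rw [Equiv.Perm.mclosure_swap_castSucc_succ]
    trivial
  induction hπ using Submonoid.closure_induction generalizing u with
  | mem x hx =>
    obtain ⟨i, rfl⟩ := hx
    rw [hswap, Equiv.Perm.sign_swap (Fin.castSucc_lt_succ).ne]
    simp
  | one => simp
  | mul x y _ _ hx hy =>
    have : u ∘ ⇑(x * y) = (u ∘ x) ∘ y := rfl
    rw [this, hy, hx, map_mul]
    push_cast
    ring

variable (R r) in
/-- The supertrace of a product of `2 r` Clifford multiplications as an alternating map. -/
def cliffAlternating [IsDomain R] [CharZero R] :
    (Fin r × Fin 2 → R) [⋀^Fin (r * 2)]→ₗ[R] R :=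
  { (superTraceₗ R r).compMultilinearMap
      ((MultilinearMap.mkPiAlgebraFin R (r * 2)
        (Matrix (Finset (Fin r)) (Finset (Fin r)) R)).compLinearMap fun _ => cliff R) with
    map_eq_zero_of_eq' := by
      intro v i j hv hij
      have h1 : ∀ u : Fin (r * 2) → Fin r × Fin 2 → R, (superTraceₗ R r).compMultilinearMap
          ((MultilinearMap.mkPiAlgebraFin R (r * 2)
            (Matrix (Finset (Fin r)) (Finset (Fin r)) R)).compLinearMap fun _ => cliff R) u =
          superTrace ((List.ofFn u).map (cliff R)).prod := by
        intro u
        rw [LinearMap.compMultilinearMap_apply, MultilinearMap.compLinearMap_apply,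
          MultilinearMap.mkPiAlgebraFin_apply, superTraceₗ_apply, List.map_ofFn]
        rfl
      change (superTraceₗ R r).compMultilinearMap
          ((MultilinearMap.mkPiAlgebraFin R (r * 2)
            (Matrix (Finset (Fin r)) (Finset (Fin r)) R)).compLinearMap fun _ => cliff R) v = 0
      rw [h1]
      have h2 := superTrace_ofFn_perm (mul_comm r 2) v (Equiv.swap i j)
      have h3 : v ∘ Equiv.swap i j = v := by
        funext k
        by_cases hki : k = i
        · subst hki; simp [hv]
        · by_cases hkj : k = j
          · subst hkj; simp [hv]
          · simp [Equiv.swap_apply_of_ne_of_ne hki hkj]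
      rw [h3, Equiv.Perm.sign_swap hij] at h2
      simp only [Units.val_neg, Units.val_one, Int.cast_neg, Int.cast_one, neg_mul, one_mul] at h2
      -- Exchanging two equal arguments shows that the value is its own negative; it vanishes
      -- because R is a domain of characteristic zero.
      exact self_eq_neg.mp h2 }

theorem cliffAlternating_apply [IsDomain R] [CharZero R] (v : Fin (r * 2) → Fin r × Fin 2 → R) :
    cliffAlternating R r v = superTrace ((List.ofFn v).map (cliff R)).prod := by
  change (superTraceₗ R r).compMultilinearMap
          ((MultilinearMap.mkPiAlgebraFin R (r * 2)
            (Matrix (Finset (Fin r)) (Finset (Fin r)) R)).compLinearMap fun _ => cliff R) v = _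
  rw [LinearMap.compMultilinearMap_apply, MultilinearMap.compLinearMap_apply,
    MultilinearMap.mkPiAlgebraFin_apply, superTraceₗ_apply, List.map_ofFn]
  rfl

theorem reverse_ofFn {α : Type*} {n : ℕ} (f : Fin n → α) :
    (List.ofFn f).reverse = List.ofFn fun i => f i.rev := by
  refine List.ext_getElem (by simp) fun i h1 h2 => ?_
  rw [List.getElem_reverse, List.getElem_ofFn, List.getElem_ofFn]
  congr 1
  ext
  simp only [List.length_ofFn, Fin.val_rev]
  omega

theorem cliff_single (p : Fin r × Fin 2) : cliff R (Pi.single p 1) = cliffGen R p := by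
  rw [cliff, Fintype.linearCombination_apply_single, one_smul]

/-- The supertrace of the ordered product of all generators. -/
theorem superTrace_gen_univ : superTrace ((List.ofFn fun i : Fin (r * 2) =>
    cliffGen R (finProdFinEquiv.symm i)).reverse).prod = 1 := by
  let h : ℕ → Matrix (Finset (Fin r)) (Finset (Fin r)) R := fun i =>
    if hi : i < r * 2 then cliffGen R (finProdFinEquiv.symm ⟨i, hi⟩) else 1
  have hlist : (List.ofFn fun i : Fin (r * 2) => cliffGen R (finProdFinEquiv.symm i)) =
      (List.range (r * 2)).map h := by
    refine List.ext_getElem (by simp) fun i h1 h2 => ?_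
    simp only [List.length_ofFn] at h1
    simp [h, h1]
  -- Annihilation after creation at t is the projection to the subsets not containing t. The whole
  -- product projects to the empty subset, which has supertrace 1.
  have key : ∀ t ≤ r, ((List.range (t * 2)).map h).reverse.prod =
      Matrix.diagonal fun S : Finset (Fin r) => if ∀ k ∈ S, t ≤ (k : ℕ) then 1 else 0 := by
    intro t
    induction t with
    | zero => intro _; simp
    | succ t ih =>
      intro ht
      rw [show (t + 1) * 2 = t * 2 + 1 + 1 by ring, List.range_succ, List.range_succ]
      simp only [List.map_append, List.reverse_append, List.map_cons, List.map_nil,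
        List.reverse_cons, List.reverse_nil, List.nil_append, List.prod_append, List.prod_cons,
        List.prod_nil, mul_one]
      rw [ih (by omega), ← mul_assoc]
      have e0 : h (t * 2) = cliffGen R (⟨t, by omega⟩, 0) := by
        simp only [h]
        rw [dif_pos (by omega)]
        congr 1
        rw [Equiv.symm_apply_eq]
        ext
        simp [finProdFinEquiv, mul_comm]
      have e1 : h (t * 2 + 1) = cliffGen R (⟨t, by omega⟩, 1) := by
        simp only [h]
        rw [dif_pos (by omega)]
        congr 1
        rw [Equiv.symm_apply_eq]
        ext
        simp [finProdFinEquiv, mul_comm, add_comm]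
      rw [e0, e1, cliffGen_mul_of_fst_eq (by rfl), Matrix.diagonal_mul_diagonal]
      congr 1
      funext S
      simp only [zero_ne_one, iff_false, sub_zero, and_true]
      rw [ite_zero_mul_ite_zero, mul_one]
      congr 1
      rw [eq_iff_iff]
      constructor
      · rintro ⟨h1, h2⟩ k hk
        refine lt_of_le_of_ne (h2 k hk) fun h3 => h1 ?_
        have : k = ⟨t, by omega⟩ := Fin.ext h3.symm
        rwa [← this]
      · intro h1
        exact ⟨fun h2 => absurd (h1 _ h2) (by simp), fun k hk => Nat.le_of_succ_le (h1 k hk)⟩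
  rw [hlist, key r le_rfl, superTrace, Finset.sum_eq_single ∅]
  · simp
  · intro S _ hS
    rw [Matrix.diagonal_apply_eq, if_neg, mul_zero]
    intro h1
    obtain ⟨k, hk⟩ := Finset.nonempty_iff_ne_empty.mpr hS
    exact absurd (h1 k hk) (not_le.mpr k.2)
  · simp

/-- The supertrace of a product of `2 r` Clifford multiplications is a determinant. -/
theorem superTrace_prod_cliff [IsDomain R] [CharZero R] (J : Fin (r * 2) → Fin r × Fin 2 → R) :
    superTrace ((List.ofFn fun i => cliff R (J i)).reverse).prod =
      (Matrix.of fun i j => J i (finProdFinEquiv.symm j)).det := by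
  -- An alternating form in top degree is the determinant times its value on a basis. The arguments
  -- are reversed to match the order ∂ₙδ ⋯ ∂₁δ of the Chern character, and in that order the value
  -- on the basis is 1.
  let F := (cliffAlternating R r).domDomCongr Fin.revPerm
  have hF : ∀ v, F v = superTrace ((List.ofFn fun i => cliff R (v i)).reverse).prod := by
    intro v
    change cliffAlternating R r (fun i => v (Fin.revPerm i)) = _
    rw [cliffAlternating_apply, List.map_ofFn, reverse_ofFn]
    rfl
  let e := (Pi.basisFun R (Fin r × Fin 2)).reindex finProdFinEquiv
  have he : F e = 1 := by
    rw [hF, ← superTrace_gen_univ (R := R) (r := r)]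
    congr 4
    funext i
    rw [← cliff_single]
    congr 1
    simp [e]
  rw [← hF, AlternatingMap.eq_smul_basis_det e F, he, one_smul, Module.Basis.det_apply,
    ← Matrix.det_transpose]
  congr 1

end KoszulDet

/-! ### Koszul differentials as Clifford multiplications -/

section KoszulChern

variable {σ : Type*} [Fintype σ] [LinearOrder σ] {r : ℕ}

theorem koszulDifferential_eq_cliff {R : Type*} [CommRing R] (α β : Fin r → R) :
    koszulDifferential α β = cliff R fun p => if p.2 = 0 then α p.1 else β p.1 := by
  ext T S
  rw [cliff, Fintype.linearCombination_apply, Matrix.sum_apply, Fintype.sum_prod_type]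
  refine Finset.sum_congr rfl fun k _ => ?_
  rw [Fin.sum_univ_two]
  simp only [Matrix.smul_apply, smul_eq_mul, if_true, one_ne_zero, if_false, cliffGen, extSign,
    zero_ne_one, iff_false, iff_true]
  by_cases hk : k ∈ S
  · have h1 : symmDiff S {k} = S.erase k := by
      ext x
      simp only [Finset.mem_erase, Finset.mem_symmDiff, Finset.mem_singleton]
      by_cases hx : x = k
      · subst hx; tauto
      · tauto
    rw [h1]
    by_cases hT : T = S.erase k
    · simp [hk, hT, mul_comm]
    · simp [hk, hT]
  · have h1 : symmDiff S {k} = insert k S := by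
      ext x
      simp only [Finset.mem_insert, Finset.mem_symmDiff, Finset.mem_singleton]
      by_cases hx : x = k
      · subst hx; tauto
      · tauto
    rw [h1]
    by_cases hT : T = insert k S
    · simp [hk, hT, mul_comm]
    · simp [hk, hT]

theorem pderiv_koszulDifferential {σ : Type*} (α β : Fin r → MvPolynomial σ ℂ) (j : σ) :
    (koszulDifferential α β).map (MvPolynomial.pderiv j) =
      koszulDifferential (fun k => MvPolynomial.pderiv j (α k))
        (fun k => MvPolynomial.pderiv j (β k)) := by
  ext1 T S
  rw [Matrix.map_apply, koszulDifferential, koszulDifferential, map_sum]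
  refine Finset.sum_congr rfl fun k _ => ?_
  rcases neg_one_pow_eq_or (MvPolynomial σ ℂ) (S.filter (· < k)).card with h | h
  · rw [h, one_mul, one_mul, map_add]
    split_ifs <;> simp
  · rw [h, neg_one_mul, neg_one_mul, map_neg, map_add]
    split_ifs <;> simp

theorem sort_univ_eq_ofFn {N : ℕ} (e : Fin N ≃o σ) :
    (Finset.univ : Finset σ).sort (· ≤ ·) = List.ofFn e := by
  have h := Finset.map_sort (s := (Finset.univ : Finset (Fin N))) (r := (· ≤ ·)) (r' := (· ≤ ·))
    (f := e.toEquiv.toEmbedding) fun a _ b _ => e.le_iff_le.symm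
  rw [Fin.sort_univ, Finset.map_univ_equiv] at h
  rw [← h, List.ofFn_eq_map]
  rfl

/-- The Chern character of a Koszul matrix factorization as a Jacobian determinant. -/
theorem koszulChern_eq_det (e : Fin (r * 2) ≃o σ) (α β : Fin r → MvPolynomial σ ℂ) :
    koszulChern α β = (Matrix.of fun (i j : Fin (r * 2)) => MvPolynomial.pderiv (e i)
      (if (finProdFinEquiv.symm j).2 = 0 then α (finProdFinEquiv.symm j).1 else
        β (finProdFinEquiv.symm j).1)).det := by
  have h1 := superTrace_prod_cliff (R := MvPolynomial σ ℂ) fun i p =>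
    MvPolynomial.pderiv (e i) (if p.2 = 0 then α p.1 else β p.1)
  rw [← h1, koszulChern, sort_univ_eq_ofFn e, List.map_reverse, List.map_ofFn]
  congr 4
  funext i
  rw [Function.comp_apply, pderiv_koszulDifferential, koszulDifferential_eq_cliff]
  congr 1
  funext p
  split_ifs <;> rfl

end KoszulChern

/-! ## Atomic polynomials as polynomials of a partial injection -/

section Index

/-- The successor of an index: cyclic for a loop, partially defined for a chain. -/
def nextOf (τ : AtomicType) (n : ℕ) : Fin n → Option (Fin n) :=
  match τ with
  | .chain => fun i => if h : (i : ℕ) + 1 < n then some ⟨i + 1, h⟩ else none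
  | .loop => fun i => some (finRotate n i)

/-- The predecessor of an index: cyclic for a loop, partially defined for a chain. -/
def prevOf (τ : AtomicType) (n : ℕ) : Fin n → Option (Fin n) :=
  match τ with
  | .chain => fun i => if 0 < (i : ℕ) then some ⟨i - 1, by omega⟩ else none
  | .loop => fun i => some ((finRotate n).symm i)

theorem finRotate_val {n : ℕ} (i : Fin n) : (finRotate n i : ℕ) = (i + 1) % n := by
  rcases n with _ | n
  · exact i.elim0
  · rw [finRotate_apply, Fin.val_add, Fin.val_one']
    simp

theorem hasOneOrbit_finRotate (n : ℕ) : HasOneOrbit (finRotate n) := by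
  intro T hne hT
  obtain ⟨i, hi⟩ := hne
  have key : ∀ k : ℕ, ∀ j : Fin n, (j : ℕ) = (i + k) % n → j ∈ T := by
    intro k
    induction k with
    | zero =>
      intro j hj
      have : j = i := Fin.ext (by rw [hj, add_zero, Nat.mod_eq_of_lt i.2])
      rwa [this]
    | succ k ih =>
      intro j hj
      have hn : 0 < n := i.pos
      have h1 := hT _ (ih ⟨(i + k) % n, Nat.mod_lt _ hn⟩ rfl)
      have : j = finRotate n ⟨(i + k) % n, Nat.mod_lt _ hn⟩ :=
        Fin.ext (by rw [hj, finRotate_val]; simp [add_assoc])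
      rwa [this]
  refine Finset.eq_univ_iff_forall.mpr fun j => key (j + (n - i)) j ?_
  have h1 : (i : ℕ) + (j + (n - i)) = j + n := by have := i.2; omega
  rw [h1, Nat.add_mod_right, Nat.mod_eq_of_lt j.2]

theorem sign_finRotate_eq {n : ℕ} (hn : 0 < n) :
    ((Equiv.Perm.sign (finRotate n) : ℤ) : ℂ) = -(-1) ^ n := by
  obtain ⟨k, rfl⟩ : ∃ k, n = k + 1 := ⟨n - 1, by omega⟩
  rw [sign_finRotate, pow_succ]
  push_cast
  ring

theorem nextOf_eq_some_iff (τ : AtomicType) {n : ℕ} (i j : Fin n) :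
    nextOf τ n i = some j ↔ prevOf τ n j = some i := by
  cases τ
  · simp only [nextOf, prevOf, Option.dite_none_right_eq_some, Option.ite_none_right_eq_some,
      Option.some.injEq, Fin.ext_iff]
    constructor
    · rintro ⟨h, h'⟩
      omega
    · rintro ⟨h, h'⟩
      have := j.2
      exact ⟨by omega, by omega⟩
  · simp only [nextOf, prevOf, Option.some.injEq]
    rw [Equiv.symm_apply_eq, eq_comm]

theorem partialInj_nextOf (τ : AtomicType) (n : ℕ) : PartialInj (nextOf τ n) := by
  intro i j k hi hj
  rw [nextOf_eq_some_iff] at hi hj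
  exact Option.some.inj (hi.symm.trans hj)

theorem partialInj_prevOf (τ : AtomicType) (n : ℕ) : PartialInj (prevOf τ n) := by
  intro i j k hi hj
  rw [← nextOf_eq_some_iff] at hi hj
  exact Option.some.inj (hi.symm.trans hj)

theorem exponentMatrix_eq (τ : AtomicType) {n : ℕ} (a : Fin n → ℕ) :
    exponentMatrix τ a = atomMat (nextOf τ n) a := by
  ext i j
  cases τ
  · simp only [exponentMatrix, atomMat, nextOf, Option.dite_none_right_eq_some,
      Option.some.injEq, Fin.ext_iff]
    congr 1
    refine if_congr ?_ rfl rfl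
    have := j.2
    exact ⟨fun h => ⟨by omega, by omega⟩, fun ⟨h, h'⟩ => h'.symm⟩
  · simp only [exponentMatrix, atomMat, nextOf, Option.some.injEq, Fin.ext_iff, finRotate_val]
    congr 1
    exact if_congr eq_comm rfl rfl

theorem exponentMatrix_transpose_eq (τ : AtomicType) {n : ℕ} (a : Fin n → ℕ) :
    (exponentMatrix τ a).transpose = atomMat (prevOf τ n) a := by
  rw [exponentMatrix_eq]
  ext i j
  simp only [Matrix.transpose_apply, atomMat, ← nextOf_eq_some_iff]
  congr 1
  by_cases h : i = j
  · subst h; rfl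
  · rw [if_neg h, if_neg (Ne.symm h)]

theorem prod_pow_atomMat {σ M : Type*} [Fintype σ] [DecidableEq σ] [CommMonoid M]
    (s : σ → Option σ) (a : σ → ℕ) (x : σ → M) (i : σ) :
    ∏ j, x j ^ atomMat s a i j = x i ^ a i * (s i).elim 1 x := by
  simp only [atomMat, pow_add, Finset.prod_mul_distrib]
  congr 1
  · rw [Finset.prod_eq_single i]
    · simp
    · intro j _ hj
      simp [Ne.symm hj]
    · simp
  · rcases s i with _ | k
    · simp
    · rw [Finset.prod_eq_single k]
      · simp
      · intro j _ hj
        simp [Ne.symm hj]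
      · simp

theorem polyOf_atomMat {n : ℕ} (s : Fin n → Option (Fin n)) (a : Fin n → ℕ) :
    polyOf (atomMat s a) = atomPoly s a :=
  Finset.sum_congr rfl fun i _ => prod_pow_atomMat s a _ i

theorem dualPoly_eq (τ : AtomicType) {n : ℕ} (a : Fin n → ℕ) :
    dualPoly τ a = atomPoly (prevOf τ n) a := by
  rw [dualPoly, exponentMatrix_transpose_eq, polyOf_atomMat]

theorem mono_eq_cls (τ : AtomicType) {n : ℕ} (a m : Fin n → ℕ) :
    mono τ a m = cls (dualPoly τ a) m := rfl

end Index

/-! ## Integrality -/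

section Lattice

variable {n : ℕ} (E : Matrix (Fin n) (Fin n) ℕ)

/-- The vector `v` is an integral combination of the columns of `E`. -/
def InLattice (v : Fin n → ℤ) : Prop :=
  ∃ c : Fin n → ℤ, ∀ i, ∑ j, (E i j : ℤ) * c j = v i

/-- The rational coordinates of `v` with respect to the columns of `E`. -/
noncomputable def ratCoord (v : Fin n → ℤ) (i : Fin n) : ℚ :=
  ∑ j, (E.map (Nat.cast : ℕ → ℚ))⁻¹ i j * v j

theorem det_exponentMatrix_ne_zero (τ : AtomicType) (a : Fin n → ℕ) (ha : ∀ i, 2 ≤ a i) :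
    ((exponentMatrix τ a).map (Nat.cast : ℕ → ℚ)).det ≠ 0 := by
  intro h
  refine det_atomMatC_ne_zero (nextOf τ n) a ha ?_
  have h1 : atomMatC (nextOf τ n) a = (algebraMap ℚ ℂ).mapMatrix
      ((exponentMatrix τ a).map (Nat.cast : ℕ → ℚ)) := by
    ext i j
    simp [atomMatC, exponentMatrix_eq]
  rw [h1, ← RingHom.map_det, h, map_zero]

variable {E}

theorem sum_mul_ratCoord (hE : (E.map (Nat.cast : ℕ → ℚ)).det ≠ 0) (v : Fin n → ℤ) (i : Fin n) :
    ∑ j, (E i j : ℚ) * ratCoord E v j = v i := by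
  have h1 : (E.map (Nat.cast : ℕ → ℚ)).mulVec ((E.map (Nat.cast : ℕ → ℚ))⁻¹.mulVec
      fun j => (v j : ℚ)) = fun j => (v j : ℚ) := by
    rw [Matrix.mulVec_mulVec, Matrix.mul_nonsing_inv _ (isUnit_iff_ne_zero.mpr hE),
      Matrix.one_mulVec]
  exact congrFun h1 i

theorem ratCoord_of_sum (hE : (E.map (Nat.cast : ℕ → ℚ)).det ≠ 0) {v c : Fin n → ℤ}
    (hc : ∀ i, ∑ j, (E i j : ℤ) * c j = v i) (i : Fin n) : ratCoord E v i = c i := by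
  have h0 : (fun j => (v j : ℚ)) = (E.map (Nat.cast : ℕ → ℚ)).mulVec fun j => (c j : ℚ) := by
    funext k
    rw [← hc k]
    simp [Matrix.mulVec, dotProduct]
  have h1 : (E.map (Nat.cast : ℕ → ℚ))⁻¹.mulVec (fun j => (v j : ℚ)) = fun j => (c j : ℚ) := by
    rw [h0, Matrix.mulVec_mulVec, Matrix.nonsing_inv_mul _ (isUnit_iff_ne_zero.mpr hE),
      Matrix.one_mulVec]
  exact congrFun h1 i

theorem inLattice_of_ratCoord (hE : (E.map (Nat.cast : ℕ → ℚ)).det ≠ 0) {v : Fin n → ℤ}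
    (h : ∀ i, ∃ z : ℤ, ratCoord E v i = z) : InLattice E v := by
  choose c hc using h
  refine ⟨c, fun i => ?_⟩
  have := sum_mul_ratCoord hE v i
  simp only [hc] at this
  exact_mod_cast this

theorem expUnit_eq_one_iff (q : ℚ) :
    expUnit (2 * Real.pi * Complex.I * (q : ℂ)) = 1 ↔ ∃ z : ℤ, q = z := by
  rw [Units.ext_iff, expUnit, Units.val_mk0, Units.val_one, Complex.exp_eq_one_iff]
  refine exists_congr fun z => ?_
  rw [mul_comm (z : ℂ)]
  have : (2 * Real.pi * Complex.I : ℂ) ≠ 0 := Complex.two_pi_I_ne_zero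
  rw [mul_right_inj' this]
  exact ⟨fun h => by exact_mod_cast h, fun h => by exact_mod_cast h⟩

/-- The exponents of ℑ(m) are the coordinates of E⁻¹(m + 1), so fixed variables and inverses become
questions of integrality. -/
theorem groupElt_apply (m : Fin n → ℕ) (i : Fin n) :
    (groupElt E m : Fin n → ℂˣ) i =
      expUnit (2 * Real.pi * Complex.I * (ratCoord E (fun j => (m j : ℤ) + 1) i : ℂ)) := by
  have h1 : (groupElt E m : Fin n → ℂˣ) i = ∏ j, rhoElt E j i ^ (m j + 1) := by
    rw [groupElt, Subgroup.val_finsetProd, Finset.prod_apply]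
    rfl
  rw [h1]
  simp only [rhoElt]
  rw [prod_expUnit_pow]
  congr 1
  rw [ratCoord]
  push_cast
  rw [Finset.mul_sum]
  refine Finset.sum_congr rfl fun j _ => ?_
  simp only [rho]
  ring

theorem ratCoord_add (v v' : Fin n → ℤ) (i : Fin n) :
    ratCoord E (v + v') i = ratCoord E v i + ratCoord E v' i := by
  simp [ratCoord, mul_add, Finset.sum_add_distrib]

theorem expUnit_add (z z' : ℂ) : expUnit (z + z') = expUnit z * expUnit z' := by
  ext
  simp [expUnit, Complex.exp_add]

/-- Two elements `ℑ(m)`, `ℑ(m')` are inverse to each other iff `m + m' + 2` is integral. -/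
theorem groupElt_eq_inv_iff (hE : (E.map (Nat.cast : ℕ → ℚ)).det ≠ 0) (m m' : Fin n → ℕ) :
    groupElt E m' = (groupElt E m)⁻¹ ↔ InLattice E fun i => (m i : ℤ) + m' i + 2 := by
  have h0 : (fun i => (m i : ℤ) + m' i + 2) =
      (fun j => (m' j : ℤ) + 1) + fun j => (m j : ℤ) + 1 := by
    funext i
    simp only [Pi.add_apply]
    ring
  have h1 : groupElt E m' = (groupElt E m)⁻¹ ↔
      ∀ i, ∃ z : ℤ, ratCoord E (fun i => (m i : ℤ) + m' i + 2) i = z := by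
    rw [eq_inv_iff_mul_eq_one, Subtype.ext_iff, funext_iff]
    refine forall_congr' fun i => ?_
    rw [Subgroup.coe_mul, Pi.mul_apply, groupElt_apply, groupElt_apply, ← expUnit_add, ← mul_add,
      h0, ratCoord_add, ← expUnit_eq_one_iff]
    push_cast
    rfl
  rw [h1]
  refine ⟨inLattice_of_ratCoord hE, ?_⟩
  rintro ⟨c, hc⟩ i
  exact ⟨c i, ratCoord_of_sum hE hc i⟩

theorem mem_fixedVars_iff (m : Fin n → ℕ) (i : Fin n) :
    i ∈ fixedVars (groupElt E m : Fin n → ℂˣ) ↔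
      ∃ z : ℤ, ratCoord E (fun j => (m j : ℤ) + 1) i = z := by
  rw [fixedVars, Finset.mem_filter, groupElt_apply, expUnit_eq_one_iff]
  simp

/-- A monomial with non-vanishing residue has an exponent vector in a translate of the lattice. -/
theorem inLattice_of_residue_ne_zero (hE : (E.map (Nat.cast : ℕ → ℚ)).det ≠ 0) (M : Fin n → ℕ)
    (hM : milnorResidue (polyOf E.transpose) (cls _ M) ≠ 0) :
    InLattice E fun i => (M i : ℤ) + 2 := by
  refine inLattice_of_ratCoord hE fun j => ?_
  -- The symmetry ρⱼ of the transposed polynomial has exponents given by row j of E⁻¹. Its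
  -- triviality on the weight M + 2 is integrality of coordinate j of E⁻¹(M + 2).
  have h1 := prod_pow_eq_one_of_residue_ne_zero _ (rhoElt_mem E.transpose j) M hM
  rw [← expUnit_eq_one_iff]
  have h2 : ∏ i, rhoElt E.transpose j i ^ (M i + 2) = 1 := by
    ext
    push_cast
    exact h1
  rw [← h2]
  simp only [rhoElt]
  rw [prod_expUnit_pow]
  congr 1
  rw [ratCoord]
  push_cast
  rw [Finset.mul_sum]
  refine Finset.sum_congr rfl fun i _ => ?_
  have h3 : rho E.transpose j i = (E.map (Nat.cast : ℕ → ℚ))⁻¹ j i := by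
    rw [rho, Matrix.transpose_map, ← Matrix.transpose_nonsing_inv, Matrix.transpose_apply]
  rw [h3]
  ring

end Lattice

/-! ## Combinatorics of loops -/

section LoopCombinatorics

theorem sum_atomMat_mul {σ K : Type*} [Fintype σ] [DecidableEq σ] [CommSemiring K]
    (s : σ → Option σ) (a : σ → ℕ) (c : σ → K) (i : σ) :
    ∑ j, (atomMat s a i j : K) * c j = a i * c i + (s i).elim 0 c := by
  simp only [atomMat, Nat.cast_add, add_mul, Finset.sum_add_distrib]
  congr 1
  · simp
  · rcases s i with _ | k <;> simp

variable {n : ℕ} {a : Fin n → ℕ}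

/-- At an index i where |d| is maximal, aᵢ|dᵢ| ≤ (aᵢ - 1) + |dᵢ|, so |d| ≤ 1 everywhere. A value ±1
then forces the opposite value at the next index, and this spreads over the only orbit. -/
theorem loop_bounded_cases {σ : Type*} [Fintype σ] {a : σ → ℕ} (ha : ∀ i, 2 ≤ a i)
    {p : Equiv.Perm σ} (hp : HasOneOrbit p) (d : σ → ℤ)
    (hd : ∀ i, |a i * d i + d (p i)| ≤ a i - 1) :
    (∀ i, d i = 0) ∨ ((∀ i, d i = 1 ∨ d i = -1) ∧ ∀ i, d (p i) = -d i) := by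
  rcases isEmpty_or_nonempty σ with hσ | hσ
  · left
    exact fun i => hσ.elim i
  obtain ⟨i₀, hi₀⟩ := Finite.exists_max fun i => |d i|
  have hmax : |d i₀| ≤ 1 := by
    by_contra! h
    have h1 := hd i₀
    have h2 := hi₀ (p i₀)
    have h3 : (a i₀ : ℤ) * |d i₀| ≤ (a i₀ - 1) + |d i₀| := by
      calc (a i₀ : ℤ) * |d i₀| = |(a i₀ * d i₀ + d (p i₀)) - d (p i₀)| := by
            rw [add_sub_cancel_right, abs_mul, Nat.abs_cast]
        _ ≤ |a i₀ * d i₀ + d (p i₀)| + |d (p i₀)| := abs_sub _ _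
        _ ≤ _ := add_le_add h1 h2
    have h4 : (2 : ℤ) ≤ a i₀ := by exact_mod_cast ha i₀
    nlinarith
  have hle : ∀ i, |d i| ≤ 1 := fun i => (hi₀ i).trans hmax
  have hcases : ∀ i, d i = 0 ∨ d i = 1 ∨ d i = -1 := by
    intro i
    have := abs_le.mp (hle i)
    omega
  have hstep : ∀ i, d i ≠ 0 → d (p i) = -d i := by
    intro i hi
    have h1 := abs_le.mp (hd i)
    have h2 := abs_le.mp (hle (p i))
    rcases (hcases i).resolve_left hi with h | h
    · rw [h] at h1 ⊢
      omega
    · rw [h] at h1 ⊢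
      omega
  by_cases h0 : ∀ i, d i = 0
  · exact Or.inl h0
  · right
    push Not at h0
    obtain ⟨i, hi⟩ := h0
    classical
    have hT := hp (Finset.univ.filter fun i => d i ≠ 0) ⟨i, by simpa using hi⟩ (by
      intro j hj
      simp only [Finset.mem_filter, Finset.mem_univ, true_and] at hj ⊢
      rw [hstep j hj]
      simpa using hj)
    have hne : ∀ i, d i ≠ 0 := by
      intro j
      have : j ∈ Finset.univ.filter fun i => d i ≠ 0 := by rw [hT]; exact Finset.mem_univ j
      simpa using this
    exact ⟨fun i => (hcases i).resolve_left (hne i), fun i => hstep i (hne i)⟩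

/-- Signs that alternate around the loop return to their initial value only if n is even. -/
theorem alternating_eq (hn : 0 < n) (d : Fin n → ℤ) (hd : ∀ i, d (finRotate n i) = -d i)
    (hne : ∀ i, d i ≠ 0) : Even n ∧ ∀ i : Fin n, d i = (-1) ^ (i : ℕ) * d ⟨0, hn⟩ := by
  have key : ∀ k (hk : k < n), d ⟨k, hk⟩ = (-1) ^ k * d ⟨0, hn⟩ := by
    intro k
    induction k with
    | zero => intro hk; simp
    | succ k ih =>
      intro hk
      have h1 : (⟨k + 1, hk⟩ : Fin n) = finRotate n ⟨k, by omega⟩ :=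
        Fin.ext (by rw [finRotate_val]; exact (Nat.mod_eq_of_lt hk).symm)
      rw [h1, hd, ih, pow_succ]
      ring
  refine ⟨?_, fun i => key i i.2⟩
  have h1 : (⟨0, hn⟩ : Fin n) = finRotate n ⟨n - 1, by omega⟩ := by
    refine Fin.ext ?_
    rw [finRotate_val]
    simp [Nat.sub_add_cancel hn]
  have h2 := hd ⟨n - 1, by omega⟩
  rw [← h1, key (n - 1)] at h2
  by_contra hodd
  rw [Nat.not_even_iff_odd] at hodd
  have h3 : Even (n - 1) := by
    obtain ⟨k, hk⟩ := hodd
    exact ⟨k, by omega⟩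
  rw [h3.neg_one_pow, one_mul] at h2
  have := hne ⟨0, hn⟩
  omega

theorem eq_oddVec_or_evenVec (hn : 0 < n) (m : Fin n → ℕ) (d : Fin n → ℤ)
    (hd : ∀ i, d i = 1 ∨ d i = -1) (halt : ∀ i, d (finRotate n i) = -d i)
    (h1 : ∀ i, d i = 1 → m i = a i - 1) (h0 : ∀ i, d i = -1 → m i = 0) :
    Even n ∧ (m = oddVec a ∧ d ⟨0, hn⟩ = 1 ∨ m = evenVec a ∧ d ⟨0, hn⟩ = -1) := by
  obtain ⟨hev, heq⟩ := alternating_eq hn d halt fun i => by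
    rcases hd i with h | h <;> rw [h] <;> decide
  refine ⟨hev, ?_⟩
  rcases hd ⟨0, hn⟩ with h | h
  · left
    refine ⟨funext fun i => ?_, h⟩
    have hi := heq i
    rw [h, mul_one] at hi
    rw [oddVec]
    by_cases hp : Even (i : ℕ)
    · rw [if_pos hp.add_one, h1 i (by rw [hi, hp.neg_one_pow])]
    · rw [Nat.not_even_iff_odd] at hp
      rw [if_neg (by simpa using hp.add_one), h0 i (by rw [hi, hp.neg_one_pow])]
  · right
    refine ⟨funext fun i => ?_, h⟩
    have hi := heq i
    rw [h] at hi
    rw [evenVec]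
    by_cases hp : Even (i : ℕ)
    · rw [if_neg (by simpa using hp.add_one), h0 i (by rw [hi, hp.neg_one_pow, one_mul])]
    · rw [Nat.not_even_iff_odd] at hp
      rw [if_pos hp.add_one, h1 i (by rw [hi, hp.neg_one_pow]; rfl)]

theorem sum_exponentMatrix_loop {K : Type*} [CommSemiring K] (c : Fin n → K) (i : Fin n) :
    ∑ j, (exponentMatrix .loop a i j : K) * c j = a i * c i + c (finRotate n i) := by
  rw [exponentMatrix_eq, sum_atomMat_mul]
  rfl

/-- Pairs of standard vectors of a loop whose sum is in the translated lattice. -/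
theorem loop_pair_cases (hn : 0 < n) (ha : ∀ i, 2 ≤ a i) {m m' : Fin n → ℕ}
    (hm : ∀ i, m i < a i) (hm' : ∀ i, m' i < a i)
    (h : InLattice (exponentMatrix .loop a) fun i => (m i : ℤ) + m' i + 2) :
    (∀ i, m i + m' i = a i - 1) ∨
      Even n ∧ (m = oddVec a ∧ m' = oddVec a ∨ m = evenVec a ∧ m' = evenVec a) := by
  obtain ⟨c, hc⟩ := h
  -- Subtracting the solution c = 1, whose right-hand side is aᵢ + 1, centres the interval of
  -- possible right-hand sides at 0.
  have hd : ∀ i, (a i : ℤ) * (c i - 1) + (c (finRotate n i) - 1) = m i + m' i + 1 - a i := by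
    intro i
    have := hc i
    rw [sum_exponentMatrix_loop] at this
    linear_combination this
  rcases loop_bounded_cases ha (hasOneOrbit_finRotate n) (fun i => c i - 1) (fun i => by
    simp only [hd i]
    have h1 := hm i
    have h2 := hm' i
    rw [abs_le]
    constructor <;> omega) with h0 | ⟨hpm, halt⟩
  · left
    intro i
    have := hd i
    rw [h0, h0] at this
    have := hm i
    omega
  · right
    have e1 : ∀ i, c i - 1 = 1 → m i = a i - 1 ∧ m' i = a i - 1 := by
      intro i hi
      have h1 := hd i
      have h2 := halt i
      rw [h2, hi] at h1
      have := hm i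
      have := hm' i
      omega
    have e0 : ∀ i, c i - 1 = -1 → m i = 0 ∧ m' i = 0 := by
      intro i hi
      have h1 := hd i
      have h2 := halt i
      rw [h2, hi] at h1
      have := hm i
      have := hm' i
      omega
    obtain ⟨hev, h1⟩ := eq_oddVec_or_evenVec hn m (fun i => c i - 1) hpm halt
      (fun i hi => (e1 i hi).1) (fun i hi => (e0 i hi).1)
    obtain ⟨-, h2⟩ := eq_oddVec_or_evenVec hn m' (fun i => c i - 1) hpm halt
      (fun i hi => (e1 i hi).2) (fun i hi => (e0 i hi).2)
    refine ⟨hev, ?_⟩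
    rcases h1 with ⟨h1, h3⟩ | ⟨h1, h3⟩ <;> rcases h2 with ⟨h2, h4⟩ | ⟨h2, h4⟩
    · exact Or.inl ⟨h1, h2⟩
    · rw [h3] at h4; norm_num at h4
    · rw [h3] at h4; norm_num at h4
    · exact Or.inr ⟨h1, h2⟩

/-- Put b = E⁻¹(m + 1). Centred at 1/2, the equations bound |bᵢ - 1/2| by 1/2 as in
`loop_bounded_cases`, so 0 ≤ bᵢ ≤ 1. One integral coordinate is 0 or 1; it forces mᵢ to be 0 or aᵢ -
1 and the next coordinate to be the other value, and so on around the loop. -/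
theorem loop_fixedVars_cases (hn : 0 < n) (ha : ∀ i, 2 ≤ a i) {m : Fin n → ℕ}
    (hm : ∀ i, m i < a i) :
    fixedVars (groupElt (exponentMatrix .loop a) m : Fin n → ℂˣ) = ∅ ∨
      Even n ∧ (m = oddVec a ∨ m = evenVec a) := by
  classical
  rcases Finset.eq_empty_or_nonempty
    (fixedVars (groupElt (exponentMatrix .loop a) m : Fin n → ℂˣ)) with h | ⟨i, hi⟩
  · exact Or.inl h
  right
  rw [mem_fixedVars_iff] at hi
  set b := ratCoord (exponentMatrix .loop a) fun j => (m j : ℤ) + 1 with hb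
  have heq : ∀ i, (a i : ℚ) * b i + b (finRotate n i) = m i + 1 := by
    intro i
    have := sum_mul_ratCoord (det_exponentMatrix_ne_zero .loop a ha) (fun j => (m j : ℤ) + 1) i
    rw [sum_exponentMatrix_loop] at this
    rw [this]
    push_cast
    ring
  have hne : Nonempty (Fin n) := ⟨i⟩
  obtain ⟨i₀, hi₀⟩ := Finite.exists_max fun i => |b i - 1 / 2|
  have hmax : |b i₀ - 1 / 2| ≤ 1 / 2 := by
    have h1 : (a i₀ : ℚ) * (b i₀ - 1 / 2) =
        (m i₀ + 1 - (a i₀ + 1) / 2) - (b (finRotate n i₀) - 1 / 2) := by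
      linear_combination heq i₀
    have h2 : |(m i₀ : ℚ) + 1 - (a i₀ + 1) / 2| ≤ (a i₀ - 1) / 2 := by
      have h3 : (m i₀ : ℚ) + 1 ≤ a i₀ := by exact_mod_cast hm i₀
      have h4 : (0 : ℚ) ≤ m i₀ := Nat.cast_nonneg _
      rw [abs_le]
      constructor <;> linarith
    have h3 : (a i₀ : ℚ) * |b i₀ - 1 / 2| ≤ (a i₀ - 1) / 2 + |b i₀ - 1 / 2| := by
      calc (a i₀ : ℚ) * |b i₀ - 1 / 2| = |(a i₀ : ℚ) * (b i₀ - 1 / 2)| := by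
            rw [abs_mul, Nat.abs_cast]
        _ ≤ |(m i₀ : ℚ) + 1 - (a i₀ + 1) / 2| + |b (finRotate n i₀) - 1 / 2| := by
            rw [h1]
            exact abs_sub _ _
        _ ≤ _ := add_le_add h2 (hi₀ _)
    have h4 : (2 : ℚ) ≤ a i₀ := by exact_mod_cast ha i₀
    nlinarith
  have hb01 : ∀ i, 0 ≤ b i ∧ b i ≤ 1 := by
    intro i
    have := abs_le.mp ((hi₀ i).trans hmax)
    constructor <;> linarith
  have hzero : ∀ i, b i = 0 → m i = 0 ∧ b (finRotate n i) = 1 := by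
    intro i h
    have h1 := heq i
    rw [h, mul_zero, zero_add] at h1
    have h2 := (hb01 (finRotate n i)).2
    rw [h1] at h2
    have h3 : (m i : ℚ) = 0 := le_antisymm (by linarith) (Nat.cast_nonneg _)
    exact ⟨by exact_mod_cast h3, by rw [h1, h3, zero_add]⟩
  have hone : ∀ i, b i = 1 → m i = a i - 1 ∧ b (finRotate n i) = 0 := by
    intro i h
    have h1 := heq i
    rw [h, mul_one] at h1
    have h2 := (hb01 (finRotate n i)).1
    have h3 : (m i : ℚ) + 1 ≤ a i := by exact_mod_cast hm i
    have h4 : (a i : ℚ) = m i + 1 := by linarith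
    have h5 : a i = m i + 1 := by exact_mod_cast h4
    exact ⟨by omega, by linarith⟩
  have hT := hasOneOrbit_finRotate n (Finset.univ.filter fun i => b i = 0 ∨ b i = 1) ⟨i, by
    obtain ⟨z, hz⟩ := hi
    have h1 := hb01 i
    rw [hz] at h1
    have h2 : 0 ≤ z := by exact_mod_cast h1.1
    have h3 : z ≤ 1 := by exact_mod_cast h1.2
    have h4 : z = 0 ∨ z = 1 := by omega
    simp only [Finset.mem_filter, Finset.mem_univ, true_and]
    rcases h4 with h4 | h4 <;> simp [hz, h4]⟩ (by
    intro j hj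
    simp only [Finset.mem_filter, Finset.mem_univ, true_and] at hj ⊢
    rcases hj with hj | hj
    · exact Or.inr (hzero j hj).2
    · exact Or.inl (hone j hj).2)
  have hall : ∀ i, b i = 0 ∨ b i = 1 := by
    intro j
    have : j ∈ Finset.univ.filter fun i => b i = 0 ∨ b i = 1 := by rw [hT]; exact Finset.mem_univ j
    simpa using this
  obtain ⟨hev, h⟩ := eq_oddVec_or_evenVec hn m (fun i => if b i = 1 then 1 else -1)
    (fun i => by split_ifs <;> simp)
    (fun i => by
      rcases hall i with h | h
      · rw [h, (hzero i h).2]; norm_num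
      · rw [h, (hone i h).2]; norm_num)
    (fun i hi => (hone i (by by_contra h; simp [h] at hi)).1)
    (fun i hi => (hzero i ((hall i).resolve_right (fun h => by norm_num [h] at hi))).1)
  exact ⟨hev, h.imp And.left And.left⟩

theorem even_finRotate_iff (hev : Even n) (i : Fin n) :
    Even (finRotate n i : ℕ) ↔ ¬ Even (i : ℕ) := by
  rw [finRotate_val]
  have hi := i.2
  by_cases h : (i : ℕ) + 1 < n
  · rw [Nat.mod_eq_of_lt h, Nat.even_add_one]
  · have h1 : (i : ℕ) + 1 = n := by omega
    rw [h1, Nat.mod_self]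
    have h2 : ¬ Even (i : ℕ) := by
      rw [← h1, Nat.even_add_one] at hev
      exact hev
    simp [h2]

theorem fixedVars_oddVec (hev : Even n) (ha : ∀ i, 2 ≤ a i) :
    fixedVars (groupElt (exponentMatrix .loop a) (oddVec a) : Fin n → ℂˣ) = Finset.univ := by
  refine Finset.eq_univ_iff_forall.mpr fun i => ?_
  rw [mem_fixedVars_iff]
  -- The indicator of the zero-based even positions, which are the odd positions of the statement,
  -- solves E c = m^odd + 1.
  refine ⟨_, ratCoord_of_sum (det_exponentMatrix_ne_zero .loop a ha)
    (c := fun i => if Even (i : ℕ) then 1 else 0) (fun i => ?_) i⟩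
  rw [sum_exponentMatrix_loop, oddVec]
  have := ha i
  simp only [even_finRotate_iff hev]
  by_cases h : Even (i : ℕ)
  · rw [if_pos h, if_neg (by simpa using h), if_pos h.add_one]
    omega
  · have h' : Odd (i : ℕ) := Nat.not_even_iff_odd.mp h
    rw [if_neg h, if_pos h, if_neg (by simpa using h'.add_one)]
    omega

theorem fixedVars_evenVec (hev : Even n) (ha : ∀ i, 2 ≤ a i) :
    fixedVars (groupElt (exponentMatrix .loop a) (evenVec a) : Fin n → ℂˣ) = Finset.univ := by
  refine Finset.eq_univ_iff_forall.mpr fun i => ?_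
  rw [mem_fixedVars_iff]
  refine ⟨_, ratCoord_of_sum (det_exponentMatrix_ne_zero .loop a ha)
    (c := fun i => if Even (i : ℕ) then 0 else 1) (fun i => ?_) i⟩
  rw [sum_exponentMatrix_loop, evenVec]
  have := ha i
  simp only [even_finRotate_iff hev]
  by_cases h : Even (i : ℕ)
  · rw [if_pos h, if_neg (by simpa using h), if_neg (by simpa using h.add_one)]
    omega
  · have h' : Odd (i : ℕ) := Nat.not_even_iff_odd.mp h
    rw [if_neg h, if_pos h, if_pos h'.add_one]
    omega

/-- The square of the monomial `∏_{i ∈ T} xᵢ ^ (aᵢ - 1)` for a set `T` that alternates along the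
loop. -/
theorem cls_loop_square {σ : Type*} [Fintype σ] [DecidableEq σ] {a : σ → ℕ} (ha : ∀ i, 2 ≤ a i)
    (p : Equiv.Perm σ) {w : MvPolynomial σ ℂ} (hw : w = atomPoly (fun i => some (p i)) a)
    (T : Finset σ) (hT : ∀ i, p i ∈ T ↔ i ∉ T) :
    cls w (fun i => if i ∈ T then (a i - 1) + (a i - 1) else 0) =
      ((-1) ^ T.card * ∏ i ∈ Tᶜ, (a i : ℂ)) • cls w (fun i => a i - 1) := by
  have hsum : ∀ (q : Equiv.Perm σ) (f : σ → ℕ) (j : σ),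
      (∑ i ∈ T, (Pi.single (q i) (f (q i)) : σ → ℕ)) j = if q.symm j ∈ T then f j else 0 := by
    intro q f j
    rw [Finset.sum_apply]
    simp only [Pi.single_apply]
    have h1 : ∀ i, (if j = q i then f (q i) else 0) = if q.symm j = i then f j else 0 := by
      intro i
      by_cases h : j = q i
      · rw [if_pos h, if_pos (by rw [h]; simp), h]
      · rw [if_neg h, if_neg fun h' => h (by rw [← h']; simp)]
    rw [Finset.sum_congr rfl fun i _ => h1 i, Finset.sum_ite_eq]
  have hT' : ∀ j, p.symm j ∈ T ↔ j ∉ T := by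
    intro j
    have := hT (p.symm j)
    rw [Equiv.apply_symm_apply] at this
    tauto
  -- For i ∈ T, xᵢ^(2(aᵢ-1)) is split as xᵢ^(aᵢ-2) xᵢ^aᵢ and the second factor is rewritten. The
  -- relations supply xⱼ^(aⱼ-1) for j ∉ T and one more xⱼ for j ∈ T, which completes the socle
  -- monomial.
  have key := cls_add_sum_single hw (partialInj_some p) T p (fun i _ => rfl)
    (fun i => if i ∈ T then a i - 2 else 0)
  have e1 : (fun i => if i ∈ T then a i - 2 else 0) + ∑ i ∈ T, (Pi.single i (a i) : σ → ℕ) =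
      fun i => if i ∈ T then (a i - 1) + (a i - 1) else 0 := by
    funext j
    have := hsum 1 a j
    simp only [Equiv.Perm.coe_one, id_eq] at this
    rw [Pi.add_apply, this]
    change _ + (if j ∈ T then a j else 0) = _
    have := ha j
    split_ifs <;> omega
  have e2 : (fun i => if i ∈ T then a i - 2 else 0) +
      ∑ i ∈ T, ((Pi.single (p i) (a (p i) - 1) : σ → ℕ) + optExp (some (p (p i)))) =
      fun i => a i - 1 := by
    funext j
    have h1 := hsum p (fun i => a i - 1) j
    have h2 := hsum (p * p) (fun _ => 1) j
    have h3 : (p * p).symm j = p.symm (p.symm j) := rfl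
    simp only [optExp, Option.elim_some]
    simp only [Equiv.Perm.coe_mul, Function.comp_apply] at h2
    rw [Pi.add_apply, Finset.sum_add_distrib, Pi.add_apply, h1, h2, h3]
    simp only [hT']
    have := ha j
    by_cases hj : j ∈ T
    · simp [hj]
      omega
    · simp [hj]
  rw [e1, e2] at key
  rw [key]
  congr 1
  rw [Finset.prod_neg]
  congr 1
  refine Finset.prod_bij (fun i _ => p i) ?_ ?_ ?_ ?_
  · intro i hi
    rw [Finset.mem_compl, hT]
    simpa using hi
  · intro i _ j _ h
    exact p.injective h
  · intro j hj
    exact ⟨p.symm j, (hT' j).mpr (Finset.mem_compl.mp hj), by simp⟩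
  · intro i _
    rfl

end LoopCombinatorics

/-! ## The residue pairing of the dual polynomial -/

section ResiduePairing

theorem linearIndependent_of_separating {ι V : Type*} [AddCommGroup V] [Module ℂ V] (v : ι → V)
    (h : ∀ i, ∃ φ : V →ₗ[ℂ] ℂ, φ (v i) ≠ 0 ∧ ∀ j, j ≠ i → φ (v j) = 0) :
    LinearIndependent ℂ v := by
  rw [linearIndependent_iff']
  intro T g hg i hi
  obtain ⟨φ, hφ, hφ'⟩ := h i
  have h1 := congrArg φ hg
  rw [map_sum, map_zero, Finset.sum_eq_single_of_mem i hi] at h1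
  · rw [map_smul, smul_eq_mul] at h1
    exact (mul_eq_zero.mp h1).resolve_right hφ
  · intro j _ hj
    rw [map_smul, hφ' j hj, smul_zero]

variable {n : ℕ} (τ : AtomicType) (a : Fin n → ℕ)

/-- The residue of a monomial. -/
noncomputable def monoRes (M : Fin n → ℕ) : ℂ := milnorResidue (dualPoly τ a) (cls _ M)

theorem normalizedResidue_mono (m m' : Fin n → ℕ) :
    normalizedResidue τ a (mono τ a m) (mono τ a m') =
      monoRes τ a (m + m') / monoRes τ a (socleVec τ a) := by
  rw [normalizedResidue, mono_eq_cls, mono_eq_cls, mono_eq_cls, ← cls_add]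
  rfl

/-- The functional `f ↦ Res (f x^m)`. -/
noncomputable def resFunctional (m : Fin n → ℕ) : MilnorRing (dualPoly τ a) →ₗ[ℂ] ℂ :=
  milnorResidue (dualPoly τ a) ∘ₗ LinearMap.mulRight ℂ (mono τ a m)

theorem resFunctional_mono (m m' : Fin n → ℕ) :
    resFunctional τ a m' (mono τ a m) = monoRes τ a (m + m') := by
  rw [resFunctional, LinearMap.comp_apply, LinearMap.mulRight_apply, mono_eq_cls, mono_eq_cls,
    ← cls_add]
  rfl

variable {a}

theorem inLattice_of_monoRes_ne_zero (ha : ∀ i, 2 ≤ a i) {m m' : Fin n → ℕ}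
    (h : monoRes τ a (m + m') ≠ 0) :
    InLattice (exponentMatrix τ a) fun i => (m i : ℤ) + m' i + 2 := by
  have := inLattice_of_residue_ne_zero (det_exponentMatrix_ne_zero τ a ha) (m + m') h
  simpa using this

theorem milnorResidue_congr {σ : Type*} [Fintype σ] [DecidableEq σ] {w w' : MvPolynomial σ ℂ}
    (h : w = w') (M : σ → ℕ) : milnorResidue w (cls w M) = milnorResidue w' (cls w' M) := by
  subst h
  rfl

/-- The residue is the inverse of the determinant of the exponent matrix. -/
theorem monoRes_socle_loop_ne_zero (hn : 0 < n) (ha : ∀ i, 2 ≤ a i) :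
    monoRes .loop a (socleVec .loop a) ≠ 0 := by
  have : Nonempty (Fin n) := ⟨⟨0, hn⟩⟩
  have h1 := residue_socle_loop (hasOneOrbit_finRotate n).symm (by
    rw [Equiv.Perm.sign_symm, Fintype.card_fin]
    exact sign_finRotate_eq hn) ha
  rw [monoRes, milnorResidue_congr (dualPoly_eq .loop a)]
  have h2 := det_atomMatC_ne_zero (fun i => some ((finRotate n).symm i)) a ha
  rw [det_atomMatC_loop (hasOneOrbit_finRotate n).symm, Equiv.Perm.sign_symm,
    sign_finRotate_eq hn] at h2
  change milnorResidue (atomPoly (fun i => some ((finRotate n).symm i)) a)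
      (Ideal.Quotient.mk _ (xpow fun i => a i - 1)) ≠ 0
  rw [h1, Fintype.card_fin, sub_eq_add_neg]
  exact inv_ne_zero h2

theorem card_even_filter (hev : Even n) :
    (Finset.univ.filter fun i : Fin n => Even (i : ℕ)).card = n / 2 ∧
    (Finset.univ.filter fun i : Fin n => ¬ Even (i : ℕ)).card = n / 2 := by
  have h1 : (Finset.univ.filter fun i : Fin n => Even (i : ℕ)).card =
      (Finset.univ.filter fun i : Fin n => ¬ Even (i : ℕ)).card := by
    refine Finset.card_bij (fun i _ => finRotate n i) ?_ ?_ ?_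
    · intro i hi
      simp only [Finset.mem_filter, Finset.mem_univ, true_and] at hi ⊢
      rw [even_finRotate_iff hev]
      simpa using hi
    · intro i _ j _ h
      exact (finRotate n).injective h
    · intro j hj
      refine ⟨(finRotate n).symm j, ?_, by rw [Equiv.apply_symm_apply]⟩
      simp only [Finset.mem_filter, Finset.mem_univ, true_and] at hj ⊢
      have := even_finRotate_iff hev ((finRotate n).symm j)
      rw [Equiv.apply_symm_apply] at this
      tauto
  have h2 := Finset.card_filter_add_card_filter_not (s := (Finset.univ : Finset (Fin n)))
    (fun i => Even (i : ℕ))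
  rw [Finset.card_univ, Fintype.card_fin] at h2
  omega

theorem oddVec_add_self : oddVec a + oddVec a =
    fun i => if i ∈ Finset.univ.filter (fun i : Fin n => Even (i : ℕ))
      then (a i - 1) + (a i - 1) else 0 := by
  funext i
  simp only [Pi.add_apply, oddVec, Finset.mem_filter, Finset.mem_univ, true_and]
  by_cases h : Even (i : ℕ)
  · rw [if_pos h, if_pos h.add_one]
  · rw [if_neg h, if_neg (by simpa using (Nat.not_even_iff_odd.mp h).add_one)]

theorem evenVec_add_self : evenVec a + evenVec a =
    fun i => if i ∈ Finset.univ.filter (fun i : Fin n => ¬ Even (i : ℕ))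
      then (a i - 1) + (a i - 1) else 0 := by
  funext i
  simp only [Pi.add_apply, evenVec, Finset.mem_filter, Finset.mem_univ, true_and]
  by_cases h : Even (i : ℕ)
  · rw [if_neg (not_not.mpr h), if_neg (by simpa using h.add_one)]
  · rw [if_pos h, if_pos (Nat.not_even_iff_odd.mp h).add_one]

theorem even_finRotate_symm_iff (hev : Even n) (i : Fin n) :
    Even ((finRotate n).symm i : ℕ) ↔ ¬ Even (i : ℕ) := by
  have := even_finRotate_iff hev ((finRotate n).symm i)
  rw [Equiv.apply_symm_apply] at this
  tauto

/-- The support of m^odd consists of even values in `Fin n` and alternates along the loop; the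
coefficient comes from the complementary positions. -/
theorem monoRes_oddVec (hev : Even n) (ha : ∀ i, 2 ≤ a i) :
    monoRes .loop a (oddVec a + oddVec a) = ((-1) ^ (n / 2) *
      ∏ i ∈ Finset.univ.filter (fun i : Fin n => ¬ Even (i : ℕ)), (a i : ℂ)) *
        monoRes .loop a (socleVec .loop a) := by
  have h1 := cls_loop_square ha (finRotate n).symm (dualPoly_eq .loop a)
    (Finset.univ.filter fun i : Fin n => Even (i : ℕ)) (fun i => by
      simp only [Finset.mem_filter, Finset.mem_univ, true_and]
      exact even_finRotate_symm_iff hev i)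
  rw [monoRes, oddVec_add_self, h1, map_smul, smul_eq_mul, (card_even_filter hev).1,
    Finset.compl_filter]
  rfl

theorem monoRes_evenVec (hev : Even n) (ha : ∀ i, 2 ≤ a i) :
    monoRes .loop a (evenVec a + evenVec a) = ((-1) ^ (n / 2) *
      ∏ i ∈ Finset.univ.filter (fun i : Fin n => Even (i : ℕ)), (a i : ℂ)) *
        monoRes .loop a (socleVec .loop a) := by
  have h1 := cls_loop_square ha (finRotate n).symm (dualPoly_eq .loop a)
    (Finset.univ.filter fun i : Fin n => ¬ Even (i : ℕ)) (fun i => by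
      simp only [Finset.mem_filter, Finset.mem_univ, true_and]
      rw [even_finRotate_symm_iff hev i])
  rw [monoRes, evenVec_add_self, h1, map_smul, smul_eq_mul, (card_even_filter hev).2,
    Finset.compl_filter]
  simp only [not_not]
  rfl

theorem oddVec_add_evenVec : oddVec a + evenVec a = socleVec .loop a := by
  funext i
  simp only [Pi.add_apply, oddVec, evenVec, socleVec]
  by_cases h : Even ((i : ℕ) + 1)
  · rw [if_pos h, if_neg (by simpa using h), zero_add]
  · rw [if_neg h, if_pos (Nat.not_even_iff_odd.mp h), add_zero]

theorem oddVec_lt (ha : ∀ i, 2 ≤ a i) (i : Fin n) : oddVec a i < a i := by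
  have := ha i
  unfold oddVec
  split_ifs <;> omega

theorem evenVec_lt (ha : ∀ i, 2 ≤ a i) (i : Fin n) : evenVec a i < a i := by
  have := ha i
  unfold evenVec
  split_ifs <;> omega

theorem oddVec_ne_evenVec (hn : 0 < n) (ha : ∀ i, 2 ≤ a i) : oddVec a ≠ evenVec a := by
  intro h
  have := congrFun h ⟨0, hn⟩
  have h2 := ha ⟨0, hn⟩
  simp [oddVec, evenVec] at this
  omega

theorem prod_even_mul_prod_odd : (∏ i ∈ Finset.univ.filter (fun i : Fin n => Even (i : ℕ)),
    (a i : ℂ)) * ∏ i ∈ Finset.univ.filter (fun i : Fin n => ¬ Even (i : ℕ)), (a i : ℂ) =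
      ∏ i, (a i : ℂ) :=
  Finset.prod_filter_mul_prod_filter_not _ _ _

theorem prod_ne_one (hn : 0 < n) (ha : ∀ i, 2 ≤ a i) : ∏ i, (a i : ℂ) ≠ 1 := by
  intro h
  have h1 : ∏ i, a i = 1 := by exact_mod_cast h
  have h2 := Finset.prod_eq_one_iff.mp h1 ⟨0, hn⟩ (Finset.mem_univ _)
  have := ha ⟨0, hn⟩
  omega

/-- Multiplication by the complementary monomial followed by the residue singles out m, except that
m^odd and m^even pair with themselves as well as with each other. Up to the socle residue, their
Gram matrix has diagonal entries ± the products of alternate exponents and off-diagonal entries 1.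
Its determinant ∏ aᵢ - 1 is nonzero. -/
theorem loop_separating (hn : 0 < n) (ha : ∀ i, 2 ≤ a i) {m : Fin n → ℕ} (hm : ∀ i, m i < a i) :
    ∃ φ : MilnorRing (dualPoly .loop a) →ₗ[ℂ] ℂ, φ (mono .loop a m) ≠ 0 ∧
      ∀ m' : Fin n → ℕ, (∀ i, m' i < a i) → m' ≠ m → φ (mono .loop a m') = 0 := by
  have hR := monoRes_socle_loop_ne_zero hn ha
  by_cases hb : Even n ∧ (m = oddVec a ∨ m = evenVec a)
  · obtain ⟨hev, hb⟩ := hb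
    have hz : ∀ m', (∀ i, m' i < a i) → m' ≠ oddVec a → m' ≠ evenVec a →
        ∀ m'', m'' = oddVec a ∨ m'' = evenVec a → monoRes .loop a (m' + m'') = 0 := by
      intro m' hm' h1 h2 m'' h3
      have hm'' : ∀ i, m'' i < a i := by
        rcases h3 with rfl | rfl
        · exact oddVec_lt ha
        · exact evenVec_lt ha
      by_contra h
      rcases loop_pair_cases hn ha hm' hm'' (inLattice_of_monoRes_ne_zero .loop ha h) with
        h4 | ⟨-, ⟨h4, -⟩ | ⟨h4, -⟩⟩
      · rcases h3 with rfl | rfl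
        · refine h2 (funext fun i => ?_)
          have e1 := h4 i
          have e2 := congrFun (oddVec_add_evenVec (a := a)) i
          simp only [Pi.add_apply, socleVec] at e2
          omega
        · refine h1 (funext fun i => ?_)
          have e1 := h4 i
          have e2 := congrFun (oddVec_add_evenVec (a := a)) i
          simp only [Pi.add_apply, socleVec] at e2
          omega
      · exact h1 h4
      · exact h2 h4
    set R := monoRes .loop a (socleVec .loop a)
    set Ao := ∏ i ∈ Finset.univ.filter (fun i : Fin n => Even (i : ℕ)), (a i : ℂ) with hAo
    set Ae := ∏ i ∈ Finset.univ.filter (fun i : Fin n => ¬ Even (i : ℕ)), (a i : ℂ) with hAe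
    have hA : Ao * Ae ≠ 1 := by
      rw [hAo, hAe, prod_even_mul_prod_odd]
      exact prod_ne_one hn ha
    have hsq : ((-1 : ℂ) ^ (n / 2)) * (-1) ^ (n / 2) = 1 := by
      rw [← mul_pow]; simp
    have hoo : monoRes .loop a (oddVec a + oddVec a) = (-1) ^ (n / 2) * Ae * R :=
      monoRes_oddVec hev ha
    have hee : monoRes .loop a (evenVec a + evenVec a) = (-1) ^ (n / 2) * Ao * R :=
      monoRes_evenVec hev ha
    have hoe : monoRes .loop a (oddVec a + evenVec a) = R := by rw [oddVec_add_evenVec]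
    have heo : monoRes .loop a (evenVec a + oddVec a) = R := by
      rw [add_comm, oddVec_add_evenVec]
    rcases hb with rfl | rfl
    -- The coefficients are a row of the adjugate of the 2 × 2 Gram matrix of m^odd and m^even.
    · refine ⟨((-1) ^ (n / 2) * Ao) • resFunctional .loop a (oddVec a) -
        resFunctional .loop a (evenVec a), ?_, fun m' hm' hne => ?_⟩
      · rw [LinearMap.sub_apply, LinearMap.smul_apply, resFunctional_mono, resFunctional_mono,
          hoo, hoe, smul_eq_mul]
        have : (-1) ^ (n / 2) * Ao * ((-1) ^ (n / 2) * Ae * R) - R = (Ao * Ae - 1) * R := by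
          linear_combination (Ao * Ae * R) * hsq
        rw [this]
        exact mul_ne_zero (sub_ne_zero.mpr hA) hR
      · rw [LinearMap.sub_apply, LinearMap.smul_apply, resFunctional_mono, resFunctional_mono,
          smul_eq_mul]
        by_cases he : m' = evenVec a
        · subst he
          rw [heo, hee, sub_self]
        · rw [hz m' hm' hne he _ (Or.inl rfl), hz m' hm' hne he _ (Or.inr rfl), mul_zero, sub_zero]
    · refine ⟨((-1) ^ (n / 2) * Ae) • resFunctional .loop a (evenVec a) -
        resFunctional .loop a (oddVec a), ?_, fun m' hm' hne => ?_⟩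
      · rw [LinearMap.sub_apply, LinearMap.smul_apply, resFunctional_mono, resFunctional_mono,
          hee, heo, smul_eq_mul]
        have : (-1) ^ (n / 2) * Ae * ((-1) ^ (n / 2) * Ao * R) - R = (Ao * Ae - 1) * R := by
          linear_combination (Ao * Ae * R) * hsq
        rw [this]
        exact mul_ne_zero (sub_ne_zero.mpr hA) hR
      · rw [LinearMap.sub_apply, LinearMap.smul_apply, resFunctional_mono, resFunctional_mono,
          smul_eq_mul]
        by_cases he : m' = oddVec a
        · subst he
          rw [hoe, hoo, sub_self]
        · rw [hz m' hm' he hne _ (Or.inl rfl), hz m' hm' he hne _ (Or.inr rfl), mul_zero, sub_zero]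
  · have hc : m + (socleVec .loop a - m) = socleVec .loop a := by
      funext i
      have := hm i
      simp only [Pi.add_apply, Pi.sub_apply, socleVec]
      omega
    refine ⟨resFunctional .loop a (socleVec .loop a - m), ?_, fun m' hm' hne => ?_⟩
    · rw [resFunctional_mono, hc]
      exact hR
    · rw [resFunctional_mono]
      by_contra h
      have hlt : ∀ i, (socleVec .loop a - m) i < a i := by
        intro i
        have := ha i
        simp only [Pi.sub_apply, socleVec]
        omega
      rcases loop_pair_cases hn ha hm' hlt (inLattice_of_monoRes_ne_zero .loop ha h) with
        h4 | ⟨hev, ⟨-, h4⟩ | ⟨-, h4⟩⟩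
      · refine hne (funext fun i => ?_)
        have e1 := h4 i
        have e2 := congrFun hc i
        have e3 := hm i
        simp only [Pi.add_apply, Pi.sub_apply, socleVec] at e1 e2
        omega
      · refine hb ⟨hev, Or.inr (funext fun i => ?_)⟩
        have e1 := congrFun h4 i
        have e2 := congrFun (oddVec_add_evenVec (a := a)) i
        have e3 := hm i
        simp only [Pi.add_apply, Pi.sub_apply, socleVec] at e1 e2
        omega
      · refine hb ⟨hev, Or.inl (funext fun i => ?_)⟩
        have e1 := congrFun h4 i
        have e2 := congrFun (oddVec_add_evenVec (a := a)) i
        have e3 := hm i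
        simp only [Pi.add_apply, Pi.sub_apply, socleVec] at e1 e2
        omega

end ResiduePairing

/-! ## Relations along a set of indices -/

section Relations

variable {σ : Type*} [Fintype σ] [DecidableEq σ] {s : σ → Option σ} {a : σ → ℕ}
  {w : MvPolynomial σ ℂ}

theorem sum_single_apply {σ ι : Type*} [DecidableEq σ] [DecidableEq ι] (T : Finset ι) (f : ι → Option σ)
    (hf : ∀ i ∈ T, ∀ j ∈ T, ∀ k, f i = some k → f j = some k → i = j) (x : σ → ℕ) (j : σ) :
    ∑ i ∈ T, ((f i).elim 0 fun k => (Pi.single k (x k) : σ → ℕ)) j =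
      if ∃ i ∈ T, f i = some j then x j else 0 := by
  have h1 : ∀ i, ((f i).elim 0 fun k => (Pi.single k (x k) : σ → ℕ)) j =
      if f i = some j then x j else 0 := by
    intro i
    rcases f i with _ | k
    · simp
    · by_cases h : k = j
      · subst h; simp
      · simp [h, Ne.symm h]
  rw [Finset.sum_congr rfl fun i _ => h1 i]
  split_ifs with h
  · obtain ⟨i, hi, hij⟩ := h
    rw [Finset.sum_eq_single_of_mem i hi, if_pos hij]
    intro l hl hli
    exact if_neg fun h' => hli (hf _ hl _ hi _ h' hij)
  · exact Finset.sum_eq_zero fun i hi => if_neg fun h' => h ⟨i, hi, h'⟩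

/-- This is `cls_add_sum_single` with all exponents given pointwise, so that its use reduces to case
distinctions on an index. -/
theorem cls_relations (hw : w = atomPoly s a) (hs : PartialInj s) (T : Finset σ)
    (k : σ → σ) (hk : ∀ i ∈ T, s i = some (k i)) (h M M' : σ → ℕ)
    (hM : ∀ j, M j = h j + if j ∈ T then a j else 0)
    (hM' : ∀ j, M' j = h j + (if ∃ i ∈ T, some (k i) = some j then a j - 1 else 0) +
      if ∃ i ∈ T, s (k i) = some j then 1 else 0) :
    cls w M = (∏ i ∈ T, -(a (k i) : ℂ)) • cls w M' := by
  have hinj : ∀ i ∈ T, ∀ j ∈ T, k i = k j → i = j := by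
    intro i hi j hj hij
    exact hs _ _ _ (hk i hi) (hij ▸ hk j hj)
  have e1 : M = h + ∑ i ∈ T, Pi.single i (a i) := by
    funext j
    have := sum_single_apply T (fun i => some i) (by
      intro i _ j _ l hi hj
      exact Option.some.inj (hi.trans hj.symm)) a j
    simp only [Option.elim_some] at this
    rw [Pi.add_apply, Finset.sum_apply, this, hM]
    simp
  have e2 : M' = h + ∑ i ∈ T, (Pi.single (k i) (a (k i) - 1) + optExp (s (k i))) := by
    funext j
    have h1 := sum_single_apply T (fun i => some (k i)) (by
      intro i hi' j hj' l hi hj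
      exact hinj _ hi' _ hj' (Option.some.inj (hi.trans hj.symm))) (fun j => a j - 1) j
    have h2 := sum_single_apply T (fun i => s (k i)) (by
      intro i hi' j hj' l hi hj
      exact hinj _ hi' _ hj' (hs _ _ _ hi hj)) (fun _ => 1) j
    simp only [Option.elim_some] at h1
    rw [Pi.add_apply, Finset.sum_apply]
    simp only [Pi.add_apply, Finset.sum_add_distrib]
    rw [h1, hM', add_assoc]
    congr 2
    exact h2.symm
  rw [e1, e2]
  exact cls_add_sum_single hw hs T k hk h

end Relations

/-! ## Combinatorics of chains -/

section ChainCombinatorics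

variable {n : ℕ} {a : Fin n → ℕ}

theorem sum_exponentMatrix_chain {K : Type*} [CommSemiring K] (c : Fin n → K) (i : Fin n) :
    ∑ j, (exponentMatrix .chain a i j : K) * c j =
      a i * c i + if h : (i : ℕ) + 1 < n then c ⟨i + 1, h⟩ else 0 := by
  rw [exponentMatrix_eq, sum_atomMat_mul]
  simp only [nextOf]
  split_ifs <;> simp

/-- Solutions of the linear system of a chain, continued by zero, take the values `0`, `1`
alternately on the part where the right-hand side has a standard form. -/
theorem chain_alternating {K : Type*} [Field K] [CharZero K] (ha : ∀ i, 2 ≤ a i) (c : ℕ → K)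
    (v : Fin n → K) (hc : ∀ i : Fin n, a i * c i + c (i + 1) = v i) (z : K) (hn : c n = 0) (k : ℕ)
    (hk : 2 * k ≤ n) (hv : ∀ i : Fin n, n < (i : ℕ) + 1 + 2 * k →
      v i = if Even (n - (i + 1)) then z * a i else z) (t : ℕ) (ht : t ≤ k) :
    c (n - 2 * t) = 0 ∧ (t < k → c (n - 2 * t - 1) = z) := by
  have ha' : ∀ i, (a i : K) ≠ 0 := fun i => by
    have := ha i
    exact_mod_cast (by omega : a i ≠ 0)
  -- Solving from the right end: after the value 0, a right-hand side z aᵢ gives z; after the value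
  -- z, a right-hand side z gives 0.
  have step : ∀ t < k, c (n - 2 * t) = 0 → c (n - 2 * t - 1) = z := by
    intro t ht h0
    have h1 := hc ⟨n - 2 * t - 1, by omega⟩
    rw [hv ⟨n - 2 * t - 1, by omega⟩ (by simp only; omega)] at h1
    simp only at h1
    rw [if_pos ⟨t, by omega⟩, show n - 2 * t - 1 + 1 = n - 2 * t by omega, h0, add_zero,
      mul_comm z] at h1
    exact mul_left_cancel₀ (ha' _) h1
  have key : ∀ t ≤ k, c (n - 2 * t) = 0 := by
    intro t
    induction t with
    | zero => intro _; simpa using hn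
    | succ t ih =>
      intro ht
      have h0 := step t (by omega) (ih (by omega))
      have h1 := hc ⟨n - 2 * t - 2, by omega⟩
      rw [hv ⟨n - 2 * t - 2, by omega⟩ (by simp only; omega)] at h1
      simp only at h1
      rw [if_neg (by rw [Nat.even_iff]; omega),
        show n - 2 * t - 2 + 1 = n - 2 * t - 1 by omega, h0, add_eq_right] at h1
      rw [show n - 2 * (t + 1) = n - 2 * t - 2 by omega]
      exact (mul_eq_zero.mp h1).resolve_left (ha' _)
  exact ⟨key t ht, fun h => step t h (key t ht)⟩

/-- The system E c = m + m' + 2 is solved from the last index to the first. On the last 2k positions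
c alternates between 2 and 0. To the left of them each equation is a divisibility by aᵢ of a number
confined to too short an interval, which forces c = 1 and complementary exponents. -/
theorem chain_pair_aux (ha : ∀ i, 2 ≤ a i) {k k' : ℕ} {m m' : Fin n → ℕ}
    (hm : IsChainStandard a k m) (hm' : IsChainStandard a k' m') (hkk : k ≤ k')
    (h : InLattice (exponentMatrix .chain a) fun i => (m i : ℤ) + m' i + 2) :
    k = k' ∧ ∀ i : Fin n, ((i : ℕ) + 1 + 2 * k < n → m i + m' i = a i - 1) ∧
      ((i : ℕ) + 1 + 2 * k = n → m i + m' i = a i - 2) := by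
  obtain ⟨c₀, hc₀⟩ := h
  set c : ℕ → ℤ := fun i => if h : i < n then c₀ ⟨i, h⟩ else 0 with hcdef
  have hc : ∀ i : Fin n, (a i : ℤ) * c i + c (i + 1) = m i + m' i + 2 := by
    intro i
    have := hc₀ i
    rw [sum_exponentMatrix_chain] at this
    refine Eq.trans ?_ this
    simp [hcdef]
  have hn : c n = 0 := by simp [hcdef]
  have hzero : c (n - 2 * k) = 0 := by
    -- On these positions m + m' + 2 is 2aᵢ or 2, so z = 2.
    have h1 := chain_alternating (K := ℚ) ha (fun i => (c i : ℚ))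
      (fun i => (m i : ℚ) + m' i + 2) (fun i => by exact_mod_cast hc i) 2 (by simp [hn]) k hm.1
      (fun i hi => by
        rw [((hm.2 i).2.2 hi), ((hm'.2 i).2.2 (by omega))]
        have h2 : ((a i - 1 : ℕ) : ℚ) = a i - 1 := by
          rw [Nat.cast_sub (by have := ha i; omega), Nat.cast_one]
        split_ifs
        · rw [h2]; ring
        · simp) k le_rfl
    exact_mod_cast h1.1
  have hedge : ∀ i : Fin n, (i : ℕ) + 1 + 2 * k = n →
      (a i : ℤ) * c i = m i + m' i + 2 ∧ m i + 1 < a i := by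
    intro i hi
    have h1 := hc i
    rw [show (i : ℕ) + 1 = n - 2 * k by omega, hzero, add_zero] at h1
    exact ⟨h1, (hm.2 i).2.1 hi⟩
  -- If k < k', then m'ᵢ = aᵢ - 1 at the edge position of m, so aᵢ would divide mᵢ + 1, which lies
  -- strictly between 0 and aᵢ.
  have hk : k = k' := by
    by_contra hne
    have hlt : 2 * k' ≤ n := hm'.1
    obtain ⟨h1, h2⟩ := hedge ⟨n - 1 - 2 * k, by omega⟩ (by simp only; omega)
    have h3 := (hm'.2 ⟨n - 1 - 2 * k, by omega⟩).2.2 (by simp only; omega)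
    rw [if_pos ⟨k, by simp only; omega⟩] at h3
    set i : Fin n := ⟨n - 1 - 2 * k, by omega⟩
    have h4 := ha i
    rw [h3] at h1
    have h5 : (a i : ℤ) * (c i - 1) = m i + 1 := by
      rw [Nat.cast_sub (by omega)] at h1
      push_cast at h1
      linear_combination h1
    have h6 : (a i : ℤ) ∣ m i + 1 := ⟨_, h5.symm⟩
    have h7 := Int.le_of_dvd (by omega) h6
    omega
  subst hk
  refine ⟨rfl, ?_⟩
  have hone : ∀ i : Fin n, (i : ℕ) + 1 + 2 * k = n → c i = 1 ∧ m i + m' i = a i - 2 := by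
    intro i hi
    obtain ⟨h1, h2⟩ := hedge i hi
    have h3 := (hm'.2 i).2.1 hi
    have h4 : (a i : ℤ) ∣ m i + m' i + 2 - a i := ⟨c i - 1, by linear_combination -h1⟩
    have h5 : (m i : ℤ) + m' i + 2 - a i = 0 := by
      refine Int.eq_zero_of_abs_lt_dvd h4 ?_
      rw [abs_lt]
      constructor <;> omega
    refine ⟨?_, by omega⟩
    have h6 : (a i : ℤ) * (c i - 1) = 0 := by linear_combination h1 + h5
    have h7 : (a i : ℤ) ≠ 0 := by omega
    have := (mul_eq_zero.mp h6).resolve_left h7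
    omega
  have key : ∀ t : ℕ, ∀ i : Fin n, (i : ℕ) + 1 + t + 2 * k = n → c i = 1 ∧
      (0 < t → m i + m' i = a i - 1) := by
    intro t
    induction t with
    | zero =>
      intro i hi
      exact ⟨(hone i (by omega)).1, by simp⟩
    | succ t ih =>
      intro i hi
      have h1 := (ih ⟨i + 1, by omega⟩ (by simp only; omega)).1
      have h2 := hc i
      simp only at h1
      rw [h1] at h2
      have h3 := (hm.2 i).1 (by omega)
      have h4 := (hm'.2 i).1 (by omega)
      have h5 : (a i : ℤ) ∣ m i + m' i + 1 - a i := ⟨c i - 1, by linear_combination -h2⟩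
      have h6 : (m i : ℤ) + m' i + 1 - a i = 0 := by
        refine Int.eq_zero_of_abs_lt_dvd h5 ?_
        rw [abs_lt]
        constructor <;> omega
      refine ⟨?_, fun _ => by omega⟩
      have h7 : (a i : ℤ) * (c i - 1) = 0 := by linear_combination h2 + h6
      have h8 : (a i : ℤ) ≠ 0 := by omega
      have := (mul_eq_zero.mp h7).resolve_left h8
      omega
  intro i
  exact ⟨fun hi => (key (n - (i + 1 + 2 * k)) i (by omega)).2 (by omega),
    fun hi => (hone i hi).2⟩

/-- Pairs of standard vectors of a chain whose sum is in the translated lattice. -/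
theorem chain_pair_cases (ha : ∀ i, 2 ≤ a i) {k k' : ℕ} {m m' : Fin n → ℕ}
    (hm : IsChainStandard a k m) (hm' : IsChainStandard a k' m')
    (h : InLattice (exponentMatrix .chain a) fun i => (m i : ℤ) + m' i + 2) :
    k = k' ∧ ∀ i : Fin n, ((i : ℕ) + 1 + 2 * k < n → m i + m' i = a i - 1) ∧
      ((i : ℕ) + 1 + 2 * k = n → m i + m' i = a i - 2) := by
  rcases le_total k k' with hkk | hkk
  · exact chain_pair_aux ha hm hm' hkk h
  · obtain ⟨h1, h2⟩ := chain_pair_aux ha hm' hm hkk (by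
      convert h using 2
      ring)
    subst h1
    refine ⟨rfl, fun i => ⟨fun hi => ?_, fun hi => ?_⟩⟩
    · rw [add_comm, (h2 i).1 hi]
    · rw [add_comm, (h2 i).2 hi]

/-- On the last 2k positions the coordinates of E⁻¹(m + 1) alternate between 1 and 0. At all earlier
positions they lie strictly between 0 and 1. -/
theorem chain_mem_fixedVars_iff (ha : ∀ i, 2 ≤ a i) {k : ℕ} {m : Fin n → ℕ}
    (hm : IsChainStandard a k m) (i : Fin n) :
    i ∈ fixedVars (groupElt (exponentMatrix .chain a) m : Fin n → ℂˣ) ↔ n ≤ (i : ℕ) + 2 * k := by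
  rw [mem_fixedVars_iff]
  set b₀ := ratCoord (exponentMatrix .chain a) fun j => (m j : ℤ) + 1 with hb₀
  set b : ℕ → ℚ := fun i => if h : i < n then b₀ ⟨i, h⟩ else 0 with hb
  have heq : ∀ i : Fin n, (a i : ℚ) * b i + b (i + 1) = m i + 1 := by
    intro i
    have := sum_mul_ratCoord (det_exponentMatrix_ne_zero .chain a ha) (fun j => (m j : ℤ) + 1) i
    rw [sum_exponentMatrix_chain] at this
    push_cast at this
    refine Eq.trans ?_ this
    simp [hb, hb₀]
  have hbi : b₀ i = b i := by simp [hb]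
  have halt := chain_alternating (K := ℚ) ha b (fun i => (m i : ℚ) + 1) heq 1 (by simp [hb]) k hm.1
    (fun i hi => by
      rw [((hm.2 i).2.2 hi)]
      have h2 : ((a i - 1 : ℕ) : ℚ) = a i - 1 := by
        rw [Nat.cast_sub (by have := ha i; omega), Nat.cast_one]
      split_ifs
      · rw [h2]; ring
      · simp)
  rw [hbi]
  constructor
  · intro hz
    by_contra hlt
    -- At the edge, aᵢbᵢ = mᵢ + 1 with 0 < mᵢ + 1 < aᵢ. Further left, bᵢ = (mᵢ + 1 - bᵢ₊₁)/aᵢ with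
    -- bᵢ₊₁ already strictly between 0 and 1.
    have key : ∀ t : ℕ, ∀ i : Fin n, (i : ℕ) + 1 + t + 2 * k = n → 0 < b i ∧ b i < 1 := by
      intro t
      induction t with
      | zero =>
        intro i hi
        have h1 := heq i
        rw [show (i : ℕ) + 1 = n - 2 * k by omega, (halt k le_rfl).1, add_zero] at h1
        have h2 : (m i : ℚ) + 1 < a i := by exact_mod_cast (hm.2 i).2.1 (by omega)
        have h3 : (2 : ℚ) ≤ a i := by exact_mod_cast ha i
        have h4 : (0 : ℚ) ≤ m i := Nat.cast_nonneg _
        constructor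
        · by_contra! h
          nlinarith
        · by_contra! h
          nlinarith
      | succ t ih =>
        intro i hi
        obtain ⟨h5, h6⟩ := ih ⟨i + 1, by omega⟩ (by simp only; omega)
        simp only at h5 h6
        have h1 := heq i
        have h2 : (m i : ℚ) + 1 ≤ a i := by exact_mod_cast (hm.2 i).1 (by omega)
        have h3 : (2 : ℚ) ≤ a i := by exact_mod_cast ha i
        have h4 : (0 : ℚ) ≤ m i := Nat.cast_nonneg _
        constructor
        · by_contra! h
          nlinarith
        · by_contra! h
          nlinarith
    obtain ⟨h1, h2⟩ := key (n - (i + 1 + 2 * k)) i (by have := i.2; omega)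
    obtain ⟨z, hz⟩ := hz
    rw [hz] at h1 h2
    have h3 : 0 < z := by exact_mod_cast h1
    have h4 : z < 1 := by exact_mod_cast h2
    omega
  · intro hi
    have hin := i.2
    rcases Nat.even_or_odd' (n - i) with ⟨t, ht | ht⟩
    · refine ⟨0, ?_⟩
      rw [show (i : ℕ) = n - 2 * t by omega, (halt t (by omega)).1]
      simp
    · refine ⟨1, ?_⟩
      rw [show (i : ℕ) = n - 2 * t - 1 by omega, (halt t (by omega)).2 (by omega)]
      simp

end ChainCombinatorics

/-! ## The residue pairing of the dual of a chain -/

section Derivative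

variable {σ : Type*} [Fintype σ] [DecidableEq σ] {s : σ → Option σ} {a : σ → ℕ}
  {w : MvPolynomial σ ℂ}

theorem cls_eq_mul_of_le {σ : Type*} [Fintype σ] (w : MvPolynomial σ ℂ) {m m' : σ → ℕ}
    (h : m' ≤ m) : cls w m = cls w (m - m') * cls w m' := by
  rw [← cls_add]
  congr 1
  exact (tsub_add_cancel_of_le h).symm

theorem cls_deriv_eq_zero (hw : w = atomPoly s a) (ha : ∀ i, 2 ≤ a i) {j : σ}
    (hj : ∀ i, s i ≠ some j) : cls w (Pi.single j (a j - 1) + optExp (s j)) = 0 := by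
  have h1 := mk_atomDeriv hw j
  rw [atomDeriv_eq, Finset.sum_eq_zero (fun i _ => if_neg (hj i)), add_zero, mul_assoc, map_mul,
    map_natCast, ← nsmul_eq_mul, ← Nat.cast_smul_eq_nsmul ℂ] at h1
  rw [cls, xpow_add, xpow_single, xpow_optExp]
  refine (smul_eq_zero.mp h1).resolve_left ?_
  have := ha j
  exact_mod_cast (by omega : a j ≠ 0)

theorem cls_deriv_eq_smul (hw : w = atomPoly s a) (hs : PartialInj s) (ha : ∀ i, 2 ≤ a i)
    {i j : σ} (h : s i = some j) : cls w (Pi.single j (a j - 1) + optExp (s j)) =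
      (-(a j : ℂ))⁻¹ • cls w (Pi.single i (a i)) := by
  have h2 : (-(a j : ℂ)) ≠ 0 := by
    have := ha j
    exact neg_ne_zero.mpr (by exact_mod_cast (by omega : a j ≠ 0))
  rw [cls_single hw hs h, smul_smul, inv_mul_cancel₀ h2, one_smul]

end Derivative

/-! ### Products, vanishing and separation of monomials for the dual of a chain -/

section ChainResidue

variable {n : ℕ} {a : Fin n → ℕ}

theorem isSocle_chain (ha : ∀ i, 2 ≤ a i) :
    IsSocle (prevOf .chain n) a (socleVec .chain a) := by
  intro j
  have h2 := ha j
  have h1 : (∃ i, prevOf .chain n i = some j) ↔ (j : ℕ) + 1 ≠ n := by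
    simp only [prevOf, Option.ite_none_right_eq_some, Option.some.injEq, Fin.ext_iff]
    constructor
    · rintro ⟨i, hi, hij⟩
      have := i.2
      omega
    · intro h
      have := j.2
      exact ⟨⟨j + 1, by omega⟩, by simp, by simp⟩
  simp only [h1]
  simp only [socleVec]
  split_ifs <;> omega

theorem monoRes_socle_chain (ha : ∀ i, 2 ≤ a i) :
    monoRes .chain a (socleVec .chain a) = (∏ i, (a i : ℂ))⁻¹ := by
  rw [monoRes, milnorResidue_congr (dualPoly_eq .chain a)]
  refine residue_socle_chain (partialInj_prevOf _ _) ha (fun i => n - i) ?_ (isSocle_chain ha)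
  intro i k h
  simp only [prevOf, Option.ite_none_right_eq_some, Option.some.injEq, Fin.ext_iff] at h
  have := i.2
  omega

theorem monoRes_socle_chain_ne_zero (ha : ∀ i, 2 ≤ a i) :
    monoRes .chain a (socleVec .chain a) ≠ 0 := by
  rw [monoRes_socle_chain ha]
  refine inv_ne_zero (Finset.prod_ne_zero_iff.mpr fun i _ => ?_)
  have := ha i
  exact_mod_cast (by omega : a i ≠ 0)

/-- The indices `n - 2k, n - 2k + 2, …, n - 2`. -/
def chainTail (n k : ℕ) : Finset (Fin n) :=
  Finset.univ.filter fun i => n ≤ (i : ℕ) + 2 * k ∧ Even (n - i)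

/-- In the tail, m + m' alternates between 2(aᵢ - 1) and 0. One relation at each position of the
first kind moves xᵢ^aᵢ to xᵢ₋₁^(aᵢ₋₁-1) xᵢ₋₂ with the factor -aᵢ₋₁ and produces the socle monomial,
including the missing xᵢ at the edge. -/
theorem monoRes_chain (ha : ∀ i, 2 ≤ a i) {k : ℕ} {m m' : Fin n → ℕ}
    (hm : IsChainStandard a k m) (hm' : IsChainStandard a k m')
    (h : ∀ i : Fin n, ((i : ℕ) + 1 + 2 * k < n → m i + m' i = a i - 1) ∧
      ((i : ℕ) + 1 + 2 * k = n → m i + m' i = a i - 2)) :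
    monoRes .chain a (m + m') =
      (∏ i ∈ chainTail n k, -(a i : ℂ)) * monoRes .chain a (socleVec .chain a) := by
  -- The zero-based positions n - 1, n - 3, …, n - 2k + 1, where both exponents are aᵢ - 1.
  set T : Finset (Fin n) :=
    Finset.univ.filter fun i => n ≤ (i : ℕ) + 2 * k ∧ Even (n - (i + 1)) with hT
  have hk := hm.1
  have hmem : ∀ i, i ∈ T ↔ n ≤ (i : ℕ) + 2 * k ∧ Even (n - (i + 1)) := fun i => by simp [hT]
  have hpos : ∀ i ∈ T, 0 < (i : ℕ) := by
    intro i hi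
    rw [hmem, Nat.even_iff] at hi
    have := i.2
    omega
  have hrel := cls_relations (dualPoly_eq .chain a) (partialInj_prevOf .chain n) T
    (fun i => ⟨i - 1, by omega⟩) (fun i hi => by simp [prevOf, hpos i hi])
    (fun i => (m + m') i - if i ∈ T then a i else 0) (m + m') (socleVec .chain a)
    (fun i => by
      split_ifs with hi
      · rw [hmem] at hi
        have h1 := (hm.2 i).2.2 (by omega)
        have h2 := (hm'.2 i).2.2 (by omega)
        rw [if_pos hi.2] at h1 h2
        have := ha i
        simp only [Pi.add_apply]
        omega
      · simp)
    (fun i => by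
      have e1 : (∃ j ∈ T, some (⟨j - 1, by omega⟩ : Fin n) = some i) ↔
          n ≤ (i : ℕ) + 2 * k ∧ ¬ Even (n - (i + 1)) := by
        constructor
        · rintro ⟨j, hj, hji⟩
          have h1 := hpos j hj
          have h2 := (hmem j).mp hj
          simp only [Option.some.injEq, Fin.ext_iff] at hji
          rw [Nat.even_iff] at h2 ⊢
          have := j.2
          omega
        · rintro ⟨h1, h2⟩
          rw [Nat.even_iff] at h2
          have := i.2
          refine ⟨⟨i + 1, by omega⟩, (hmem _).mpr ?_, by simp⟩
          rw [Nat.even_iff]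
          simp only
          omega
      have e2 : (∃ j ∈ T, prevOf .chain n (⟨j - 1, by omega⟩ : Fin n) = some i) ↔
          n ≤ (i : ℕ) + 2 + 2 * k ∧ Even (n - (i + 1)) ∧ (i : ℕ) + 1 < n := by
        constructor
        · rintro ⟨j, hj, hji⟩
          have h1 := hpos j hj
          have h2 := (hmem j).mp hj
          simp only [prevOf, Option.ite_none_right_eq_some, Option.some.injEq, Fin.ext_iff] at hji
          rw [Nat.even_iff] at h2 ⊢
          have := j.2
          omega
        · rintro ⟨h1, h2, h3⟩
          rw [Nat.even_iff] at h2
          refine ⟨⟨i + 2, by omega⟩, (hmem _).mpr ?_, by simp [prevOf]⟩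
          rw [Nat.even_iff]
          simp only
          omega
      simp only [e1, e2]
      simp only [hmem]
      simp only [Pi.add_apply, socleVec]
      have hin := i.2
      have hai := ha i
      rcases lt_trichotomy ((i : ℕ) + 1 + 2 * k) n with hlt | heq | hgt
      · have := (h i).1 hlt
        rw [if_neg (by omega), if_neg (by omega), if_neg (by omega)]
        by_cases h2 : n ≤ (i : ℕ) + 2 + 2 * k ∧ Even (n - (i + 1)) ∧ (i : ℕ) + 1 < n
        · have h3 := h2.2.1
          rw [Nat.even_iff] at h3
          omega
        · rw [if_neg h2]
          omega
      · have := (h i).2 heq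
        rw [if_neg (by omega : ¬(n ≤ (i : ℕ) + 2 * k ∧ Even (n - (i + 1)))),
          if_neg (by omega : ¬(n ≤ (i : ℕ) + 2 * k ∧ ¬Even (n - (i + 1))))]
        have hev : Even (n - (i + 1)) := ⟨k, by omega⟩
        simp only [hev, true_and]
        split_ifs <;> omega
      · have h1 := (hm.2 i).2.2 hgt
        have h2 := (hm'.2 i).2.2 hgt
        by_cases hev : Even (n - (i + 1))
        · simp only [hev, if_true, true_and, and_true, not_true, and_false, if_false] at h1 h2 ⊢
          rw [h1, h2]
          split_ifs <;> omega
        · have hodd := hev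
          rw [Nat.even_iff] at hodd
          simp only [hev, if_false, false_and, and_false, not_false_iff, and_true] at h1 h2 ⊢
          rw [h1, h2]
          split_ifs <;> omega)
  rw [monoRes, hrel, map_smul, smul_eq_mul]
  congr 1
  refine Finset.prod_bij (fun i _ => ⟨i - 1, by omega⟩) ?_ ?_ ?_ ?_
  · intro i hi
    have h1 := hpos i hi
    have h2 := (hmem i).mp hi
    have := i.2
    rw [Nat.even_iff] at h2
    simp only [chainTail, Finset.mem_filter, Finset.mem_univ, true_and, Nat.even_iff]
    omega
  · intro i hi j hj hij
    have h1 := hpos i hi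
    have h2 := hpos j hj
    rw [Fin.ext_iff] at hij ⊢
    simp only at hij
    omega
  · intro i hi
    simp only [chainTail, Finset.mem_filter, Finset.mem_univ, true_and, Nat.even_iff] at hi
    have := i.2
    refine ⟨⟨i + 1, by omega⟩, (hmem _).mpr ?_, by simp⟩
    rw [Nat.even_iff]
    simp only
    omega
  · intro i _
    rfl

theorem single_add_prev_le {m : Fin n → ℕ} (j : Fin n) (h : a j - 1 ≤ m j)
    (h' : ∀ i : Fin n, (i : ℕ) + 1 = j → 1 ≤ m i) :
    Pi.single j (a j - 1) + optExp (prevOf .chain n j) ≤ m := by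
  have ho : ∀ i, optExp (prevOf .chain n j) i = if (i : ℕ) + 1 = j then 1 else 0 := by
    intro i
    simp only [prevOf]
    by_cases hj : 0 < (j : ℕ)
    · simp only [hj, if_true, optExp, Option.elim_some, Pi.single_apply, Fin.ext_iff]
      refine if_congr ?_ rfl rfl
      omega
    · rw [if_neg hj, if_neg (by omega)]
      rfl
  intro i
  rw [Pi.add_apply, ho]
  by_cases hij : i = j
  · subst hij
    simpa using h
  · rw [Pi.single_eq_of_ne hij, zero_add]
    split_ifs with h1
    · exact h' i h1
    · exact Nat.zero_le _

/-- The relation at position n - 1 - 2k trades the factor x^(a-1) there, times the variable before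
it, for a power of the variable after it. That is the same situation with k - 1. At the right end
nothing is left to trade for: the last derivative is a single monomial, which vanishes. -/
theorem cls_chain_eq_zero (ha : ∀ i, 2 ≤ a i) (k : ℕ) (hk : 2 * k < n) (m : Fin n → ℕ)
    (hm : ∀ t ≤ k, ∀ i : Fin n, (i : ℕ) + 1 + 2 * t = n → a i - 1 ≤ m i)
    (hm' : ∀ i : Fin n, (i : ℕ) + 2 + 2 * k = n → 1 ≤ m i) :
    cls (dualPoly .chain a) m = 0 := by
  induction k generalizing m with
  | zero =>
    set j : Fin n := ⟨n - 1, by omega⟩ with hj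
    have hle : Pi.single j (a j - 1) + optExp (prevOf .chain n j) ≤ m := by
      refine single_add_prev_le j (hm 0 le_rfl j (by simp only [hj]; omega)) fun i hi => hm' i ?_
      simp only [hj] at hi
      omega
    rw [cls_eq_mul_of_le _ hle, cls_deriv_eq_zero (dualPoly_eq .chain a) ha, mul_zero]
    intro i hi
    simp only [prevOf, Option.ite_none_right_eq_some, Option.some.injEq, Fin.ext_iff, hj] at hi
    have := i.2
    omega
  | succ k ih =>
    -- Here j is the edge position n - 1 - 2(k + 1), and i₀ = j + 1 receives the power x^a, so its
    -- exponent is positive as the induction hypothesis requires.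
    set j : Fin n := ⟨n - 3 - 2 * k, by omega⟩ with hj
    set i₀ : Fin n := ⟨n - 2 - 2 * k, by omega⟩ with hi₀
    have hprev : prevOf .chain n i₀ = some j := by
      simp only [prevOf, Option.ite_none_right_eq_some, Option.some.injEq, Fin.ext_iff, hj, hi₀]
      omega
    have hle : Pi.single j (a j - 1) + optExp (prevOf .chain n j) ≤ m := by
      refine single_add_prev_le j (hm (k + 1) le_rfl j (by simp only [hj]; omega))
        fun i hi => hm' i ?_
      simp only [hj] at hi
      omega
    rw [cls_eq_mul_of_le _ hle,
      cls_deriv_eq_smul (dualPoly_eq .chain a) (partialInj_prevOf _ _) ha hprev, mul_smul_comm,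
      ← cls_add, ih (by omega), smul_zero]
    · intro t ht i hi
      have h1 := hm t (by omega) i hi
      have h2 : (Pi.single j (a j - 1) : Fin n → ℕ) i = 0 := by
        rw [Pi.single_apply, if_neg]
        rw [Fin.ext_iff]
        simp only [hj]
        omega
      have h3 : optExp (prevOf .chain n j) i = 0 := by
        simp only [prevOf]
        split_ifs with h
        · simp only [optExp, Option.elim_some]
          rw [Pi.single_apply, if_neg]
          rw [Fin.ext_iff]
          simp only [hj]
          omega
        · rfl
      simp only [Pi.add_apply, Pi.sub_apply, h2, h3]
      omega
    · intro i hi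
      have h1 : i = i₀ := Fin.ext (by simp only [hi₀]; omega)
      have := ha i₀
      rw [h1]
      simp only [Pi.add_apply, Pi.single_eq_same]
      omega

/-- The standard tail is extended from the right as far as possible. The edge exponent is either
small enough, and m is standard, or equal to a - 1; in the latter case the exponent before it is 0,
and the tail grows by two, or the monomial vanishes by `cls_chain_eq_zero`. -/
theorem chain_standard_or_zero (ha : ∀ i, 2 ≤ a i) (m : Fin n → ℕ) (hm : ∀ i, m i < a i) :
    (∃ k, IsChainStandard a k m) ∨ cls (dualPoly .chain a) m = 0 := by
  -- The variable d bounds the untreated length n - 2k and drives the induction.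
  have key : ∀ d k : ℕ, n ≤ 2 * k + d → 2 * k ≤ n → (∀ i : Fin n, n < (i : ℕ) + 1 + 2 * k →
      m i = if Even (n - (i + 1)) then a i - 1 else 0) →
      (∃ k, IsChainStandard a k m) ∨ cls (dualPoly .chain a) m = 0 := by
    intro d
    induction d using Nat.strong_induction_on with
    | _ d ih =>
      intro k hd hk hpat
      by_cases hst : ∀ i : Fin n, (i : ℕ) + 1 + 2 * k = n → m i + 1 < a i
      · exact Or.inl ⟨k, hk, fun i => ⟨fun _ => hm i, hst i, hpat i⟩⟩
      push Not at hst
      obtain ⟨i, hi, hmi⟩ := hst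
      by_cases hz : ∀ i : Fin n, (i : ℕ) + 2 + 2 * k = n → 1 ≤ m i
      · refine Or.inr (cls_chain_eq_zero ha k (by omega) m ?_ hz)
        intro t ht j hj
        rcases ht.lt_or_eq with ht | rfl
        · rw [hpat j (by omega), if_pos ⟨t, by omega⟩]
        · have : j = i := Fin.ext (by omega)
          subst this
          omega
      · push Not at hz
        obtain ⟨i', hi', hmi'⟩ := hz
        refine ih (d - 2) (by omega) (k + 1) (by omega) (by omega) fun j hj => ?_
        by_cases h1 : n < (j : ℕ) + 1 + 2 * k
        · exact hpat j h1
        · by_cases h2 : (j : ℕ) + 1 + 2 * k = n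
          · have : j = i := Fin.ext (by omega)
            subst this
            have := hm j
            rw [if_pos ⟨k, by omega⟩]
            omega
          · have : j = i' := Fin.ext (by omega)
            subst this
            rw [if_neg (by rw [Nat.even_iff]; omega)]
            omega
  exact key n 0 (by omega) (by omega) (fun i hi => by have := i.2; omega)

/-- The dual vector d is complementary to m before the tail and equal to m on it. By
`chain_pair_cases`, m is the only standard vector with which d pairs. -/
theorem chain_separating (ha : ∀ i, 2 ≤ a i) {m : Fin n → ℕ} (hm : IsStandard .chain a m) :
    ∃ φ : MilnorRing (dualPoly .chain a) →ₗ[ℂ] ℂ, φ (mono .chain a m) ≠ 0 ∧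
      ∀ m' : Fin n → ℕ, IsStandard .chain a m' → m' ≠ m → φ (mono .chain a m') = 0 := by
  obtain ⟨k, hm⟩ := hm
  set d : Fin n → ℕ := fun i => if (i : ℕ) + 1 + 2 * k < n then a i - 1 - m i else
    if (i : ℕ) + 1 + 2 * k = n then a i - 2 - m i else m i with hd
  have hdst : IsChainStandard a k d := by
    refine ⟨hm.1, fun i => ⟨fun h => ?_, fun h => ?_, fun h => ?_⟩⟩
    · have := ha i
      simp only [hd, if_pos h]
      omega
    · have := ha i
      simp only [hd, if_neg (by omega : ¬ (i : ℕ) + 1 + 2 * k < n), if_pos h]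
      omega
    · simp only [hd, if_neg (by omega : ¬ (i : ℕ) + 1 + 2 * k < n),
        if_neg (by omega : ¬ (i : ℕ) + 1 + 2 * k = n)]
      exact (hm.2 i).2.2 h
  have hsum : ∀ i : Fin n, ((i : ℕ) + 1 + 2 * k < n → m i + d i = a i - 1) ∧
      ((i : ℕ) + 1 + 2 * k = n → m i + d i = a i - 2) := by
    refine fun i => ⟨fun h => ?_, fun h => ?_⟩
    · have := (hm.2 i).1 h
      simp only [hd, if_pos h]
      omega
    · have := (hm.2 i).2.1 h
      simp only [hd, if_neg (by omega : ¬ (i : ℕ) + 1 + 2 * k < n), if_pos h]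
      omega
  refine ⟨resFunctional .chain a d, ?_, fun m' hm' hne => ?_⟩
  · rw [resFunctional_mono, monoRes_chain ha hm hdst hsum]
    refine mul_ne_zero (Finset.prod_ne_zero_iff.mpr fun i _ => ?_) (monoRes_socle_chain_ne_zero ha)
    have := ha i
    exact neg_ne_zero.mpr (by exact_mod_cast (by omega : a i ≠ 0))
  · rw [resFunctional_mono]
    by_contra h
    obtain ⟨k', hm'⟩ := hm'
    obtain ⟨rfl, h1⟩ := chain_pair_cases ha hm' hdst (inLattice_of_monoRes_ne_zero .chain ha h)
    refine hne (funext fun i => ?_)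
    have h2 := h1 i
    have h3 := hsum i
    rcases lt_trichotomy ((i : ℕ) + 1 + 2 * k') n with h | h | h
    · have e1 := h2.1 h
      have e2 := h3.1 h
      omega
    · have e1 := h2.2 h
      have e2 := h3.2 h
      omega
    · rw [(hm.2 i).2.2 h, (hm'.2 i).2.2 h]

end ChainResidue

/-! ## The basis of standard monomials -/

section StandardBasis

variable {n : ℕ} {a : Fin n → ℕ}

theorem standard_separating (τ : AtomicType) (hn : 0 < n) (ha : ∀ i, 2 ≤ a i) {m : Fin n → ℕ}
    (hm : IsStandard τ a m) :
    ∃ φ : MilnorRing (dualPoly τ a) →ₗ[ℂ] ℂ, φ (mono τ a m) ≠ 0 ∧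
      ∀ m' : Fin n → ℕ, IsStandard τ a m' → m' ≠ m → φ (mono τ a m') = 0 := by
  cases τ
  · exact chain_separating ha hm
  · exact loop_separating hn ha hm

theorem span_standard (τ : AtomicType) (ha : ∀ i, 2 ≤ a i) :
    Submodule.span ℂ (Set.range fun m : {m : Fin n → ℕ // IsStandard τ a m} =>
      mono τ a m.1) = ⊤ := by
  rw [eq_top_iff, ← span_box (dualPoly_eq τ a) (partialInj_prevOf τ n) ha, Submodule.span_le]
  rintro _ ⟨m, hm, rfl⟩
  cases τ
  · rcases chain_standard_or_zero ha m hm with h | h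
    · exact Submodule.subset_span ⟨⟨m, h⟩, rfl⟩
    · rw [h]
      exact zero_mem _
  · exact Submodule.subset_span ⟨⟨m, hm⟩, rfl⟩

/-- The basis of standard monomials of the Milnor ring. -/
noncomputable def standardBasis (τ : AtomicType) (hn : 0 < n) (ha : ∀ i, 2 ≤ a i) :
    Module.Basis {m : Fin n → ℕ // IsStandard τ a m} ℂ (MilnorRing (dualPoly τ a)) :=
  Module.Basis.mk (v := fun m => mono τ a m.1)
    (linearIndependent_of_separating _ fun m => by
      obtain ⟨φ, h1, h2⟩ := standard_separating τ hn ha m.2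
      exact ⟨φ, h1, fun m' hne => h2 m'.1 m'.2 fun h => hne (Subtype.ext h)⟩)
    (span_standard τ ha).ge

theorem standardBasis_apply (τ : AtomicType) (hn : 0 < n) (ha : ∀ i, 2 ≤ a i)
    (m : {m : Fin n → ℕ // IsStandard τ a m}) : standardBasis τ hn ha m = mono τ a m.1 := by
  simp [standardBasis]

end StandardBasis

/-! ## Push-forward of monomials -/

section PushForward

variable {σ : Type*} [Fintype σ] [DecidableEq σ]

/-- The additional 1 in the exponent is the weight of dxᵢ. -/
theorem pushForward_cls (w : MvPolynomial σ ℂ) (t : σ → ℂˣ) (ht : t ∈ scalingGroup w)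
    (M : σ → ℕ) :
    pushForward w t ht (cls w M) = ((∏ i, t i ^ (M i + 1) : ℂˣ) : ℂ)⁻¹ • cls w M := by
  have h1 : (Ideal.quotientMapₐ (jacobianIdeal w)
      (MvPowerSeries.rescaleAlgHom fun i => ((t⁻¹) i : ℂ))
      (jacobianIdeal_le_comap w (inv_mem ht))).toLinearMap (cls w M) =
      ((∏ i, (t i) ^ M i : ℂˣ) : ℂ)⁻¹ • cls w M := by
    change Ideal.Quotient.mk _ (MvPowerSeries.rescaleAlgHom (fun i => ((t⁻¹) i : ℂ)) (xpow M)) = _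
    rw [rescale_xpow]
    have h2 : (∏ i, ((t⁻¹) i : ℂ) ^ M i) = ((∏ i, (t i) ^ M i : ℂˣ) : ℂ)⁻¹ := by
      push_cast
      rw [← Finset.prod_inv_distrib]
      exact Finset.prod_congr rfl fun i _ => by simp
    rw [h2, ← MvPowerSeries.smul_eq_C_mul]
    rfl
  rw [pushForward, LinearMap.smul_apply, h1, smul_smul]
  congr 1
  rw [← Units.val_inv_eq_inv_val, ← Units.val_inv_eq_inv_val, ← Units.val_mul]
  congr 1
  simp only [pow_succ, Finset.prod_mul_distrib, mul_inv, Finset.prod_inv_distrib]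
  exact mul_comm _ _

/-- The effect of a diagonal transformation on a form whose monomial is a product of monomials
of the polynomial. -/
theorem pushForward_cls_of_rows (w : MvPolynomial σ ℂ) (t : σ → ℂˣ) (ht : t ∈ scalingGroup w)
    (E : Matrix σ σ ℕ) (c : ℂˣ) (hrow : ∀ i, ∏ j, t j ^ E i j = c) (T : Finset σ) (M : σ → ℕ)
    (hM : ∀ j, M j + 1 = ∑ i ∈ T, E i j) :
    pushForward w t ht (cls w M) = ((c : ℂ) ^ T.card)⁻¹ • cls w M := by
  rw [pushForward_cls]
  congr 2
  have h1 : ∏ i, t i ^ (M i + 1) = c ^ T.card := by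
    simp only [hM, ← Finset.prod_pow_eq_pow_sum]
    rw [Finset.prod_comm, Finset.prod_congr rfl fun i _ => hrow i, Finset.prod_const]
  rw [h1]
  push_cast
  rfl

end PushForward

/-! ## Rows of the exponent matrix -/

section Rows

variable {n : ℕ} (E : Matrix (Fin n) (Fin n) ℕ)

/-- Comparing coefficients shows that g fixes each monomial of the polynomial. Equal rows are
collected, and their number cancels because it is nonzero in ℂ. -/
theorem prod_pow_row_eq_one {g : Fin n → ℂˣ} (hg : g ∈ symGroup E) (i : Fin n) :
    ∏ j, g j ^ E i j = 1 := by
  have h1 : (∑ i, MvPolynomial.monomial (Finsupp.equivFunOnFinite.symm (E i))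
      ((∏ j, g j ^ E i j : ℂˣ) : ℂ)) =
      ∑ i, MvPolynomial.monomial (Finsupp.equivFunOnFinite.symm (E i)) (1 : ℂ) := by
    refine MvPolynomial.funext fun x => ?_
    have h2 := hg x
    simp only [polyOf, map_sum, map_prod, map_pow, MvPolynomial.eval_X, mul_pow,
      Finset.prod_mul_distrib, Units.val_one, one_mul] at h2
    simp only [map_sum, MvPolynomial.eval_monomial, one_mul]
    have h3 : ∀ i, (Finsupp.equivFunOnFinite.symm (E i)).prod (fun j e => x j ^ e) =
        ∏ j, x j ^ E i j := fun i => Finsupp.prod_fintype _ _ fun j => pow_zero _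
    simp only [h3]
    rw [← h2]
    push_cast
    rfl
  have h2 := congrArg (MvPolynomial.coeff (Finsupp.equivFunOnFinite.symm (E i))) h1
  simp only [MvPolynomial.coeff_sum, MvPolynomial.coeff_monomial,
    EmbeddingLike.apply_eq_iff_eq] at h2
  have h3 : ∀ k, (if E k = E i then ((∏ j, g j ^ E k j : ℂˣ) : ℂ) else 0) =
      ((∏ j, g j ^ E i j : ℂˣ) : ℂ) * if E k = E i then 1 else 0 := by
    intro k
    split_ifs with h
    · rw [h, mul_one]
    · rw [mul_zero]
  rw [Finset.sum_congr rfl fun k _ => h3 k, ← Finset.mul_sum, Finset.sum_boole] at h2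
  ext
  rw [Units.val_one]
  refine (mul_eq_right₀ ?_).mp h2
  exact_mod_cast (Finset.card_pos.mpr ⟨i, by simp⟩).ne'

/-- Every monomial of w has total weight 1 for the qᵢ, so ζ acts on it by e^(πi). -/
theorem prod_zetaElt_pow_row (hE : (E.map (Nat.cast : ℕ → ℚ)).det ≠ 0) (i : Fin n) :
    ∏ j, zetaElt E j ^ E i j = -1 := by
  unfold zetaElt
  rw [prod_expUnit_pow]
  have h1 : ∑ k, (E i k : ℚ) * weight E k = 1 := by
    have h2 := fun j => congrFun (congrFun
      (Matrix.mul_nonsing_inv _ (isUnit_iff_ne_zero.mpr hE)) i) j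
    simp only [Matrix.mul_apply, Matrix.map_apply, Matrix.one_apply] at h2
    simp only [weight, Finset.mul_sum, rho]
    rw [Finset.sum_comm, Finset.sum_congr rfl fun j _ => h2 j]
    simp
  have h3 : ∑ k, (E i k : ℂ) * (weight E k : ℂ) = 1 := by
    have := congrArg (fun q : ℚ => (q : ℂ)) h1
    push_cast at this
    exact this
  have h4 : ∑ k, (E i k : ℂ) * (Real.pi * Complex.I * (weight E k : ℂ)) = Real.pi * Complex.I := by
    calc _ = Real.pi * Complex.I * ∑ k, (E i k : ℂ) * (weight E k : ℂ) := by
          rw [Finset.mul_sum]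
          exact Finset.sum_congr rfl fun k _ => by ring
      _ = _ := by rw [h3, mul_one]
  rw [h4]
  ext
  simp [expUnit, Complex.exp_pi_mul_I]

end Rows

/-! ## Restriction to coordinate subspaces -/

section Restriction

variable {n : ℕ}

/-- The partial map induced on a set of indices. -/
def restrictNext (s : Fin n → Option (Fin n)) (S : Finset (Fin n)) (i : S) : Option S :=
  (s i).bind fun j => if h : j ∈ S then some ⟨j, h⟩ else none

theorem restrictNext_eq_some_iff (s : Fin n → Option (Fin n)) (S : Finset (Fin n)) (i j : S) :
    restrictNext s S i = some j ↔ s i = some (j : Fin n) := by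
  unfold restrictNext
  rcases s i with _ | k
  · simp
  · simp only [Option.bind_some, Option.dite_none_right_eq_some, Option.some.injEq, Subtype.ext_iff]
    constructor
    · rintro ⟨_, h⟩
      exact h
    · rintro rfl
      exact ⟨j.2, rfl⟩

theorem PartialInj.restrictNext {s : Fin n → Option (Fin n)} (hs : PartialInj s)
    (S : Finset (Fin n)) : PartialInj (restrictNext s S) := by
  intro i j k hi hj
  rw [restrictNext_eq_some_iff] at hi hj
  exact Subtype.ext (hs _ _ _ hi hj)

theorem restrictNext_elim {s : Fin n → Option (Fin n)} {S : Finset (Fin n)}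
    (hS : ∀ i ∈ S, ∀ j, s i = some j → j ∈ S) {M : Type*} (x : M) (f : S → M) (g : Fin n → M)
    (hfg : ∀ i : S, f i = g i) (i : S) : (restrictNext s S i).elim x f = (s i).elim x g := by
  unfold LGMirror.restrictNext
  rcases h : s i with _ | k
  · simp
  · simp [hS i i.2 k h, hfg]

/-- Terms with i ∉ S contain a positive power of a vanishing variable. For i ∈ S, closedness of S
keeps x_{s(i)}; without it the term would vanish, whereas `restrictNext` would replace that variable
by 1. -/
theorem restrictedPoly_atomMat (s : Fin n → Option (Fin n)) {a : Fin n → ℕ} (ha : ∀ i, 2 ≤ a i)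
    {S : Finset (Fin n)} (hS : ∀ i ∈ S, ∀ j, s i = some j → j ∈ S) :
    restrictedPoly (atomMat s a) S = atomPoly (restrictNext s S) fun i => a i := by
  rw [restrictedPoly, polyOf_atomMat, atomPoly, atomPoly, map_sum]
  set g : Fin n → MvPolynomial S ℂ := fun i => if h : i ∈ S then MvPolynomial.X ⟨i, h⟩ else 0
    with hg
  have h1 : ∀ i, restrictTo S (MvPolynomial.X i ^ a i * (s i).elim 1 MvPolynomial.X) =
      g i ^ a i * (s i).elim 1 g := by
    intro i
    rw [map_mul, map_pow]
    congr 1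
    · simp [restrictTo, hg]
    · rcases s i with _ | k
      · simp
      · simp [restrictTo, hg]
  rw [Finset.sum_congr rfl fun i _ => h1 i]
  have h2 : ∑ i, g i ^ a i * (s i).elim 1 g = ∑ i ∈ S, g i ^ a i * (s i).elim 1 g := by
    refine (Finset.sum_subset (Finset.subset_univ S) fun i _ hi => ?_).symm
    have := ha i
    simp only [hg, dif_neg hi]
    rw [zero_pow (by omega), zero_mul]
  rw [h2, ← Finset.sum_coe_sort]
  refine Finset.sum_congr rfl fun i _ => ?_
  have hgi : ∀ i : S, MvPolynomial.X i = g i := fun i => by simp [hg]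
  rw [restrictNext_elim hS 1 MvPolynomial.X g hgi, hgi]

theorem prod_pow_restrictNext {s : Fin n → Option (Fin n)} {a : Fin n → ℕ} {S : Finset (Fin n)}
    (hS : ∀ i ∈ S, ∀ j, s i = some j → j ∈ S) {t : Fin n → ℂˣ} {c : ℂˣ}
    (ht : ∀ i, ∏ j, t j ^ atomMat s a i j = c) (i : S) :
    ∏ j : S, t j ^ atomMat (restrictNext s S) (fun i => a i) i j = c := by
  rw [prod_pow_atomMat (restrictNext s S) (fun i => a i) (fun j : S => t j), ← ht i,
    prod_pow_atomMat]
  congr 1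
  exact restrictNext_elim hS 1 _ t (fun _ => rfl) i

end Restriction

/-! ## The pairing of the state space on homogeneous elements -/

section StatePairing

variable {n : ℕ} (E : Matrix (Fin n) (Fin n) ℕ)

/-- The Chern character of a Koszul matrix factorization on a coordinate subspace. -/
noncomputable def chernOn (S : Finset (Fin n)) {r : ℕ}
    (αβ : Fin r → MvPolynomial (Fin n) ℂ × MvPolynomial (Fin n) ℂ) :
    FormSpace (restrictedPoly E S) :=
  Ideal.Quotient.mk _ ((koszulChern (fun k => restrictTo S (αβ k).1)
    (fun k => restrictTo S (αβ k).2) : MvPolynomial S ℂ) : MvPowerSeries S ℂ)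

open Classical in
theorem statePairing_lof_of_ne {γ γ' : symGroup E} (h : γ' ≠ γ⁻¹) (x : sector E γ)
    (y : sector E γ') :
    statePairing E (DirectSum.lof ℂ _ (fun γ => sector E γ) γ x)
      (DirectSum.lof ℂ _ (fun γ => sector E γ) γ' y) = 0 := by
  rw [statePairing, DirectSum.toModule_lof, LinearMap.comp_apply, LinearMap.lcomp_apply,
    DirectSum.component.of, dif_neg h, map_zero]

open Classical in
theorem statePairing_lof {γ γ' : symGroup E} (h : γ' = γ⁻¹)
    (hf : fixedVars (γ' : Fin n → ℂˣ) = fixedVars (γ : Fin n → ℂˣ)) (x : sector E γ)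
    (y : sector E γ') :
    statePairing E (DirectSum.lof ℂ _ (fun γ => sector E γ) γ x)
      (DirectSum.lof ℂ _ (fun γ => sector E γ) γ' y) =
    canonicalPairing (restrictedPoly E (fixedVars (γ : Fin n → ℂˣ)))
      (restrictedPush E _ (zetaElt E) (zetaElt_mem E) x) (formCast E hf y) := by
  subst h
  rw [statePairing, DirectSum.toModule_lof, LinearMap.comp_apply, LinearMap.lcomp_apply,
    DirectSum.component.lof_self]
  rfl

theorem statePairing_eq_zero {γ γ' : symGroup E} (h : γ' ≠ γ⁻¹) {v v' : StateSpace E}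
    {x : FormSpace (restrictedPoly E (fixedVars (γ : Fin n → ℂˣ)))}
    {y : FormSpace (restrictedPoly E (fixedVars (γ' : Fin n → ℂˣ)))}
    (hv : IsSectorElt E v γ x) (hv' : IsSectorElt E v' γ' y) : statePairing E v v' = 0 := by
  obtain ⟨x, -, rfl⟩ := hv
  obtain ⟨y, -, rfl⟩ := hv'
  exact statePairing_lof_of_ne E h x y

theorem fixedVars_eq_of_eq_inv {γ γ' : symGroup E} (h : γ' = γ⁻¹) :
    fixedVars (γ' : Fin n → ℂˣ) = fixedVars (γ : Fin n → ℂˣ) := by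
  subst h
  exact fixedVars_inv _

theorem statePairing_eq {γ γ' : symGroup E} (h : γ' = γ⁻¹) {v v' : StateSpace E}
    {x : FormSpace (restrictedPoly E (fixedVars (γ : Fin n → ℂˣ)))}
    {y : FormSpace (restrictedPoly E (fixedVars (γ' : Fin n → ℂˣ)))}
    (hv : IsSectorElt E v γ x) (hv' : IsSectorElt E v' γ' y) : statePairing E v v' =
      canonicalPairing (restrictedPoly E (fixedVars (γ : Fin n → ℂˣ)))
        (restrictedPush E _ (zetaElt E) (zetaElt_mem E) x)
        (formCast E (fixedVars_eq_of_eq_inv E h) y) := by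
  obtain ⟨x, rfl, rfl⟩ := hv
  obtain ⟨y, rfl, rfl⟩ := hv'
  exact statePairing_lof E h _ x y

end StatePairing

/-! ## Alternating sets of indices -/

section Alternating

variable {σ : Type*} [Fintype σ] [DecidableEq σ] {s : σ → Option σ} {a : σ → ℕ}
  {w : MvPolynomial σ ℂ}

/-- The exponent vector with entries `aⱼ - 1` for `j ∈ T` and `0` otherwise. -/
def altVec (a : σ → ℕ) (T : Finset σ) : σ → ℕ := fun j => if j ∈ T then a j - 1 else 0

/-- The form with this monomial is a product of terms of the polynomial with the differentials
counted in. This gives its weight under every symmetry of the polynomial and under ζ. -/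
theorem altVec_add_one {σ : Type*} [DecidableEq σ] {s : σ → Option σ} {a : σ → ℕ} (hs : PartialInj s) (ha : ∀ i, 2 ≤ a i) {T : Finset σ}
    (hT : ∀ j, j ∉ T ↔ ∃ i ∈ T, s i = some j) (j : σ) :
    altVec a T j + 1 = ∑ i ∈ T, atomMat s a i j := by
  simp only [atomMat, altVec, Finset.sum_add_distrib, Finset.sum_ite_eq']
  by_cases hj : j ∈ T
  · have h1 : ∀ i ∈ T, s i ≠ some j := fun i hi h => (hT j).mpr ⟨i, hi, h⟩ hj
    rw [if_pos hj, if_pos hj, Finset.sum_eq_zero fun i hi => if_neg (h1 i hi)]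
    have := ha j
    omega
  · obtain ⟨i, hi, hij⟩ := (hT j).mp hj
    rw [if_neg hj, if_neg hj, Finset.sum_eq_single_of_mem i hi, if_pos hij]
    intro l _ hl
    exact if_neg fun h => hl (hs _ _ _ h hij)

/-- As in `cls_loop_square`, but for chains too: one factor xᵢ^aᵢ is rewritten for each i ∈ T. The
successors of T fill the complement, and second successors return to T except at an end of the
chain. -/
theorem cls_altVec_square (hw : w = atomPoly s a) (hs : PartialInj s) (ha : ∀ i, 2 ≤ a i)
    {T : Finset σ} (hT : ∀ j, j ∉ T ↔ ∃ i ∈ T, s i = some j) (hT' : ∀ i ∈ T, s i ≠ none)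
    {soc : σ → ℕ} (hsoc : IsSocle s a soc) :
    cls w (altVec a T) * cls w (altVec a T) = (∏ j ∈ Tᶜ, -(a j : ℂ)) • cls w soc := by
  have hex : ∀ i, ∃ k, i ∈ T → s i = some k := by
    intro i
    by_cases hi : i ∈ T
    · obtain ⟨k, hk⟩ := Option.ne_none_iff_exists'.mp (hT' i hi)
      exact ⟨k, fun _ => hk⟩
    · exact ⟨i, fun h => absurd h hi⟩
  choose k hk using hex
  have hknot : ∀ i ∈ T, k i ∉ T := fun i hi => (hT _).mpr ⟨i, hi, hk i hi⟩
  have e1 : ∀ j, (∃ i ∈ T, some (k i) = some j) ↔ j ∉ T := by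
    intro j
    rw [hT]
    exact exists_congr fun i => and_congr_right fun hi => by rw [hk i hi]
  have e2 : ∀ j ∈ T, (∃ i ∈ T, s (k i) = some j) ↔ ∃ i, s i = some j := by
    intro j hj
    constructor
    · rintro ⟨i, -, h⟩
      exact ⟨_, h⟩
    · rintro ⟨i, h⟩
      have hi : i ∉ T := fun hi => (hT j).mpr ⟨i, hi, h⟩ hj
      obtain ⟨l, hl, hli⟩ := (hT i).mp hi
      refine ⟨l, hl, ?_⟩
      have : k l = i := Option.some.inj ((hk l hl).symm.trans hli)
      rwa [this]
  have e3 : ∀ j ∉ T, ¬ ∃ i ∈ T, s (k i) = some j := by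
    rintro j hj ⟨i, hi, h⟩
    obtain ⟨l, hl, hlj⟩ := (hT j).mp hj
    have := hs _ _ _ h hlj
    exact hknot i hi (this ▸ hl)
  rw [← cls_add, cls_relations hw hs T k hk
    (fun j => (altVec a T + altVec a T) j - if j ∈ T then a j else 0) (altVec a T + altVec a T) soc]
  · congr 1
    refine Finset.prod_bij (fun i _ => k i) ?_ ?_ ?_ ?_
    · intro i hi
      exact Finset.mem_compl.mpr (hknot i hi)
    · intro i hi j hj h
      exact hs _ _ _ (hk i hi) ((hk j hj).trans (congrArg some h.symm))
    · intro j hj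
      obtain ⟨i, hi, h⟩ := (hT j).mp (Finset.mem_compl.mp hj)
      exact ⟨i, hi, Option.some.inj ((hk i hi).symm.trans h)⟩
    · intro i _
      rfl
  · intro j
    have := ha j
    simp only [altVec, Pi.add_apply]
    split_ifs <;> omega
  · intro j
    have h1 := hsoc j
    have h2 := ha j
    simp only [altVec, Pi.add_apply, e1]
    by_cases hj : j ∈ T
    · simp only [hj, if_true, not_true, if_false, e2 j hj]
      split_ifs at h1 ⊢ <;> omega
    · have h3 : ∃ i, s i = some j := by
        obtain ⟨i, -, h⟩ := (hT j).mp hj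
        exact ⟨i, h⟩
      simp only [hj, if_false, not_false_iff, if_true, e3 j hj, h3] at h1 ⊢
      omega

theorem cls_altVec_mul_compl (w : MvPolynomial σ ℂ) (a : σ → ℕ) (T : Finset σ) :
    cls w (altVec a T) * cls w (altVec a Tᶜ) = cls w fun i => a i - 1 := by
  rw [← cls_add]
  congr 1
  funext j
  by_cases hj : j ∈ T <;> simp [altVec, hj]

theorem canonicalPairing_apply (w : MvPolynomial σ ℂ) (x y : FormSpace w) :
    canonicalPairing w x y = (-1) ^ (Fintype.card σ).choose 2 * milnorResidue w (x * y) := rfl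

end Alternating

/-- The binomial coefficient is r(2r - 1), which has the parity of r. -/
theorem neg_one_pow_choose (r : ℕ) : (-1 : ℂ) ^ (r * 2).choose 2 = (-1) ^ r := by
  rw [Nat.choose_two_right, mul_comm r 2, mul_assoc, Nat.mul_div_cancel_left _ two_pos]
  rcases r with _ | r
  · simp
  · rw [show 2 * (r + 1) - 1 = 2 * r + 1 by omega,
      show (r + 1) * (2 * r + 1) = 2 * ((r + 1) * r) + (r + 1) by ring, pow_add, pow_mul]
    simp

/-! ## Chern characters of Koszul matrix factorizations formed along a chain or a loop -/

section KoszulDet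

variable {σ : Type*} {r : ℕ}

/-- The first component of the pair attached to `t`. -/
noncomputable def pairFst (u : Fin r × Fin 2 ≃ σ) (nx : Fin r → Option (Fin r)) (a : σ → ℕ)
    (t : Fin r) : MvPolynomial σ ℂ :=
  -(MvPolynomial.X (u (t, 0)) ^ a (u (t, 0)) + MvPolynomial.X (u (t, 1)) ^ (a (u (t, 1)) - 1) *
    (nx t).elim 1 fun t' => MvPolynomial.X (u (t', 0)))

/-- The second component of the pair attached to `t`. -/
noncomputable def pairSnd (u : Fin r × Fin 2 ≃ σ) (t : Fin r) : MvPolynomial σ ℂ :=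
  MvPolynomial.X (u (t, 1))

/-- The bidiagonal matrix of partial derivatives of the first components with respect to the
variables in the even positions. -/
noncomputable def evenMatrix (u : Fin r × Fin 2 ≃ σ) (nx : Fin r → Option (Fin r)) (a : σ → ℕ) :
    Matrix (Fin r) (Fin r) (MvPolynomial σ ℂ) := Matrix.of fun t s =>
  (if t = s then -((a (u (t, 0)) : MvPolynomial σ ℂ) *
    MvPolynomial.X (u (t, 0)) ^ (a (u (t, 0)) - 1)) else 0) +
  if nx t = some s then -MvPolynomial.X (u (t, 1)) ^ (a (u (t, 1)) - 1) else 0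

variable (u : Fin r × Fin 2 ≃ σ) (nx : Fin r → Option (Fin r)) (a : σ → ℕ)

theorem pderiv_pairFst [DecidableEq σ] (s t : Fin r) :
    MvPolynomial.pderiv (u (s, 0)) (pairFst u nx a t) = evenMatrix u nx a t s := by
  have h10 : ∀ t, u (t, 1) ≠ u (s, 0) := fun t h => by simpa using u.injective h
  have hX : ∀ t, MvPolynomial.pderiv (u (s, 0)) (MvPolynomial.X (u (t, 0)) : MvPolynomial σ ℂ) =
      if t = s then 1 else 0 := by
    intro t
    by_cases h : t = s
    · subst h; simp
    · rw [if_neg h, MvPolynomial.pderiv_X_of_ne]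
      intro h'
      exact h (by simpa using u.injective h')
  rw [pairFst, evenMatrix, Matrix.of_apply, map_neg, map_add, MvPolynomial.pderiv_mul,
    MvPolynomial.pderiv_pow, MvPolynomial.pderiv_pow, MvPolynomial.pderiv_X_of_ne (h10 t),
    mul_zero, zero_mul, zero_add, hX, neg_add]
  congr 1
  · split_ifs <;> simp
  · rcases nx t with _ | t'
    · simp
    · simp only [Option.elim_some, hX, Option.some.injEq]
      split_ifs <;> simp

theorem pderiv_pairSnd_zero (s t : Fin r) :
    MvPolynomial.pderiv (u (s, 0)) (pairSnd u t) = 0 :=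
  MvPolynomial.pderiv_X_of_ne fun h => by simpa using u.injective h

theorem pderiv_pairSnd_one [DecidableEq σ] (s t : Fin r) :
    MvPolynomial.pderiv (u (s, 1)) (pairSnd u t) = if s = t then 1 else 0 := by
  rw [pairSnd]
  by_cases h : s = t
  · subst h; simp
  · rw [if_neg h, MvPolynomial.pderiv_X_of_ne]
    intro h'
    exact h (by simpa using (u.injective h').symm)

/-- Pairs as elements of a disjoint union. -/
def prodTwoEquivSum (r : ℕ) : Fin r × Fin 2 ≃ Fin r ⊕ Fin r where
  toFun p := if p.2 = 0 then Sum.inl p.1 else Sum.inr p.1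
  invFun := Sum.elim (fun t => (t, 0)) fun t => (t, 1)
  left_inv := by
    rintro ⟨t, b⟩
    fin_cases b <;> simp
  right_inv := by
    rintro (t | t) <;> simp

/-- The second components are the variables u(t, 1) themselves, so the Jacobian matrix is block
triangular with an identity block. Only the derivatives of the first components by the variables
u(s, 0) remain. -/
theorem det_pairs [DecidableEq σ] : (Matrix.of fun i j : Fin r × Fin 2 => MvPolynomial.pderiv (u i)
    (if j.2 = 0 then pairFst u nx a j.1 else pairSnd u j.1)).det = (evenMatrix u nx a).det := by
  have h1 : (Matrix.of fun i j : Fin r × Fin 2 => MvPolynomial.pderiv (u i)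
      (if j.2 = 0 then pairFst u nx a j.1 else pairSnd u j.1)) =
      (Matrix.fromBlocks (evenMatrix u nx a).transpose 0
        (Matrix.of fun s t => MvPolynomial.pderiv (u (s, 1)) (pairFst u nx a t)) 1).submatrix
        (prodTwoEquivSum r) (prodTwoEquivSum r) := by
    ext1 ⟨s, b⟩ ⟨t, c⟩
    fin_cases b <;> fin_cases c
    · simp [prodTwoEquivSum, pderiv_pairFst]
    · simp [prodTwoEquivSum, pderiv_pairSnd_zero]
    · simp [prodTwoEquivSum]
    · simp [prodTwoEquivSum, pderiv_pairSnd_one, Matrix.one_apply]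
  rw [h1, Matrix.det_submatrix_equiv_self, Matrix.det_fromBlocks_zero₁₂, Matrix.det_one, mul_one,
    Matrix.det_transpose]

/-- The Chern character uses the variables in increasing order, whereas the block form needs the
order of the pairs; π compares the two. -/
theorem koszulChern_pairs {σ : Type*} [Fintype σ] [LinearOrder σ] (e : Fin (r * 2) ≃o σ)
    (π : Equiv.Perm (Fin (r * 2))) (nx : Fin r → Option (Fin r)) (a : σ → ℕ)
    (u : Fin r × Fin 2 ≃ σ) (hu : ∀ p, u p = e (π (finProdFinEquiv p))) :
    koszulChern (pairFst u nx a) (pairSnd u) =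
      (Equiv.Perm.sign π : ℤ) * (evenMatrix u nx a).det := by
  rw [koszulChern_eq_det e, ← det_pairs]
  set M : Matrix (Fin (r * 2)) (Fin (r * 2)) (MvPolynomial σ ℂ) :=
    Matrix.of fun i j => MvPolynomial.pderiv (e i) (if (finProdFinEquiv.symm j).2 = 0
      then pairFst u nx a (finProdFinEquiv.symm j).1 else pairSnd u (finProdFinEquiv.symm j).1)
    with hM
  have h1 : (Matrix.of fun i j : Fin r × Fin 2 => MvPolynomial.pderiv (u i)
      (if j.2 = 0 then pairFst u nx a j.1 else pairSnd u j.1)) =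
      (M.submatrix π id).submatrix finProdFinEquiv finProdFinEquiv := by
    ext1 i j
    simp only [hM, hu, Matrix.of_apply, Matrix.submatrix_apply, id, Equiv.symm_apply_apply]
  rw [h1, Matrix.det_submatrix_equiv_self, Matrix.det_permute, ← mul_assoc]
  have h2 : ((Equiv.Perm.sign π : ℤ) : MvPolynomial σ ℂ) * (Equiv.Perm.sign π : ℤ) = 1 := by
    rw [← Int.cast_mul, ← Units.val_mul, Int.units_mul_self]
    simp
  rw [h2, one_mul]

theorem det_evenMatrix_chain (hnx : ∀ t t', nx t = some t' → t < t') :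
    (evenMatrix u nx a).det = ∏ t, -((a (u (t, 0)) : MvPolynomial σ ℂ) *
      MvPolynomial.X (u (t, 0)) ^ (a (u (t, 0)) - 1)) := by
  rw [det_eq_prod_diag_of_rank _ (fun t : Fin r => (t : ℕ))]
  · refine Finset.prod_congr rfl fun t _ => ?_
    have : nx t ≠ some t := fun h => lt_irrefl _ (hnx _ _ h)
    simp [evenMatrix, this]
  · intro s t hst h
    simp only [evenMatrix, Matrix.of_apply, if_neg hst, zero_add] at h
    by_contra h'
    exact h (if_neg fun h'' => h' (hnx _ _ h''))

/-- In the cyclic determinant the r signs of the off-diagonal entries combine with the sign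
(-1)^(r-1) of the rotation to -1. -/
theorem det_evenMatrix_loop (hr : 0 < r) :
    (evenMatrix u (fun t => some (finRotate r t)) a).det =
      (∏ t, -((a (u (t, 0)) : MvPolynomial σ ℂ) *
        MvPolynomial.X (u (t, 0)) ^ (a (u (t, 0)) - 1))) -
      ∏ t, MvPolynomial.X (u (t, 1)) ^ (a (u (t, 1)) - 1) := by
  have : Nonempty (Fin r) := ⟨⟨0, hr⟩⟩
  have h1 := det_cyclic (hasOneOrbit_finRotate r) (fun t => -((a (u (t, 0)) : MvPolynomial σ ℂ) *
    MvPolynomial.X (u (t, 0)) ^ (a (u (t, 0)) - 1)))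
    (fun t => -MvPolynomial.X (u (t, 1)) ^ (a (u (t, 1)) - 1))
  have h2 : evenMatrix u (fun t => some (finRotate r t)) a = Matrix.of fun i j =>
      (if i = j then -((a (u (i, 0)) : MvPolynomial σ ℂ) *
        MvPolynomial.X (u (i, 0)) ^ (a (u (i, 0)) - 1)) else 0) +
      (if finRotate r i = j then -MvPolynomial.X (u (i, 1)) ^ (a (u (i, 1)) - 1) else 0) := by
    ext1 i j
    simp [evenMatrix]
  rw [h2, h1, sub_eq_add_neg]
  congr 1
  rw [Finset.prod_neg, Finset.card_univ, Fintype.card_fin]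
  obtain ⟨k, rfl⟩ : ∃ k, r = k + 1 := ⟨r - 1, by omega⟩
  rw [sign_finRotate]
  push_cast
  rw [← mul_assoc, ← pow_add, show k + (k + 1) = 2 * k + 1 by ring, pow_succ, pow_mul]
  simp

theorem mk_prod_zero [Fintype σ] [DecidableEq σ] (w : MvPolynomial σ ℂ) (T : Finset σ) (hT : ∀ p, u p ∈ T ↔ p.2 = 0) :
    Ideal.Quotient.mk (jacobianIdeal w)
      (((∏ t, -((a (u (t, 0)) : MvPolynomial σ ℂ) *
        MvPolynomial.X (u (t, 0)) ^ (a (u (t, 0)) - 1)) : MvPolynomial σ ℂ)) :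
        MvPowerSeries σ ℂ) = (∏ j ∈ T, -(a j : ℂ)) • cls w (altVec a T) := by
  have h1 : xpow (altVec a T) = ∏ t, (MvPowerSeries.X (u (t, 0)) : MvPowerSeries σ ℂ) ^
      (a (u (t, 0)) - 1) := by
    rw [xpow, ← u.prod_comp, Fintype.prod_prod_type]
    refine Finset.prod_congr rfl fun t _ => ?_
    simp [altVec, hT]
  have h2 : ∏ j ∈ T, -(a j : ℂ) = ∏ t, -(a (u (t, 0)) : ℂ) := by
    rw [← Finset.prod_ite_mem_eq, ← u.prod_comp, Fintype.prod_prod_type]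
    refine Finset.prod_congr rfl fun t _ => ?_
    simp [hT]
  have h3 : (((∏ t, -((a (u (t, 0)) : MvPolynomial σ ℂ) *
      MvPolynomial.X (u (t, 0)) ^ (a (u (t, 0)) - 1)) : MvPolynomial σ ℂ)) :
      MvPowerSeries σ ℂ) = (∏ t, -(a (u (t, 0)) : ℂ)) •
        ∏ t, (MvPowerSeries.X (u (t, 0)) : MvPowerSeries σ ℂ) ^ (a (u (t, 0)) - 1) := by
    rw [← MvPolynomial.coeToMvPowerSeries.ringHom_apply, map_prod, ← Finset.prod_smul]
    refine Finset.prod_congr rfl fun t _ => ?_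
    rw [map_neg, map_mul, map_natCast, map_pow, MvPolynomial.coeToMvPowerSeries.ringHom_apply,
      MvPolynomial.coe_X, neg_smul, Nat.cast_smul_eq_nsmul, nsmul_eq_mul]
  rw [cls, h1, h2, h3]
  rfl

theorem mk_prod_one [Fintype σ] [DecidableEq σ] (w : MvPolynomial σ ℂ) (T : Finset σ) (hT : ∀ p, u p ∈ T ↔ p.2 = 0) :
    Ideal.Quotient.mk (jacobianIdeal w)
      (((∏ t, MvPolynomial.X (u (t, 1)) ^ (a (u (t, 1)) - 1) : MvPolynomial σ ℂ)) :
        MvPowerSeries σ ℂ) = cls w (altVec a Tᶜ) := by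
  rw [cls, xpow, ← u.prod_comp, Fintype.prod_prod_type,
    ← MvPolynomial.coeToMvPowerSeries.ringHom_apply, map_prod]
  congr 1
  refine Finset.prod_congr rfl fun t _ => ?_
  simp [Fin.prod_univ_two, altVec, hT]

end KoszulDet

/-! ## Sectors of an atomic polynomial -/

section Enumeration

variable {σ : Type*} [Fintype σ] [DecidableEq σ] {r : ℕ}

theorem card_of_enum (u : Fin r × Fin 2 ≃ σ) {T : Finset σ} (hT : ∀ p, u p ∈ T ↔ p.2 = 0) :
    T.card = r := by
  rw [Finset.card_eq_sum_ones, ← Finset.sum_ite_mem_eq, ← u.sum_comp, Fintype.sum_prod_type]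
  simp [hT]

/-- The sign (-1)^binom(2r,2) = (-1)^r of the canonical form cancels the factor by which ζ acts on
the Chern characters. -/
theorem canonicalPairing_push (w : MvPolynomial σ ℂ) (hcard : Fintype.card σ = r * 2)
    {f : FormSpace w → FormSpace w} {x : FormSpace w} (hx : f x = ((-1 : ℂ) ^ r)⁻¹ • x)
    (y : FormSpace w) : canonicalPairing w (f x) y = milnorResidue w (x * y) := by
  rw [canonicalPairing_apply, hx, hcard, neg_one_pow_choose, smul_mul_assoc, map_smul, smul_eq_mul,
    ← mul_assoc, mul_inv_cancel₀ (pow_ne_zero _ (by norm_num)), one_mul]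

end Enumeration

/-! ### Weights of alternating monomials on fixed subspaces -/

section Sector

variable (τ : AtomicType) {n : ℕ} {a : Fin n → ℕ}

theorem restrictedPoly_eq (ha : ∀ i, 2 ≤ a i) {S : Finset (Fin n)}
    (hS : ∀ i ∈ S, ∀ j, nextOf τ n i = some j → j ∈ S) :
    restrictedPoly (exponentMatrix τ a) S =
      atomPoly (restrictNext (nextOf τ n) S) fun i => a i := by
  rw [exponentMatrix_eq]
  exact restrictedPoly_atomMat _ ha hS

/-- With c = 1 this gives invariance under G_w, so the Chern characters lie in their sectors; with c
= -1 it gives the action of ζ. -/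
theorem restrictedPush_altVec (ha : ∀ i, 2 ≤ a i) {S : Finset (Fin n)}
    (hS : ∀ i ∈ S, ∀ j, nextOf τ n i = some j → j ∈ S) {T : Finset S}
    (hT : ∀ j, j ∉ T ↔ ∃ i ∈ T, restrictNext (nextOf τ n) S i = some j)
    {t : Fin n → ℂˣ} (ht : t ∈ scalingGroup (polyOf (exponentMatrix τ a))) {c : ℂˣ}
    (hc : ∀ i, ∏ j, t j ^ exponentMatrix τ a i j = c) :
    restrictedPush (exponentMatrix τ a) S t ht (cls _ (altVec (fun i : S => a i) T)) =
      ((c : ℂ) ^ T.card)⁻¹ • cls _ (altVec (fun i : S => a i) T) := by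
  rw [exponentMatrix_eq] at hc
  exact pushForward_cls_of_rows _ _ _ _ c (prod_pow_restrictNext hS hc) T _
    (altVec_add_one ((partialInj_nextOf τ n).restrictNext S) (fun i => ha i) hT)

theorem restrictedPush_zeta_altVec (ha : ∀ i, 2 ≤ a i) {S : Finset (Fin n)}
    (hS : ∀ i ∈ S, ∀ j, nextOf τ n i = some j → j ∈ S) {T : Finset S}
    (hT : ∀ j, j ∉ T ↔ ∃ i ∈ T, restrictNext (nextOf τ n) S i = some j) :
    restrictedPush (exponentMatrix τ a) S (zetaElt _) (zetaElt_mem _)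
      (cls _ (altVec (fun i : S => a i) T)) =
      ((-1 : ℂ) ^ T.card)⁻¹ • cls _ (altVec (fun i : S => a i) T) := by
  have := restrictedPush_altVec τ ha hS hT (zetaElt_mem _)
    (prod_zetaElt_pow_row _ (det_exponentMatrix_ne_zero τ a ha))
  simpa using this

theorem restrictedPush_sym_altVec (ha : ∀ i, 2 ≤ a i) {S : Finset (Fin n)}
    (hS : ∀ i ∈ S, ∀ j, nextOf τ n i = some j → j ∈ S) {T : Finset S}
    (hT : ∀ j, j ∉ T ↔ ∃ i ∈ T, restrictNext (nextOf τ n) S i = some j)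
    {g : Fin n → ℂˣ} (hg : g ∈ symGroup (exponentMatrix τ a)) :
    restrictedPush (exponentMatrix τ a) S g (symmetryGroup_le _ hg)
      (cls _ (altVec (fun i : S => a i) T)) = cls _ (altVec (fun i : S => a i) T) := by
  have := restrictedPush_altVec τ ha hS hT (symmetryGroup_le _ hg) (prod_pow_row_eq_one _ hg)
  simpa using this

end Sector

/-! ### Sectors without fixed variables -/

section Narrow

variable (τ : AtomicType) {n : ℕ} {a : Fin n → ℕ}

theorem restrictedPush_one_of_empty (E : Matrix (Fin n) (Fin n) ℕ) {S : Finset (Fin n)}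
    (hS : S = ∅) {t : Fin n → ℂˣ} (ht : t ∈ scalingGroup (polyOf E)) :
    restrictedPush E S t ht 1 = 1 := by
  subst hS
  have := pushForward_cls (restrictedPoly E ∅) (fun i => t i) (restrict_mem E ht ∅) 0
  rw [cls_zero] at this
  rw [restrictedPush, this]
  simp

/-- In zero variables the socle is 1 and the chain formula for its residue is an empty product. -/
theorem milnorResidue_one_of_empty (ha : ∀ i, 2 ≤ a i) {S : Finset (Fin n)} (hS : S = ∅) :
    milnorResidue (restrictedPoly (exponentMatrix τ a) S) 1 = 1 := by
  subst hS
  rw [← cls_zero, milnorResidue_congr (restrictedPoly_eq τ ha (by simp))]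
  have := residue_socle_chain ((partialInj_nextOf τ n).restrictNext ∅) 
    (a := fun i : (∅ : Finset (Fin n)) => a i)
    (fun i => ha i) (fun _ => 0) (fun i => absurd i.2 (Finset.notMem_empty _)) (soc := 0)
    (fun i => absurd i.2 (Finset.notMem_empty _))
  refine Eq.trans this ?_
  simp

theorem canonicalPairing_one_of_empty (ha : ∀ i, 2 ≤ a i) {S : Finset (Fin n)} (hS : S = ∅) :
    canonicalPairing (restrictedPoly (exponentMatrix τ a) S)
      (restrictedPush (exponentMatrix τ a) S (zetaElt _) (zetaElt_mem _) 1) 1 = 1 := by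
  rw [restrictedPush_one_of_empty _ hS, canonicalPairing_apply, mul_one,
    milnorResidue_one_of_empty τ ha hS]
  simp [hS]

end Narrow

/-! ### Sectors of a chain -/

section Chain

variable {n : ℕ} {a : Fin n → ℕ} {k : ℕ} {S : Finset (Fin n)}

theorem chain_closed (hS : ∀ i, i ∈ S ↔ n ≤ (i : ℕ) + 2 * k) :
    ∀ i ∈ S, ∀ j, nextOf .chain n i = some j → j ∈ S := by
  intro i hi j hij
  rw [hS] at hi ⊢
  simp only [nextOf, Option.dite_none_right_eq_some, Option.some.injEq, Fin.ext_iff] at hij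
  obtain ⟨h, h'⟩ := hij
  omega

/-- The increasing enumeration of the last `2k` indices. -/
def chainOrderIso (hk : 2 * k ≤ n) (hS : ∀ i, i ∈ S ↔ n ≤ (i : ℕ) + 2 * k) :
    Fin (k * 2) ≃o S where
  toFun i := ⟨⟨n - 2 * k + i, by omega⟩, (hS _).mpr (by simp only; omega)⟩
  invFun j := ⟨j - (n - 2 * k), by have := (hS j).mp j.2; have := j.1.2; omega⟩
  left_inv i := Fin.ext (by simp)
  right_inv j := by
    have := (hS j).mp j.2
    refine Subtype.ext (Fin.ext ?_)
    simp only
    omega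
  map_rel_iff' := by
    intro i j
    simp

/-- The enumeration of the last `2k` indices by pairs. -/
def chainEnum (hk : 2 * k ≤ n) (hS : ∀ i, i ∈ S ↔ n ≤ (i : ℕ) + 2 * k) : Fin k × Fin 2 ≃ S :=
  finProdFinEquiv.trans (chainOrderIso hk hS).toEquiv

theorem chainEnum_val (hk : 2 * k ≤ n) (hS : ∀ i, i ∈ S ↔ n ≤ (i : ℕ) + 2 * k)
    (p : Fin k × Fin 2) : ((chainEnum hk hS p : Fin n) : ℕ) = n - 2 * k + (2 * p.1 + p.2) := by
  simp [chainEnum, chainOrderIso, finProdFinEquiv]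
  ring

/-- The indices `n - 2k, n - 2k + 2, …` as elements of `S`. -/
def evenPart (S : Finset (Fin n)) : Finset S := Finset.univ.filter fun i => Even (n - (i : ℕ))

theorem chainEnum_mem (hk : 2 * k ≤ n) (hS : ∀ i, i ∈ S ↔ n ≤ (i : ℕ) + 2 * k)
    (p : Fin k × Fin 2) : chainEnum hk hS p ∈ evenPart S ↔ p.2 = 0 := by
  have h1 := p.1.2
  have h2 := p.2.2
  simp only [evenPart, Finset.mem_filter, Finset.mem_univ, true_and, chainEnum_val, Nat.even_iff,
    Fin.ext_iff, Fin.val_zero]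
  omega

theorem evenPart_alternating (hS : ∀ i, i ∈ S ↔ n ≤ (i : ℕ) + 2 * k) (hk : 2 * k ≤ n) (j : S) :
    j ∉ evenPart S ↔ ∃ i ∈ evenPart S, restrictNext (nextOf .chain n) S i = some j := by
  simp only [evenPart, Finset.mem_filter, Finset.mem_univ, true_and, restrictNext_eq_some_iff,
    nextOf, Option.dite_none_right_eq_some, Option.some.injEq, Fin.ext_iff, Nat.even_iff]
  have hj := (hS j).mp j.2
  have hjn := j.1.2
  constructor
  · intro h
    refine ⟨⟨⟨j - 1, by omega⟩, (hS _).mpr (by simp only; omega)⟩, by simp only; omega, ?_⟩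
    exact ⟨by simp only; omega, by simp only; omega⟩
  · rintro ⟨i, hi, h, h'⟩
    omega

theorem restrictTo_extVar_chain (i : S) :
    restrictTo S (extVar .chain (i : ℕ)) = MvPolynomial.X i := by
  simp [extVar, restrictTo]

theorem extExp_val (i : Fin n) : extExp a (i : ℕ) = a i := by
  rw [extExp, dif_pos i.pos]
  congr 1
  exact Fin.ext (Nat.mod_eq_of_lt i.2)

/-- The variable beyond the last one is 1, which corresponds to `nextOf` being undefined at the last
pair. -/
theorem restrictTo_koszulPair_chain (hk : 2 * k ≤ n)
    (hS : ∀ i, i ∈ S ↔ n ≤ (i : ℕ) + 2 * k) (t : Fin k) :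
    restrictTo S (koszulPair .chain a (n - 2 * k + 2 * t)).1 =
      pairFst (chainEnum hk hS) (nextOf .chain k) (fun i : S => a i) t ∧
    restrictTo S (koszulPair .chain a (n - 2 * k + 2 * t)).2 =
      pairSnd (chainEnum hk hS) t := by
  have h0 : n - 2 * k + 2 * t = ((chainEnum hk hS (t, 0) : Fin n) : ℕ) := by
    rw [chainEnum_val]; simp
  have h1 : n - 2 * k + 2 * t + 1 = ((chainEnum hk hS (t, 1) : Fin n) : ℕ) := by
    rw [chainEnum_val]; simp [add_assoc]
  have h2 : restrictTo S (extVar .chain (n - 2 * k + 2 * t + 2)) =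
      (nextOf .chain k t).elim 1 fun t' => MvPolynomial.X (chainEnum hk hS (t', 0)) := by
    by_cases h : (t : ℕ) + 1 < k
    · have h3 : n - 2 * k + 2 * t + 2 = ((chainEnum hk hS (⟨t + 1, h⟩, 0) : Fin n) : ℕ) := by
        rw [chainEnum_val]; simp; ring
      rw [h3, restrictTo_extVar_chain]
      simp [nextOf, h]
    · have h3 : ¬ n - 2 * k + 2 * t + 2 < n := by omega
      simp [nextOf, h, extVar, h3]
  constructor
  · simp only [koszulPair, map_neg, map_add, map_mul, map_pow, pairFst, h2, h1]
    rw [restrictTo_extVar_chain, h0, restrictTo_extVar_chain, extExp_val, extExp_val]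
  · simp only [koszulPair, pairSnd, h1]
    rw [restrictTo_extVar_chain]

/-- The reduced Jacobian matrix is triangular, so only its diagonal contributes. The pairs follow
the order of the variables, so there is no sign. -/
theorem chernOn_chain (hk : 2 * k ≤ n) (hS : ∀ i, i ∈ S ↔ n ≤ (i : ℕ) + 2 * k) :
    chernOn (exponentMatrix .chain a) S
      (fun t : Fin k => koszulPair .chain a (n - 2 * k + 2 * t)) =
      (∏ j ∈ evenPart S, -(a j : ℂ)) • cls _ (altVec (fun i : S => a i) (evenPart S)) := by
  have h1 := koszulChern_pairs (chainOrderIso hk hS) 1 (nextOf .chain k) (fun i : S => a i)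
    (chainEnum hk hS) (fun p => rfl)
  rw [det_evenMatrix_chain _ _ _ (fun t t' h => by
    simp only [nextOf, Option.dite_none_right_eq_some, Option.some.injEq, Fin.ext_iff] at h
    rw [Fin.lt_def]
    omega)] at h1
  simp only [Equiv.Perm.sign_one, Units.val_one, Int.cast_one, one_mul] at h1
  have h2 := mk_prod_zero (chainEnum hk hS) (fun i : S => a i)
    (restrictedPoly (exponentMatrix .chain a) S) (evenPart S) (chainEnum_mem hk hS)
  rw [← h2, ← h1]
  simp only [chernOn, fun t => (restrictTo_koszulPair_chain (a := a) hk hS t).1,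
    fun t => (restrictTo_koszulPair_chain (a := a) hk hS t).2]

theorem chernOn_chain_mem (ha : ∀ i, 2 ≤ a i) (hk : 2 * k ≤ n)
    (hS : ∀ i, i ∈ S ↔ n ≤ (i : ℕ) + 2 * k) {g : Fin n → ℂˣ}
    (hg : g ∈ symGroup (exponentMatrix .chain a)) :
    restrictedPush (exponentMatrix .chain a) S g (symmetryGroup_le _ hg)
      (chernOn (exponentMatrix .chain a) S
        (fun t : Fin k => koszulPair .chain a (n - 2 * k + 2 * t))) =
      chernOn (exponentMatrix .chain a) S
        (fun t : Fin k => koszulPair .chain a (n - 2 * k + 2 * t)) := by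
  rw [chernOn_chain hk hS, map_smul, restrictedPush_sym_altVec .chain ha (chain_closed hS)
    (evenPart_alternating hS hk) hg]

/-- Let c and d be the products of -aⱼ over the even part of the tail and over its complement. The
square of the Chern character is c²d times the socle monomial, whose residue is 1/(cd). -/
theorem canonicalPairing_chern_chain (ha : ∀ i, 2 ≤ a i) (hk : 2 * k ≤ n)
    (hS : ∀ i, i ∈ S ↔ n ≤ (i : ℕ) + 2 * k) :
    canonicalPairing (restrictedPoly (exponentMatrix .chain a) S)
      (restrictedPush (exponentMatrix .chain a) S (zetaElt _) (zetaElt_mem _)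
        (chernOn (exponentMatrix .chain a) S
          (fun t : Fin k => koszulPair .chain a (n - 2 * k + 2 * t))))
      (chernOn (exponentMatrix .chain a) S
        (fun t : Fin k => koszulPair .chain a (n - 2 * k + 2 * t))) =
      ∏ i ∈ chainTail n k, -(a i : ℂ) := by
  have hcard : Fintype.card S = k * 2 := by
    rw [← Fintype.card_congr (chainOrderIso hk hS).toEquiv, Fintype.card_fin]
  have hpush := restrictedPush_zeta_altVec .chain ha (chain_closed hS) (evenPart_alternating hS hk)
  rw [card_of_enum (chainEnum hk hS) (chainEnum_mem hk hS)] at hpush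
  set soc : S → ℕ := fun j =>
    (a j - 1) + (if ∃ i, restrictNext (nextOf .chain n) S i = some j then 1 else 0) - 1 with hsoc
  have hsoc' : IsSocle (restrictNext (nextOf .chain n) S) (fun i : S => a i) soc := by
    intro j
    have := ha j
    simp only [hsoc]
    split_ifs <;> omega
  have hw := restrictedPoly_eq .chain ha (chain_closed hS)
  have hsq := cls_altVec_square hw ((partialInj_nextOf .chain n).restrictNext S) (fun i => ha i)
    (evenPart_alternating hS hk) (fun i hi => by
      have h1 := (hS i).mp i.2
      have h2 := i.1.2
      simp only [evenPart, Finset.mem_filter, Finset.mem_univ, true_and, Nat.even_iff] at hi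
      rw [Ne, ← Option.isNone_iff_eq_none, Bool.not_eq_true, Option.isNone_eq_false_iff,
        Option.isSome_iff_exists]
      refine ⟨⟨⟨i + 1, by omega⟩, (hS _).mpr (by simp only; omega)⟩, ?_⟩
      rw [restrictNext_eq_some_iff]
      simp only [nextOf]
      rw [dif_pos (by omega)]) hsoc'
  have hres : milnorResidue (restrictedPoly (exponentMatrix .chain a) S) (cls _ soc) =
      (∏ i : S, (a i : ℂ))⁻¹ := by
    rw [milnorResidue_congr hw]
    refine residue_socle_chain ((partialInj_nextOf .chain n).restrictNext S) (fun i => ha i)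
      (fun i => (i : ℕ)) ?_ hsoc'
    intro i j h
    rw [restrictNext_eq_some_iff] at h
    simp only [nextOf, Option.dite_none_right_eq_some, Option.some.injEq, Fin.ext_iff] at h
    obtain ⟨_, h⟩ := h
    omega
  set c := ∏ j ∈ evenPart S, -(a j : ℂ) with hc
  have hc0 : c ≠ 0 := Finset.prod_ne_zero_iff.mpr fun i _ => by
    have := ha i
    exact neg_ne_zero.mpr (by exact_mod_cast (by omega : a i ≠ 0))
  have hd0 : ∏ j ∈ (evenPart S)ᶜ, -(a j : ℂ) ≠ 0 := Finset.prod_ne_zero_iff.mpr fun i _ => by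
    have := ha i
    exact neg_ne_zero.mpr (by exact_mod_cast (by omega : a i ≠ 0))
  -- The set S has 2k elements, so the signs cancel.
  have hall : ∏ i : S, (a i : ℂ) = c * ∏ j ∈ (evenPart S)ᶜ, -(a j : ℂ) := by
    rw [hc, Finset.prod_mul_prod_compl, Finset.prod_neg, Finset.card_univ, hcard, mul_comm k,
      pow_mul]
    simp
  rw [chernOn_chain hk hS, ← hc, canonicalPairing_push _ hcard (x := c • _)
    (by rw [map_smul, hpush, smul_comm]), smul_mul_smul_comm, hsq, map_smul, map_smul, hres, hall,
    smul_eq_mul, smul_eq_mul]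
  have hfin : c = ∏ i ∈ chainTail n k, -(a i : ℂ) := by
    rw [hc]
    refine Finset.prod_bij (fun i _ => (i : Fin n)) ?_ ?_ ?_ ?_
    · intro i hi
      simp only [evenPart, chainTail, Finset.mem_filter, Finset.mem_univ, true_and] at hi ⊢
      exact ⟨(hS i).mp i.2, hi⟩
    · intro i _ j _ h
      exact Subtype.ext h
    · intro i hi
      simp only [chainTail, Finset.mem_filter, Finset.mem_univ, true_and] at hi
      exact ⟨⟨i, (hS i).mpr hi.1⟩, by simpa [evenPart] using hi.2, rfl⟩
    · intro i _
      rfl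
  rw [← hfin]
  field_simp

end Chain

/-! ### The untwisted sector of a loop -/

section Loop

variable {n : ℕ} {a : Fin n → ℕ} {S : Finset (Fin n)}

/-- The successor of an index, for a set `S` of indices that contains all of them. -/
def loopPerm (hS : ∀ i, i ∈ S) : Equiv.Perm S :=
  (Equiv.subtypeUnivEquiv hS).symm.permCongr (finRotate n)

theorem loopPerm_val (hS : ∀ i, i ∈ S) (i : S) : (loopPerm hS i : Fin n) = finRotate n i := rfl

theorem restrictNext_loop (hS : ∀ i, i ∈ S) :
    restrictNext (nextOf .loop n) S = fun i => some (loopPerm hS i) := by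
  funext i
  rw [restrictNext_eq_some_iff]
  rfl

theorem hasOneOrbit_loopPerm (hS : ∀ i, i ∈ S) : HasOneOrbit (loopPerm hS) := by
  intro T hne hT
  have h1 := hasOneOrbit_finRotate n (T.map (Function.Embedding.subtype _)) (hne.map) (by
    intro i hi
    obtain ⟨j, hj, rfl⟩ := Finset.mem_map.mp hi
    exact Finset.mem_map.mpr ⟨_, hT j hj, rfl⟩)
  refine Finset.eq_univ_iff_forall.mpr fun i => ?_
  have h2 : (i : Fin n) ∈ T.map (Function.Embedding.subtype _) := h1 ▸ Finset.mem_univ _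
  obtain ⟨j, hj, hji⟩ := Finset.mem_map.mp h2
  have : j = i := Subtype.ext hji
  rwa [← this]

theorem card_of_forall_mem (hS : ∀ i, i ∈ S) : Fintype.card S = n := by
  rw [Fintype.card_congr (Equiv.subtypeUnivEquiv hS), Fintype.card_fin]

theorem milnorResidue_socle_loop (hn : 0 < n) (ha : ∀ i, 2 ≤ a i) (hS : ∀ i, i ∈ S) :
    milnorResidue (restrictedPoly (exponentMatrix .loop a) S) (cls _ fun i => a i - 1) =
      (∏ i : S, (a i : ℂ) - (-1) ^ n)⁻¹ := by
  have : Nonempty S := ⟨⟨⟨0, hn⟩, hS _⟩⟩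
  have h1 := residue_socle_loop (hasOneOrbit_loopPerm hS) (by
    rw [loopPerm, Equiv.Perm.sign_permCongr, card_of_forall_mem hS]
    exact sign_finRotate_eq hn) (a := fun i : S => a i) (fun i => ha i)
  rw [milnorResidue_congr (restrictedPoly_eq .loop ha (fun _ _ j _ => hS j)), restrictNext_loop hS]
  rw [card_of_forall_mem hS] at h1
  exact h1

/-- The increasing enumeration of all indices. -/
def loopOrderIso (hev : n / 2 * 2 = n) (hS : ∀ i, i ∈ S) : Fin (n / 2 * 2) ≃o S where
  toFun i := ⟨Fin.cast hev i, hS _⟩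
  invFun j := Fin.cast hev.symm j
  left_inv _ := rfl
  right_inv _ := rfl
  map_rel_iff' := Iff.rfl

/-- The enumerations of all indices by pairs, starting with the first or the second index. -/
def loopEnum (hev : n / 2 * 2 = n) (hS : ∀ i, i ∈ S) (π : Equiv.Perm (Fin (n / 2 * 2))) :
    Fin (n / 2) × Fin 2 ≃ S :=
  finProdFinEquiv.trans (π.trans (loopOrderIso hev hS).toEquiv)

/-- The indices with odd position. -/
def oddPart (S : Finset (Fin n)) : Finset S := Finset.univ.filter fun i => Even (i : ℕ)

theorem mem_oddPart (i : S) : i ∈ oddPart S ↔ Even (i : ℕ) := by simp [oddPart]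

theorem oddPart_alternating (hev : Even n) (hS : ∀ i, i ∈ S) (j : S) :
    j ∉ oddPart S ↔ ∃ i ∈ oddPart S, restrictNext (nextOf .loop n) S i = some j := by
  simp only [restrictNext_loop hS, Option.some.injEq, mem_oddPart]
  constructor
  · intro h
    refine ⟨(loopPerm hS).symm j, ?_, Equiv.apply_symm_apply _ _⟩
    have h1 := even_finRotate_iff hev ((loopPerm hS).symm j)
    rw [← loopPerm_val hS, Equiv.apply_symm_apply] at h1
    tauto
  · rintro ⟨i, hi, rfl⟩
    rw [loopPerm_val, even_finRotate_iff hev]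
    simpa using hi

theorem oddPart_compl_alternating (hev : Even n) (hS : ∀ i, i ∈ S) (j : S) :
    j ∉ (oddPart S)ᶜ ↔ ∃ i ∈ (oddPart S)ᶜ, restrictNext (nextOf .loop n) S i = some j := by
  simp only [restrictNext_loop hS, Option.some.injEq, Finset.mem_compl, mem_oddPart, not_not]
  constructor
  · intro h
    refine ⟨(loopPerm hS).symm j, ?_, Equiv.apply_symm_apply _ _⟩
    have h1 := even_finRotate_iff hev ((loopPerm hS).symm j)
    rw [← loopPerm_val hS, Equiv.apply_symm_apply] at h1
    tauto
  · rintro ⟨i, hi, rfl⟩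
    rwa [loopPerm_val, even_finRotate_iff hev]

theorem loopEnum_one_val (hev : n / 2 * 2 = n) (hS : ∀ i, i ∈ S) (p : Fin (n / 2) × Fin 2) :
    ((loopEnum hev hS 1 p : Fin n) : ℕ) = (2 * p.1 + p.2 + 0) % n := by
  have h1 := p.1.2
  have h2 := p.2.2
  rw [Nat.mod_eq_of_lt (by omega)]
  simp [loopEnum, loopOrderIso, finProdFinEquiv]
  ring

theorem loopEnum_finRotate_val (hev : n / 2 * 2 = n) (hS : ∀ i, i ∈ S)
    (p : Fin (n / 2) × Fin 2) :
    ((loopEnum hev hS (finRotate _) p : Fin n) : ℕ) = (2 * p.1 + p.2 + 1) % n := by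
  have h1 : ((loopEnum hev hS (finRotate _) p : Fin n) : ℕ) =
      (finRotate (n / 2 * 2) (finProdFinEquiv p) : ℕ) := rfl
  have h2 : (finProdFinEquiv p : ℕ) = 2 * p.1 + p.2 := by
    simp [finProdFinEquiv]
    ring
  rw [h1, finRotate_val, h2, hev]

theorem restrictTo_extVar_loop (j : ℕ) (i : S) (h : (i : ℕ) = j % n) :
    restrictTo S (extVar .loop j) = MvPolynomial.X i := by
  have hn : 0 < n := i.1.pos
  have h1 : (⟨j % n, Nat.mod_lt j hn⟩ : Fin n) = i := Fin.ext h.symm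
  simp only [extVar, hn, dif_pos, h1]
  simp [restrictTo]

theorem extExp_eq (j : ℕ) (i : Fin n) (h : (i : ℕ) = j % n) : extExp a j = a i := by
  rw [extExp, dif_pos i.pos]
  congr 1
  exact Fin.ext h.symm

/-- The shift c is 0 or 1 in the applications. It distinguishes the two ways of grouping the loop
into neighbouring pairs. -/
theorem restrictTo_koszulPair_loop (hev : n / 2 * 2 = n) (u : Fin (n / 2) × Fin 2 ≃ S) (c : ℕ)
    (hu : ∀ p, ((u p : Fin n) : ℕ) = (2 * p.1 + p.2 + c) % n) (t : Fin (n / 2)) :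
    restrictTo S (koszulPair .loop a (2 * t + c)).1 =
      pairFst u (fun t => some (finRotate (n / 2) t)) (fun i : S => a i) t ∧
    restrictTo S (koszulPair .loop a (2 * t + c)).2 = pairSnd u t := by
  have h0 : ((u (t, 0) : Fin n) : ℕ) = (2 * t + c) % n := by
    rw [hu]; simp
  have h1 : ((u (t, 1) : Fin n) : ℕ) = (2 * t + c + 1) % n := by
    rw [hu]
    congr 1
    simp only [Fin.val_one]
    ring
  have h2 : ((u (finRotate (n / 2) t, 0) : Fin n) : ℕ) = (2 * t + c + 2) % n := by
    rw [hu, finRotate_val]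
    simp only [Fin.val_zero, add_zero]
    have h3 : 2 * (((t : ℕ) + 1) % (n / 2)) = (2 * (t + 1)) % n := by
      rw [← Nat.mul_mod_mul_left, mul_comm 2 (n / 2), hev]
    rw [h3, Nat.mod_add_mod]
    congr 1
    ring
  constructor
  · simp only [koszulPair, map_neg, map_add, map_mul, map_pow, pairFst, Option.elim_some]
    rw [restrictTo_extVar_loop _ _ h0, restrictTo_extVar_loop _ _ h1, restrictTo_extVar_loop _ _ h2,
      extExp_eq _ _ h0, extExp_eq _ _ h1]
  · simp only [koszulPair, pairSnd]
    rw [restrictTo_extVar_loop _ _ h1]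

/-- The two summands are the diagonal and the cyclic contribution of the reduced determinant; they
are supported on the two alternating halves of the loop. -/
theorem chernOn_loop (hn : 0 < n) (hev : n / 2 * 2 = n) (hS : ∀ i, i ∈ S) (c : ℕ)
    (π : Equiv.Perm (Fin (n / 2 * 2)))
    (hu : ∀ p, ((loopEnum hev hS π p : Fin n) : ℕ) = (2 * p.1 + p.2 + c) % n) (T : Finset S)
    (hT : ∀ p, loopEnum hev hS π p ∈ T ↔ p.2 = 0) :
    chernOn (exponentMatrix .loop a) S
      (fun t : Fin (n / 2) => koszulPair .loop a (2 * t + c)) =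
      ((Equiv.Perm.sign π : ℤ) : ℂ) • ((∏ j ∈ T, -(a j : ℂ)) •
        cls _ (altVec (fun i : S => a i) T) - cls _ (altVec (fun i : S => a i) Tᶜ)) := by
  have h1 := koszulChern_pairs (loopOrderIso hev hS) π (fun t => some (finRotate (n / 2) t))
    (fun i : S => a i) (loopEnum hev hS π) (fun p => rfl)
  rw [det_evenMatrix_loop _ _ (by omega)] at h1
  have h2 := mk_prod_zero (loopEnum hev hS π) (fun i : S => a i)
    (restrictedPoly (exponentMatrix .loop a) S) T hT
  have h3 := mk_prod_one (loopEnum hev hS π) (fun i : S => a i)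
    (restrictedPoly (exponentMatrix .loop a) S) T hT
  have h4 : ∀ z : ℤ, ∀ p q : MvPolynomial S ℂ, Ideal.Quotient.mk
      (jacobianIdeal (restrictedPoly (exponentMatrix .loop a) S))
      (((z : MvPolynomial S ℂ) * (p - q) : MvPolynomial S ℂ) : MvPowerSeries S ℂ) =
      (z : ℂ) • (Ideal.Quotient.mk _ (p : MvPowerSeries S ℂ) -
        Ideal.Quotient.mk _ (q : MvPowerSeries S ℂ)) := by
    intro z p q
    rw [← MvPolynomial.coeToMvPowerSeries.ringHom_apply, map_mul, map_sub, map_intCast, map_mul,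
      map_intCast, map_sub, Int.cast_smul_eq_zsmul, zsmul_eq_mul]
    rfl
  rw [← h2, ← h3, ← h4, ← h1]
  simp only [chernOn, fun t => (restrictTo_koszulPair_loop (a := a) hev _ c hu t).1,
    fun t => (restrictTo_koszulPair_loop (a := a) hev _ c hu t).2]

end Loop

/-! ### The Gram matrix of the two Chern characters of a loop -/

section LoopPairing

variable {n : ℕ} {a : Fin n → ℕ} {S : Finset (Fin n)}

theorem chernOn_loop_even (hn : 0 < n) (hev : Even n) (hS : ∀ i, i ∈ S) :
    chernOn (exponentMatrix .loop a) S (fun t : Fin (n / 2) => koszulPair .loop a (2 * t)) =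
      (∏ j ∈ oddPart S, -(a j : ℂ)) • cls _ (altVec (fun i : S => a i) (oddPart S)) -
        cls _ (altVec (fun i : S => a i) (oddPart S)ᶜ) := by
  have hev' := Nat.div_two_mul_two_of_even hev
  have h1 := chernOn_loop (a := a) hn hev' hS 0 1 (loopEnum_one_val hev' hS) (oddPart S) (by
    intro p
    have h1 := p.1.2
    have h2 := p.2.2
    rw [mem_oddPart, loopEnum_one_val, Nat.mod_eq_of_lt (by omega), Nat.even_iff, Fin.ext_iff,
      Fin.val_zero]
    omega)
  simpa using h1

/-- Starting at the second variable costs the sign of the rotation of n indices, which is -1 for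
even n and exchanges the order of the difference. -/
theorem chernOn_loop_odd (hn : 0 < n) (hev : Even n) (hS : ∀ i, i ∈ S) :
    chernOn (exponentMatrix .loop a) S (fun t : Fin (n / 2) => koszulPair .loop a (2 * t + 1)) =
      cls _ (altVec (fun i : S => a i) (oddPart S)) -
      (∏ j ∈ (oddPart S)ᶜ, -(a j : ℂ)) • cls _ (altVec (fun i : S => a i) (oddPart S)ᶜ) := by
  have hev' := Nat.div_two_mul_two_of_even hev
  have h1 := chernOn_loop (a := a) hn hev' hS 1 (finRotate _) (loopEnum_finRotate_val hev' hS)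
    (oddPart S)ᶜ (by
    intro p
    have h1 := p.1.2
    have h2 := p.2.2
    rw [Finset.mem_compl, mem_oddPart, loopEnum_finRotate_val, Nat.even_iff, Fin.ext_iff,
      Fin.val_zero]
    have h3 : (2 * (p.1 : ℕ) + p.2 + 1) % n % 2 = (2 * p.1 + p.2 + 1) % 2 :=
      Nat.mod_mod_of_dvd _ hev.two_dvd
    omega)
  rw [sign_finRotate_eq (by omega), hev', hev.neg_one_pow, compl_compl, neg_smul, one_smul,
    neg_sub] at h1
  exact h1

/-- Both halves of the loop have n/2 elements, so both monomials have the same weight. -/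
theorem push_sub_smul (hev : Even n) (ha : ∀ i, 2 ≤ a i) (hS : ∀ i, i ∈ S) {t : Fin n → ℂˣ}
    (ht : t ∈ scalingGroup (polyOf (exponentMatrix .loop a))) {c : ℂˣ}
    (hc : ∀ i, ∏ j, t j ^ exponentMatrix .loop a i j = c) (y z : ℂ) :
    restrictedPush (exponentMatrix .loop a) S t ht
      (y • cls _ (altVec (fun i : S => a i) (oddPart S)) -
        z • cls _ (altVec (fun i : S => a i) (oddPart S)ᶜ)) =
      ((c : ℂ) ^ (n / 2))⁻¹ • (y • cls _ (altVec (fun i : S => a i) (oddPart S)) -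
        z • cls _ (altVec (fun i : S => a i) (oddPart S)ᶜ)) := by
  have hev' := Nat.div_two_mul_two_of_even hev
  have hcard : (oddPart S).card = n / 2 := by
    refine card_of_enum (loopEnum hev' hS 1) fun p => ?_
    have h1 := p.1.2
    have h2 := p.2.2
    rw [mem_oddPart, loopEnum_one_val, Nat.mod_eq_of_lt (by omega), Nat.even_iff, Fin.ext_iff,
      Fin.val_zero]
    omega
  have hcard' : (oddPart S)ᶜ.card = n / 2 := by
    rw [Finset.card_compl, hcard, card_of_forall_mem hS]
    omega
  have h1 := restrictedPush_altVec .loop ha (fun _ _ j _ => hS j) (oddPart_alternating hev hS) ht hc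
  have h2 := restrictedPush_altVec .loop ha (fun _ _ j _ => hS j)
    (oddPart_compl_alternating hev hS) ht hc
  rw [map_sub, map_smul, map_smul, h1, h2, hcard, hcard', smul_comm y, smul_comm z, ← smul_sub]

/-- Let P, Q be the two half-loop monomials and B, B' the products of -aⱼ over their supports. Then
P² = B' soc, Q² = B soc, PQ = soc, and soc has residue 1/(BB' - 1). -/
theorem pairing_sub_smul (hn : 0 < n) (hev : Even n) (ha : ∀ i, 2 ≤ a i) (hS : ∀ i, i ∈ S)
    (y z y' z' : ℂ) :
    canonicalPairing (restrictedPoly (exponentMatrix .loop a) S)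
      (restrictedPush (exponentMatrix .loop a) S (zetaElt _) (zetaElt_mem _)
        (y • cls _ (altVec (fun i : S => a i) (oddPart S)) -
          z • cls _ (altVec (fun i : S => a i) (oddPart S)ᶜ)))
      (y' • cls _ (altVec (fun i : S => a i) (oddPart S)) -
        z' • cls _ (altVec (fun i : S => a i) (oddPart S)ᶜ)) =
      (y * y' * (∏ j ∈ (oddPart S)ᶜ, -(a j : ℂ)) - y * z' - z * y' +
        z * z' * ∏ j ∈ oddPart S, -(a j : ℂ)) *
      ((∏ j ∈ oddPart S, -(a j : ℂ)) * (∏ j ∈ (oddPart S)ᶜ, -(a j : ℂ)) - 1)⁻¹ := by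
  have hev' := Nat.div_two_mul_two_of_even hev
  have hpush := push_sub_smul hev ha hS (zetaElt_mem _)
    (prod_zetaElt_pow_row _ (det_exponentMatrix_ne_zero .loop a ha)) y z
  have hw := restrictedPoly_eq .loop ha (fun _ _ j _ => hS j)
  have hsoc : IsSocle (restrictNext (nextOf .loop n) S) (fun i : S => a i) fun i => a i - 1 := by
    intro j
    rw [if_pos]
    rw [restrictNext_loop hS]
    exact ⟨(loopPerm hS).symm j, by simp⟩
  have hnone : ∀ i : S, restrictNext (nextOf .loop n) S i ≠ none := by
    intro i
    rw [restrictNext_loop hS]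
    simp
  have hPP := cls_altVec_square hw ((partialInj_nextOf .loop n).restrictNext S) (fun i => ha i)
    (oddPart_alternating hev hS) (fun i _ => hnone i) hsoc
  have hQQ := cls_altVec_square hw ((partialInj_nextOf .loop n).restrictNext S) (fun i => ha i)
    (oddPart_compl_alternating hev hS) (fun i _ => hnone i) hsoc
  rw [compl_compl] at hQQ
  have hPQ := cls_altVec_mul_compl (restrictedPoly (exponentMatrix .loop a) S) (fun i : S => a i)
    (oddPart S)
  have hres := milnorResidue_socle_loop hn ha hS
  have hall : ∏ i : S, (a i : ℂ) =
      (∏ j ∈ oddPart S, -(a j : ℂ)) * ∏ j ∈ (oddPart S)ᶜ, -(a j : ℂ) := by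
    rw [Finset.prod_mul_prod_compl, Finset.prod_neg, Finset.card_univ, card_of_forall_mem hS,
      hev.neg_one_pow, one_mul]
  rw [hev.neg_one_pow, hall] at hres
  rw [canonicalPairing_push _ ((card_of_forall_mem hS).trans hev'.symm)
    (by simpa using hpush)]
  set P := cls (restrictedPoly (exponentMatrix .loop a) S) (altVec (fun i : S => a i) (oddPart S))
  set Q := cls (restrictedPoly (exponentMatrix .loop a) S) (altVec (fun i : S => a i) (oddPart S)ᶜ)
  set B := ∏ j ∈ oddPart S, -(a j : ℂ)
  set B' := ∏ j ∈ (oddPart S)ᶜ, -(a j : ℂ)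
  have hmul : (y • P - z • Q) * (y' • P - z' • Q) =
      (y * y') • (P * P) - (y * z') • (P * Q) - (z * y') • (P * Q) + (z * z') • (Q * Q) := by
    rw [sub_mul, mul_sub, mul_sub, smul_mul_smul_comm, smul_mul_smul_comm, smul_mul_smul_comm,
      smul_mul_smul_comm, mul_comm Q P]
    abel
  rw [hmul, hPP, hQQ, hPQ]
  simp only [map_add, map_sub, map_smul, smul_eq_mul, hres]
  ring

theorem loop_factor_ne_zero (hn : 0 < n) (hev : Even n) (ha : ∀ i, 2 ≤ a i) (hS : ∀ i, i ∈ S) :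
    (∏ j ∈ oddPart S, -(a j : ℂ)) * (∏ j ∈ (oddPart S)ᶜ, -(a j : ℂ)) - 1 ≠ 0 := by
  rw [Finset.prod_mul_prod_compl, Finset.prod_neg, Finset.card_univ, card_of_forall_mem hS,
    hev.neg_one_pow, one_mul, sub_ne_zero]
  have h1 : ∏ i : S, (a i : ℂ) = ∏ i, (a i : ℂ) :=
    (Equiv.subtypeUnivEquiv hS).prod_comp fun i => (a i : ℂ)
  rw [h1]
  exact prod_ne_one hn ha

theorem prod_oddPart (hev : Even n) (hS : ∀ i, i ∈ S) : ∏ j ∈ oddPart S, -(a j : ℂ) =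
    (-1) ^ (n / 2) * ∏ i ∈ Finset.univ.filter (fun i : Fin n => Even (i : ℕ)), (a i : ℂ) := by
  rw [← (card_even_filter hev).1, ← Finset.prod_neg]
  refine Finset.prod_bij (fun i _ => (i : Fin n)) ?_ ?_ ?_ ?_
  · intro i hi
    simpa [oddPart] using hi
  · intro i _ j _ h
    exact Subtype.ext h
  · intro i hi
    exact ⟨⟨i, hS i⟩, by simpa [oddPart] using hi, rfl⟩
  · intro i _
    rfl

theorem prod_oddPart_compl (hev : Even n) (hS : ∀ i, i ∈ S) :
    ∏ j ∈ (oddPart S)ᶜ, -(a j : ℂ) = (-1) ^ (n / 2) *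
      ∏ i ∈ Finset.univ.filter (fun i : Fin n => ¬ Even (i : ℕ)), (a i : ℂ) := by
  rw [← (card_even_filter hev).2, ← Finset.prod_neg]
  refine Finset.prod_bij (fun i _ => (i : Fin n)) ?_ ?_ ?_ ?_
  · intro i hi
    simpa [oddPart] using hi
  · intro i _ j _ h
    exact Subtype.ext h
  · intro i hi
    exact ⟨⟨i, hS i⟩, by simpa [oddPart] using hi, rfl⟩
  · intro i _
    rfl

theorem chernOn_loop_even_mem (hn : 0 < n) (hev : Even n) (ha : ∀ i, 2 ≤ a i) (hS : ∀ i, i ∈ S)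
    {g : Fin n → ℂˣ} (hg : g ∈ symGroup (exponentMatrix .loop a)) :
    restrictedPush (exponentMatrix .loop a) S g (symmetryGroup_le _ hg)
      (chernOn (exponentMatrix .loop a) S fun t : Fin (n / 2) => koszulPair .loop a (2 * t)) =
      chernOn (exponentMatrix .loop a) S fun t : Fin (n / 2) => koszulPair .loop a (2 * t) := by
  have := push_sub_smul hev ha hS (symmetryGroup_le _ hg) (prod_pow_row_eq_one _ hg)
    (∏ j ∈ oddPart S, -(a j : ℂ)) 1
  rw [chernOn_loop_even hn hev hS]
  simpa using this

theorem chernOn_loop_odd_mem (hn : 0 < n) (hev : Even n) (ha : ∀ i, 2 ≤ a i) (hS : ∀ i, i ∈ S)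
    {g : Fin n → ℂˣ} (hg : g ∈ symGroup (exponentMatrix .loop a)) :
    restrictedPush (exponentMatrix .loop a) S g (symmetryGroup_le _ hg)
      (chernOn (exponentMatrix .loop a) S fun t : Fin (n / 2) => koszulPair .loop a (2 * t + 1)) =
      chernOn (exponentMatrix .loop a) S fun t : Fin (n / 2) => koszulPair .loop a (2 * t + 1) := by
  have := push_sub_smul hev ha hS (symmetryGroup_le _ hg) (prod_pow_row_eq_one _ hg) 1
    (∏ j ∈ (oddPart S)ᶜ, -(a j : ℂ))
  rw [chernOn_loop_odd hn hev hS]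
  simpa using this

/-- The pairings of the two Chern characters in the untwisted sector of a loop. -/
theorem canonicalPairing_chern_loop (hn : 0 < n) (hev : Even n) (ha : ∀ i, 2 ≤ a i)
    (hS : ∀ i, i ∈ S) {odd even : FormSpace (restrictedPoly (exponentMatrix .loop a) S)}
    (hodd : odd = chernOn (exponentMatrix .loop a) S
      fun t : Fin (n / 2) => koszulPair .loop a (2 * t + 1))
    (heven : even = chernOn (exponentMatrix .loop a) S
      fun t : Fin (n / 2) => koszulPair .loop a (2 * t))
    {pair : FormSpace (restrictedPoly (exponentMatrix .loop a) S) →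
      FormSpace (restrictedPoly (exponentMatrix .loop a) S) → ℂ}
    (hpair : ∀ x y, pair x y = canonicalPairing (restrictedPoly (exponentMatrix .loop a) S)
      (restrictedPush (exponentMatrix .loop a) S (zetaElt _) (zetaElt_mem _) x) y) :
    pair odd odd = (-1) ^ (n / 2) *
      ∏ i ∈ Finset.univ.filter (fun i : Fin n => ¬ Even (i : ℕ)), (a i : ℂ) ∧
    pair even even = (-1) ^ (n / 2) *
      ∏ i ∈ Finset.univ.filter (fun i : Fin n => Even (i : ℕ)), (a i : ℂ) ∧
    pair odd even = 1 ∧ pair even odd = 1 := by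
  have hne := loop_factor_ne_zero hn hev ha hS
  have hform := pairing_sub_smul hn hev ha hS
  rw [chernOn_loop_odd hn hev hS, ← one_smul ℂ (cls _ (altVec (fun i : S => a i) (oddPart S)))]
    at hodd
  rw [chernOn_loop_even hn hev hS, ← one_smul ℂ (cls _ (altVec (fun i : S => a i) (oddPart S)ᶜ))]
    at heven
  rw [← prod_oddPart hev hS, ← prod_oddPart_compl hev hS]
  subst hodd heven
  simp only [hpair, hform, ← div_eq_mul_inv, div_eq_iff hne]
  refine ⟨?_, ?_, ?_, ?_⟩ <;> ring

end LoopPairing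

/-! ## The mirror map -/

section Mirror

variable (τ : AtomicType) {n : ℕ} (a : Fin n → ℕ)

open Classical in
/-- The value of the mirror map on a standard monomial, as a form on a coordinate subspace. -/
noncomputable def mirrorForm (m : Fin n → ℕ) (S : Finset (Fin n)) :
    FormSpace (restrictedPoly (exponentMatrix τ a) S) :=
  match τ with
  | .chain => if h : ∃ k, 1 ≤ k ∧ IsChainStandard a k m then
      chernOn _ S fun t : Fin h.choose => koszulPair .chain a (n - 2 * h.choose + 2 * t) else 1
  | .loop => if Even n ∧ m = oddVec a then
      chernOn _ S fun t : Fin (n / 2) => koszulPair .loop a (2 * t + 1) else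
      if Even n ∧ m = evenVec a then
        chernOn _ S fun t : Fin (n / 2) => koszulPair .loop a (2 * t) else 1

/-- Since `mirrorForm` is defined for every set of coordinates, transport between equal sets is
harmless, and the values in the sectors of γ and γ⁻¹ can be compared. -/
theorem formCast_mirrorForm (m : Fin n → ℕ) {S T : Finset (Fin n)} (h : S = T) :
    formCast _ h (mirrorForm τ a m S) = mirrorForm τ a m T := by
  subst h
  rfl

variable {τ a}

/-- The number 2k is recovered as the number of fixed variables of ℑ(m). -/
theorem IsChainStandard.unique (ha : ∀ i, 2 ≤ a i) {m : Fin n → ℕ} {k k' : ℕ}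
    (hm : IsChainStandard a k m) (hm' : IsChainStandard a k' m) : k = k' := by
  have key : ∀ k k', IsChainStandard a k m → IsChainStandard a k' m → k ≤ k' := by
    intro k k' hm hm'
    by_contra! hlt
    have h1 := hm.1
    have h2 := chain_mem_fixedVars_iff ha hm ⟨n - 2 * k, by omega⟩
    have h3 := chain_mem_fixedVars_iff ha hm' ⟨n - 2 * k, by omega⟩
    have h4 := h2.symm.trans h3
    simp only at h4
    omega
  exact le_antisymm (key _ _ hm hm') (key _ _ hm' hm)

theorem mirrorForm_chain (ha : ∀ i, 2 ≤ a i) {m : Fin n → ℕ} {k : ℕ} (hk : 1 ≤ k)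
    (hm : IsChainStandard a k m) (S : Finset (Fin n)) : mirrorForm .chain a m S =
      chernOn _ S fun t : Fin k => koszulPair .chain a (n - 2 * k + 2 * t) := by
  have h : ∃ k, 1 ≤ k ∧ IsChainStandard a k m := ⟨k, hk, hm⟩
  have hc : h.choose = k := IsChainStandard.unique ha h.choose_spec.2 hm
  rw [mirrorForm, dif_pos h, hc]

theorem mirrorForm_chain_zero (ha : ∀ i, 2 ≤ a i) {m : Fin n → ℕ} (hm : IsChainStandard a 0 m)
    (S : Finset (Fin n)) : mirrorForm .chain a m S = 1 := by
  refine dif_neg ?_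
  rintro ⟨k, hk, hm'⟩
  have := IsChainStandard.unique ha hm hm'
  omega

theorem mirrorForm_oddVec (hev : Even n) (S : Finset (Fin n)) : mirrorForm .loop a (oddVec a) S =
    chernOn _ S fun t : Fin (n / 2) => koszulPair .loop a (2 * t + 1) :=
  if_pos ⟨hev, rfl⟩

theorem mirrorForm_evenVec (hn : 0 < n) (ha : ∀ i, 2 ≤ a i) (hev : Even n) (S : Finset (Fin n)) :
    mirrorForm .loop a (evenVec a) S =
      chernOn _ S fun t : Fin (n / 2) => koszulPair .loop a (2 * t) := by
  rw [mirrorForm, if_neg, if_pos ⟨hev, rfl⟩]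
  rintro ⟨-, h⟩
  exact oddVec_ne_evenVec hn ha h.symm

theorem fixedVars_chain_zero (ha : ∀ i, 2 ≤ a i) {m : Fin n → ℕ} (hm : IsChainStandard a 0 m) :
    fixedVars (groupElt (exponentMatrix .chain a) m : Fin n → ℂˣ) = ∅ := by
  refine Finset.eq_empty_iff_forall_notMem.mpr fun i hi => ?_
  rw [chain_mem_fixedVars_iff ha hm] at hi
  have := i.2
  omega

/-- The vectors of the other clauses have fixed variables: all of them for m^odd and m^even, the
last 2k ≥ 2 for a chain vector with k ≥ 1. -/
theorem mirrorForm_narrow (hn : 0 < n) (ha : ∀ i, 2 ≤ a i) {m : Fin n → ℕ}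
    (hm : IsStandard τ a m)
    (h : fixedVars (groupElt (exponentMatrix τ a) m : Fin n → ℂˣ) = ∅) (S : Finset (Fin n)) :
    mirrorForm τ a m S = 1 := by
  cases τ
  · obtain ⟨k, hm⟩ := hm
    obtain rfl : k = 0 := by
      by_contra hk
      have h1 := hm.1
      have h2 := (chain_mem_fixedVars_iff ha hm ⟨n - 2 * k, by omega⟩).mpr (by simp only; omega)
      rw [h] at h2
      exact Finset.notMem_empty _ h2
    exact mirrorForm_chain_zero ha hm S
  · have hne : (Finset.univ : Finset (Fin n)) ≠ ∅ :=
      Finset.ne_empty_of_mem (Finset.mem_univ ⟨0, hn⟩)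
    rw [mirrorForm, if_neg, if_neg]
    · rintro ⟨hev, rfl⟩
      exact hne ((fixedVars_evenVec hev ha).symm.trans h)
    · rintro ⟨hev, rfl⟩
      exact hne ((fixedVars_oddVec hev ha).symm.trans h)

theorem mirrorForm_mem (hn : 0 < n) (ha : ∀ i, 2 ≤ a i) {m : Fin n → ℕ}
    (hm : IsStandard τ a m) :
    mirrorForm τ a m (fixedVars (groupElt (exponentMatrix τ a) m : Fin n → ℂˣ)) ∈
      sector (exponentMatrix τ a) (groupElt _ m) := by
  intro g hg
  by_cases hf : fixedVars (groupElt (exponentMatrix τ a) m : Fin n → ℂˣ) = ∅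
  · rw [mirrorForm_narrow hn ha hm hf]
    exact restrictedPush_one_of_empty _ hf _
  cases τ
  · obtain ⟨k, hm⟩ := hm
    have hk : 1 ≤ k := by
      by_contra hk
      obtain rfl : k = 0 := by omega
      exact hf (fixedVars_chain_zero ha hm)
    rw [mirrorForm_chain ha hk hm]
    exact chernOn_chain_mem ha hm.1 (chain_mem_fixedVars_iff ha hm) hg
  · obtain ⟨hev, rfl | rfl⟩ := (loop_fixedVars_cases hn ha hm).resolve_left hf
    · rw [mirrorForm_oddVec hev]
      exact chernOn_loop_odd_mem hn hev ha
        (fun i => (fixedVars_oddVec hev ha).symm ▸ Finset.mem_univ i) hg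
    · rw [mirrorForm_evenVec hn ha hev]
      exact chernOn_loop_even_mem hn hev ha
        (fun i => (fixedVars_evenVec hev ha).symm ▸ Finset.mem_univ i) hg

/-- The classification of fixed variables shows that the clauses cover all standard vectors without
conflict, so they amount to one prescribed value for each of them. -/
theorem isMirrorMap_iff (hn : 0 < n) (ha : ∀ i, 2 ≤ a i)
    (θ : MilnorRing (dualPoly τ a) →ₗ[ℂ] StateSpace (exponentMatrix τ a)) :
    IsMirrorMap τ a θ ↔ ∀ m, IsStandard τ a m →
      IsSectorElt _ (θ (mono τ a m)) (groupElt _ m) (mirrorForm τ a m _) := by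
  constructor
  · intro h m hm
    by_cases hf : fixedVars (groupElt (exponentMatrix τ a) m : Fin n → ℂˣ) = ∅
    · rw [mirrorForm_narrow hn ha hm hf]
      exact h.narrow m hm hf
    cases τ
    · obtain ⟨k, hm⟩ := hm
      have hk : 1 ≤ k := by
        by_contra hk
        obtain rfl : k = 0 := by omega
        exact hf (fixedVars_chain_zero ha hm)
      rw [mirrorForm_chain ha hk hm]
      exact h.chain_broad rfl k m hk hm
    · obtain ⟨hev, rfl | rfl⟩ := (loop_fixedVars_cases hn ha hm).resolve_left hf
      · rw [mirrorForm_oddVec hev]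
        exact h.loop_odd rfl hev
      · rw [mirrorForm_evenVec hn ha hev]
        exact h.loop_even rfl hev
  · intro h
    refine ⟨fun m hm hf => ?_, ?_, ?_, ?_⟩
    · have := h m hm
      rwa [mirrorForm_narrow hn ha hm hf] at this
    · rintro rfl hev
      have := h (oddVec a) (oddVec_lt ha)
      rwa [mirrorForm_oddVec hev] at this
    · rintro rfl hev
      have := h (evenVec a) (evenVec_lt ha)
      rwa [mirrorForm_evenVec hn ha hev] at this
    · rintro rfl k m hk hm
      have := h m ⟨k, hm⟩
      rwa [mirrorForm_chain ha hk hm] at this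

theorem IsSectorElt.eq {E : Matrix (Fin n) (Fin n) ℕ} {v v' : StateSpace E} {γ : symGroup E}
    {h : FormSpace (restrictedPoly E (fixedVars (γ : Fin n → ℂˣ)))} (hv : IsSectorElt E v γ h)
    (hv' : IsSectorElt E v' γ h) : v = v' := by
  obtain ⟨x, hx, rfl⟩ := hv
  obtain ⟨x', hx', rfl⟩ := hv'
  rw [Subtype.ext (hx.trans hx'.symm)]

/-- The values on the basis of standard monomials are prescribed, and they are G_w-invariant by
`mirrorForm_mem`. -/
theorem existsUnique_mirrorMap (hn : 0 < n) (ha : ∀ i, 2 ≤ a i) :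
    ∃! θ : MilnorRing (dualPoly τ a) →ₗ[ℂ] StateSpace (exponentMatrix τ a),
      IsMirrorMap τ a θ := by
  classical
  refine ⟨(standardBasis τ hn ha).constr ℂ fun m => DirectSum.lof ℂ _
    (fun γ => sector (exponentMatrix τ a) γ) (groupElt _ m.1) ⟨_, mirrorForm_mem hn ha m.2⟩, ?_, ?_⟩
  · refine (isMirrorMap_iff hn ha _).mpr fun m hm => ⟨⟨_, mirrorForm_mem hn ha hm⟩, rfl, ?_⟩
    rw [← standardBasis_apply τ hn ha ⟨m, hm⟩, Module.Basis.constr_basis]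
  · intro θ hθ
    rw [isMirrorMap_iff hn ha] at hθ
    refine (standardBasis τ hn ha).ext fun m => ?_
    rw [Module.Basis.constr_basis, standardBasis_apply]
    refine (hθ m.1 m.2).eq ⟨⟨_, mirrorForm_mem hn ha m.2⟩, rfl, ?_⟩
    congr!

/-- Comparison case by case over the pairs left by the lattice condition. The complementary pair
m^odd, m^even, which lies in the untwisted sector, also pairs to 1. -/
theorem canonicalPairing_mirrorForm (hn : 0 < n) (ha : ∀ i, 2 ≤ a i) {m m' : Fin n → ℕ}
    (hm : IsStandard τ a m) (hm' : IsStandard τ a m')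
    (h : InLattice (exponentMatrix τ a) fun i => (m i : ℤ) + m' i + 2)
    (hf : fixedVars (groupElt (exponentMatrix τ a) m' : Fin n → ℂˣ) =
      fixedVars (groupElt (exponentMatrix τ a) m : Fin n → ℂˣ)) :
    canonicalPairing (restrictedPoly (exponentMatrix τ a)
        (fixedVars (groupElt (exponentMatrix τ a) m : Fin n → ℂˣ)))
      (restrictedPush (exponentMatrix τ a) _ (zetaElt _) (zetaElt_mem _) (mirrorForm τ a m _))
      (mirrorForm τ a m' _) * monoRes τ a (socleVec τ a) = monoRes τ a (m + m') := by
  cases τ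
  · obtain ⟨k, hm⟩ := hm
    obtain ⟨k', hm'⟩ := hm'
    obtain ⟨rfl, hsum⟩ := chain_pair_cases ha hm hm' h
    rw [monoRes_chain ha hm hm' hsum]
    congr 1
    rcases Nat.eq_zero_or_pos k with rfl | hk
    · rw [mirrorForm_chain_zero ha hm, mirrorForm_chain_zero ha hm',
        canonicalPairing_one_of_empty .chain ha (fixedVars_chain_zero ha hm),
        Finset.prod_eq_one]
      intro i hi
      simp only [chainTail, Finset.mem_filter, Finset.mem_univ, true_and] at hi
      have := i.2
      omega
    · rw [mirrorForm_chain ha hk hm, mirrorForm_chain ha hk hm']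
      exact canonicalPairing_chern_chain ha hm.1 (chain_mem_fixedVars_iff ha hm)
  · have hbox := loop_fixedVars_cases hn ha hm
    have hcompl : ∀ m₀ m₁ : Fin n → ℕ, m₀ + m₁ = socleVec .loop a → m = m₀ →
        (∀ i, m i + m' i = a i - 1) → m' = m₁ := by
      rintro m₀ m₁ h1 rfl h2
      funext i
      have e1 := congrFun h1 i
      have e2 := h2 i
      simp only [Pi.add_apply, socleVec] at e1
      omega
    rcases loop_pair_cases hn ha hm hm' h with hsum | ⟨hev, ⟨rfl, rfl⟩ | ⟨rfl, rfl⟩⟩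
    · have hs : m + m' = socleVec .loop a := funext hsum
      rw [hs]
      refine mul_eq_right₀ (monoRes_socle_loop_ne_zero hn ha) |>.mpr ?_
      rcases hbox with he | ⟨hev, hoe⟩
      · rw [mirrorForm_narrow hn ha hm he, mirrorForm_narrow hn ha hm' (hf.trans he)]
        exact canonicalPairing_one_of_empty .loop ha he
      · rcases hoe with hodd | heven
        · obtain rfl := hcompl _ _ oddVec_add_evenVec hodd hsum
          subst hodd
          rw [mirrorForm_oddVec hev, mirrorForm_evenVec hn ha hev]
          exact (canonicalPairing_chern_loop hn hev ha
            (fun i => (fixedVars_oddVec hev ha).symm ▸ Finset.mem_univ i) rfl rfl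
            fun _ _ => rfl).2.2.1
        · obtain rfl := hcompl _ _ ((add_comm _ _).trans oddVec_add_evenVec) heven hsum
          subst heven
          rw [mirrorForm_oddVec hev, mirrorForm_evenVec hn ha hev]
          exact (canonicalPairing_chern_loop hn hev ha
            (fun i => (fixedVars_evenVec hev ha).symm ▸ Finset.mem_univ i) rfl rfl
            fun _ _ => rfl).2.2.2
    · rw [monoRes_oddVec hev ha, mirrorForm_oddVec hev]
      congr 1
      exact (canonicalPairing_chern_loop hn hev ha
        (fun i => (fixedVars_oddVec hev ha).symm ▸ Finset.mem_univ i) rfl rfl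
        fun _ _ => rfl).1
    · rw [monoRes_evenVec hev ha, mirrorForm_evenVec hn ha hev]
      congr 1
      exact (canonicalPairing_chern_loop hn hev ha
        (fun i => (fixedVars_evenVec hev ha).symm ▸ Finset.mem_univ i) rfl rfl
        fun _ _ => rfl).2.1

theorem monoRes_socle_ne_zero (hn : 0 < n) (ha : ∀ i, 2 ≤ a i) :
    monoRes τ a (socleVec τ a) ≠ 0 := by
  cases τ
  · exact monoRes_socle_chain_ne_zero ha
  · exact monoRes_socle_loop_ne_zero hn ha

/-- The lattice condition on m + m' + 2 decides. If it fails, the sectors are not inverse to each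
other and the residue vanishes, so both sides are 0. -/
theorem normalizedResidue_mono_eq (hn : 0 < n) (ha : ∀ i, 2 ≤ a i)
    {θ : MilnorRing (dualPoly τ a) →ₗ[ℂ] StateSpace (exponentMatrix τ a)}
    (hθ : IsMirrorMap τ a θ) {m m' : Fin n → ℕ} (hm : IsStandard τ a m)
    (hm' : IsStandard τ a m') :
    normalizedResidue τ a (mono τ a m) (mono τ a m') =
      statePairing (exponentMatrix τ a) (θ (mono τ a m)) (θ (mono τ a m')) := by
  rw [isMirrorMap_iff hn ha] at hθ
  have hv := hθ m hm
  have hv' := hθ m' hm'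
  have hinv := groupElt_eq_inv_iff (det_exponentMatrix_ne_zero τ a ha) m m'
  rw [normalizedResidue_mono]
  by_cases h : InLattice (exponentMatrix τ a) fun i => (m i : ℤ) + m' i + 2
  · rw [statePairing_eq _ (hinv.mpr h) hv hv', formCast_mirrorForm,
      div_eq_iff (monoRes_socle_ne_zero hn ha)]
    exact (canonicalPairing_mirrorForm hn ha hm hm' h
      (fixedVars_eq_of_eq_inv _ (hinv.mpr h))).symm
  · rw [statePairing_eq_zero _ (fun h' => h (hinv.mp h')) hv hv']
    have : monoRes τ a (m + m') = 0 := by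
      by_contra h'
      exact h (inLattice_of_monoRes_ne_zero τ ha h')
    rw [this, zero_div]

theorem normalizedResidue_eq (hn : 0 < n) (ha : ∀ i, 2 ≤ a i)
    {θ : MilnorRing (dualPoly τ a) →ₗ[ℂ] StateSpace (exponentMatrix τ a)}
    (hθ : IsMirrorMap τ a θ) (f g : MilnorRing (dualPoly τ a)) :
    normalizedResidue τ a f g = statePairing (exponentMatrix τ a) (θ f) (θ g) := by
  have h1 : (milnorResidue (dualPoly τ a) (mono τ a (socleVec τ a)))⁻¹ •
      (LinearMap.mul ℂ (MilnorRing (dualPoly τ a))).compr₂ (milnorResidue (dualPoly τ a)) =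
      (statePairing (exponentMatrix τ a)).compl₁₂ θ θ := by
    refine LinearMap.ext_basis (standardBasis τ hn ha) (standardBasis τ hn ha) fun m m' => ?_
    rw [standardBasis_apply, standardBasis_apply]
    have := normalizedResidue_mono_eq hn ha hθ m.2 m'.2
    rw [normalizedResidue, div_eq_inv_mul] at this
    exact this
  have h2 := congrArg (fun B => B f g) h1
  rw [normalizedResidue, div_eq_inv_mul]
  exact h2

end Mirror

end LGMirror

open LGMirror
theorem mainTheorem9 (τ : AtomicType) {n : ℕ} (hn : 0 < n) (a : Fin n → ℕ)
    (ha : ∀ i, 2 ≤ a i) :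
    (∃! θ : MilnorRing (dualPoly τ a) →ₗ[ℂ] StateSpace (exponentMatrix τ a),
      IsMirrorMap τ a θ) ∧
    ∀ θ : MilnorRing (dualPoly τ a) →ₗ[ℂ] StateSpace (exponentMatrix τ a),
      IsMirrorMap τ a θ →
      (∀ m m' : Fin n → ℕ, IsStandard τ a m → IsStandard τ a m' →
        normalizedResidue τ a (mono τ a m) (mono τ a m') =
          statePairing (exponentMatrix τ a) (θ (mono τ a m)) (θ (mono τ a m'))) ∧
      ∀ f g : MilnorRing (dualPoly τ a),
        normalizedResidue τ a f g = statePairing (exponentMatrix τ a) (θ f) (θ g) :=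
  ⟨existsUnique_mirrorMap hn ha, fun _ hθ =>
    ⟨fun _ _ hm hm' => normalizedResidue_mono_eq hn ha hθ hm hm',
      normalizedResidue_eq hn ha hθ⟩⟩
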